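/- \textbf{Setting.} Let $d,k\in\mathbb N$ with $d\ge 1$, $k>d/2$, and let $1\le q\le\infty$. Let $H^k_0(\mathbb T^d)$ be the space of $k$-th order $L^2$-Sobolev functions with mean zero on the torus $\mathbb T^d=\mathbb R^d/\mathbb Z^d$ (identified with their continuous representatives), with inner product $\langle f,g\rangle_{H^k_0}=\langle D^kf,D^kg\rangle_{L^2}=\sum_{i_1,\dots,i_k=1}^d\int_{\mathbb T^d}\partial_{i_1}\cdots\partial_{i_k}f\;\partial_{i_1}\cdots\partial_{i_k}g\,dx$ and norm $\|D^kf\|_{L^2}$. For $n=N^d$, $N\in\mathbb N$, $N\ge1$, let $\Gamma_n=\{(\tau_1/N,\dots,\tau_d/N):\tau_i\in\{0,\dots,N-1\}\}$ and let $S_nf=(f(x))_{x\in\Gamma_n}$. A cube is a set $B=\prod_{i=1}^d[a_i,a_i+h)\subseteq[0,1]^d$ with $0<h\le 1$, and $|B|=h^d$. Let $\mathcal B$ be a \emph{normal} system of cubes, i.e. there is $c>1$ such that every cube $B$ contains some $\tilde B\in\mathcal B$ with $|\tilde B|\ge|B|/c$. For $y\in\mathbb R^{\Gamma_n}$ put $$\|y\|_{\mathcal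 B}=\sup_{B\in\mathcal B}\frac1{\sqrt{\#(\Gamma_n\cap B)}}\Bigl|\sum_{x\in\Gamma_n\cap B}y(x)\Bigr|$$ (terms with $\Gamma_n\cap B=\emptyset$ being $0$) and, for $\omega\in\mathbb R^{\Gamma_n}$, $\|\omega\|_{\mathcal B^*}=\sup\{\sum_{x\in\Gamma_n}\omega(x)v(x):\|v\|_{\mathcal B}\le1\}\in[0,\infty]$. Let $f\in H^k_0(\mathbb T^d)$ and $\sigma>0$. For every $n=N^d$ let $y_n=S_nf+\xi_n$, where $(\xi_n(x))_{x\in\Gamma_n}$ are i.i.d. with $\mathbb E\,e^{\tau\xi_n(x)}\le e^{\tau^2\sigma^2/2}$ for all $\tau\in\mathbb R$. Let $$\gamma_n=C(\log n)^r,\qquad r\ge\tfrac12,\quad C>0,\quad\text{and } C>\sigma\sqrt{5+2k/d}\ \text{ if } r=\tfrac12,$$ and let $\hat f_{\gamma_n}$ be the MIND estimator, i.e. the minimizer of $\frac12\|D^kg\|_{L^2}^2$ over all $g\in H^k_0(\mathbb T^d)$ with $\|S_ng-y_n\|_{\mathcal B}\le\gamma_n$. Let $S_n^*:\mathbb R^{\Gamma_n}\to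 H^k_0(\mathbb T^d)$ be the adjoint of $S_n$, i.e. $\sum_{x\in\Gamma_n}g(x)\omega(x)=\langle g,S_n^*\omega\rangle_{H^k_0}$ for all $g\in H^k_0(\mathbb T^d)$, and let $d_n(t)=\inf_{\|\omega\|_{\mathcal B^*}\le t}\|D^kS_n^*\omega-D^kf\|_{L^2}$ for $t\ge0$. Finally put $$\vartheta=\begin{cases}\dfrac{k}{2k+d}&\text{if }q\le\dfrac{4k+2d}{d},\\[2mm]\dfrac{k-d/2+d/q}{2k}&\text{if }q\ge\dfrac{4k+2d}{d}.\end{cases}$$ \textbf{Theorem.} Assume that, for some $0\le\mu<\frac12$, $$\inf_{t\ge0}\bigl(d_n(t)+(\log n)^{r/2}t^{1/2}\bigr)=O(n^{-\mu})\qquad\text{as } n=N^d\to\infty.$$ Then $\|\hat f_{\gamma_n}-f\|_{L^q}$ is integrable for every $n=N^d$, $N\ge1$, and $$\mathbb E\,\|\hat f_{\gamma_n}-f\|_{L^q}=O\bigl(n^{-\mu(1-2\vartheta)-\vartheta}(\log n)^{2r\vartheta}\bigr)\qquad\text{as } n=N^d\to\infty.$$ -/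

import Mathlib

open MeasureTheory ProbabilityTheory Filter Asymptotics
open scoped ENNReal NNReal

namespace MIND

/-! ### Periodic functions, weak derivatives and the space `H^k_0` on the torus -/

/-- Functions on the torus `ℝ^d / ℤ^d` are treated as `1`-periodic functions on `ℝ^d`. -/
def Periodic {d : ℕ} (f : (Fin d → ℝ) → ℝ) : Prop :=
  ∀ (x : Fin d → ℝ) (i : Fin d), f (x + Pi.single i 1) = f x

/-- Lebesgue measure on the period cell `[0,1]^d`. -/
noncomputable def cellMeasure (d : ℕ) : Measure (Fin d → ℝ) :=
  volume.restrict (Set.Icc 0 1)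

/-- `g` is the weak derivative `∂_{i 0} ⋯ ∂_{i (j-1)} f` on the torus, tested against all smooth
periodic functions. -/
def IsWeakDeriv {d j : ℕ} (i : Fin j → Fin d) (f g : (Fin d → ℝ) → ℝ) : Prop :=
  ∀ φ : (Fin d → ℝ) → ℝ, ContDiff ℝ ((⊤ : ℕ∞) : WithTop ℕ∞) φ → Periodic φ →
    ∫ x, f x * iteratedFDeriv ℝ j φ x (fun l => Pi.single (i l) 1) ∂(cellMeasure d) =
      (-1) ^ j * ∫ x, g x * φ x ∂(cellMeasure d)

open Classical in
/-- The weak derivative of `f` along the directions `i` (unique almost everywhere on the cell),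
if there is one in `L²`; otherwise `0`. -/
noncomputable def weakDeriv {d j : ℕ} (i : Fin j → Fin d) (f : (Fin d → ℝ) → ℝ) :
    (Fin d → ℝ) → ℝ :=
  if h : ∃ g : (Fin d → ℝ) → ℝ, MemLp g 2 (cellMeasure d) ∧ IsWeakDeriv i f g
  then h.choose else 0

/-- The space `H^k_0` of periodic functions with mean zero whose weak derivatives up to
order `k` are in `L²`. Used for `k > d/2` only, where each Sobolev class has exactly one continuous
representative; the elements are these representatives, so that point values make sense. -/
structure MemHk0 {d : ℕ} (k : ℕ) (f : (Fin d → ℝ) → ℝ) : Prop where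
  continuous : Continuous f
  periodic : Periodic f
  mean_zero : ∫ x, f x ∂(cellMeasure d) = 0
  exists_weakDeriv : ∀ j ≤ k, ∀ i : Fin j → Fin d,
    ∃ g : (Fin d → ℝ) → ℝ, MemLp g 2 (cellMeasure d) ∧ IsWeakDeriv i f g

/-- The inner product `⟨D^k f, D^k g⟩_{L²}`, where `D^k` is the full tensor of all `k`-th order
partial derivatives. -/
noncomputable def sobolevInner {d : ℕ} (k : ℕ) (f g : (Fin d → ℝ) → ℝ) : ℝ :=
  ∑ i : Fin k → Fin d, ∫ x, weakDeriv i f x * weakDeriv i g x ∂(cellMeasure d)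

/-- The homogeneous Sobolev norm `‖D^k f‖_{L²}`. -/
noncomputable def sobolevNorm {d : ℕ} (k : ℕ) (f : (Fin d → ℝ) → ℝ) : ℝ :=
  √(sobolevInner k f f)

/-- The norm `‖f‖_{L^q}` on the torus, `1 ≤ q ≤ ∞`. -/
noncomputable def lqNorm {d : ℕ} (q : ℝ≥0∞) (f : (Fin d → ℝ) → ℝ) : ℝ :=
  (eLpNorm f q (cellMeasure d)).toReal

/-! ### Cubes, sampling and the multiresolution norm -/

/-- The cubes `∏ [a_i, a_i + h)` contained in `[0,1]^d`. -/
structure Cube (d : ℕ) where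
  corner : Fin d → ℝ
  side : ℝ
  side_pos : 0 < side
  side_le_one : side ≤ 1
  corner_nonneg : ∀ i, 0 ≤ corner i
  corner_add_side_le_one : ∀ i, corner i + side ≤ 1

/-- The set of points of a cube. -/
def Cube.toSet {d : ℕ} (B : Cube d) : Set (Fin d → ℝ) :=
  {x | ∀ i, x i ∈ Set.Ico (B.corner i) (B.corner i + B.side)}

/-- The volume of a cube. -/
def Cube.vol {d : ℕ} (B : Cube d) : ℝ := B.side ^ d

/-- Normal systems of cubes. -/
def IsNormal {d : ℕ} (𝓑 : Set (Cube d)) : Prop :=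
  ∃ c : ℝ, 1 < c ∧ ∀ B : Cube d, ∃ B' ∈ 𝓑, B'.toSet ⊆ B.toSet ∧ B.vol / c ≤ B'.vol

/-- The point `(τ_1 / N, …, τ_d / N)` of the regular grid with `n = N ^ d` points. Vectors indexed
by the grid are functions on `Fin d → Fin N`. -/
noncomputable def gridPoint {d N : ℕ} (τ : Fin d → Fin N) : Fin d → ℝ :=
  fun i => ((τ i : ℕ) : ℝ) / (N : ℝ)

/-- The sampling operator `S_n`, `n = N ^ d`. -/
noncomputable def sample {d : ℕ} (N : ℕ) (f : (Fin d → ℝ) → ℝ) : (Fin d → Fin N) → ℝ :=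
  fun τ => f (gridPoint τ)

open Classical in
/-- The grid points inside a cube. -/
noncomputable def Cube.gridPoints {d : ℕ} (N : ℕ) (B : Cube d) : Finset (Fin d → Fin N) :=
  Finset.univ.filter fun τ => gridPoint τ ∈ B.toSet

/-- The multiresolution norm; a cube without grid points contributes `0 / 0 = 0`. -/
noncomputable def mrNorm {d N : ℕ} (𝓑 : Set (Cube d)) (y : (Fin d → Fin N) → ℝ) : ℝ :=
  ⨆ B : 𝓑, |∑ τ ∈ (B : Cube d).gridPoints N, y τ| / √((((B : Cube d).gridPoints N).card : ℕ) : ℝ)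

/-- The dual multiresolution norm (infinite if the multiresolution norm is only a seminorm and `w`
does not vanish on its kernel). -/
noncomputable def dualMRNorm {d N : ℕ} (𝓑 : Set (Cube d)) (w : (Fin d → Fin N) → ℝ) : ℝ≥0∞ :=
  ⨆ (v : (Fin d → Fin N) → ℝ) (_ : mrNorm 𝓑 v ≤ 1), ENNReal.ofReal (∑ τ, w τ * v τ)

/-! ### The adjoint of sampling, the distance function and the estimator -/

/-- `u = S_n^* w`, the adjoint being taken with respect to the inner product of `H^k_0`. -/
def IsSampleAdjoint {d N : ℕ} (k : ℕ) (w : (Fin d → Fin N) → ℝ) (u : (Fin d → ℝ) → ℝ) : Prop :=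
  MemHk0 k u ∧ ∀ g : (Fin d → ℝ) → ℝ, MemHk0 k g →
    ∑ τ, sample N g τ * w τ = sobolevInner k g u

/-- The multiscale distance function `d_n(t)` of `f`, `n = N ^ d`. -/
noncomputable def distFun {d : ℕ} (k : ℕ) (𝓑 : Set (Cube d)) (f : (Fin d → ℝ) → ℝ) (N : ℕ)
    (t : ℝ) : ℝ :=
  sInf {s : ℝ | ∃ (w : (Fin d → Fin N) → ℝ) (u : (Fin d → ℝ) → ℝ),
    dualMRNorm 𝓑 w ≤ ENNReal.ofReal t ∧ IsSampleAdjoint k w u ∧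
      s = sobolevNorm k (fun x => u x - f x)}

/-- `u` is the MIND estimator for the data `y` and the threshold `γ`: it minimizes
`½ ‖D^k u‖²` over `H^k_0` subject to `‖S_n u - y‖_𝓑 ≤ γ`. -/
def IsMIND {d N : ℕ} (k : ℕ) (𝓑 : Set (Cube d)) (y : (Fin d → Fin N) → ℝ) (γ : ℝ)
    (u : (Fin d → ℝ) → ℝ) : Prop :=
  MemHk0 k u ∧ mrNorm 𝓑 (sample N u - y) ≤ γ ∧
    ∀ g : (Fin d → ℝ) → ℝ, MemHk0 k g → mrNorm 𝓑 (sample N g - y) ≤ γ →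
      1 / 2 * sobolevNorm k u ^ 2 ≤ 1 / 2 * sobolevNorm k g ^ 2

open Classical in
/-- The exponent `ϑ(k, d, q)`. -/
noncomputable def theta (k d : ℕ) (q : ℝ≥0∞) : ℝ :=
  if q ≤ ENNReal.ofReal ((4 * k + 2 * d) / d) then (k : ℝ) / (2 * k + d)
  else ((k : ℝ) - d / 2 + d * (q⁻¹).toReal) / (2 * k)

end MIND

open MIND

/-! Write n = N^d, A = 2γ_n/√n, and e for the error of the estimator. Three ingredients are
combined: a deterministic bound for ‖D^k e‖ when the noise is small, an interpolation inequality
turning it into an L^q bound, and a crude bound that makes the event of large noise negligible.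

Small noise. If the multiresolution norm of the noise is at most γ_n, then f is feasible. Minimality
gives ⟨u, e⟩ ≤ 0 for the estimator u (`IsMIND.inner_nonneg`). Hence, for v = S_n^* ω with dual norm
of ω at most t, ‖D^k e‖² ≤ ⟨v - f, e⟩ - ∑ ω e ≤ ‖D^k(v - f)‖ ‖D^k e‖ + 2γ_n t. Optimising over ω and
t yields ‖D^k e‖ = O(n^{-μ}) (`IsMIND.sobolevNorm_sub_le_distFun`,
`IsMIND.sobolevNorm_sub_le_iInf`). Moreover the samples of e have multiresolution norm at most 2γ_n
= A√n.

Interpolation (`exists_lqNorm_le`). If the samples of g have multiresolution norm at most A√n and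
‖D^k g‖ ≤ Δ, then ‖g‖_q ≤ K A (Δ/A)^{1-2ϑ}. At each point x and each scale 1/M there are weights on
nearby grid points which reproduce polynomials of degree k and are combinations of averages over
cubes of the system (`exists_isQuasiInterp`). The weighted samples are thus at most C A M^{d/2},
while the approximation error is controlled pointwise by M^{d/2-k} Δ (`exists_abs_sub_le`) and in
mean square by a damped sum of Fourier coefficients (`exists_meanSquare_error`). The finest useful
scale gives the supremum bound. For the critical exponent p = 2 + 4k/d, the scale is chosen at each
x so that C A M^{d/2} is comparable to |g(x)|; then |g(x)|^p is at most a constant times A^{4k/d}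
M^{2k} times the squared error at that scale. Summing over all dyadic scales costs no logarithm,
because the damping exponent 2k + 2 exceeds 2k (`sum_damping_le`). The other q follow from
monotonicity of L^q norms or from interpolation between p and ∞.

Large noise. Every cube meets the grid in a discrete box, and there are at most n² boxes, so a
Chernoff bound over boxes controls the bad event. There the loss is at most K(1 + N^k max|ξ|), by
comparison with a trigonometric interpolant of the noise (`exists_estimator_bounds`). The lower
bound on C makes this contribution O(n^{-1/2}), which is below the claimed rate since μ < 1/2. The
same interpolant shows that the estimator is Lipschitz in the data, whence measurability and
integrability of the loss. -/

namespace MIND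

section Fourier

variable {d : ℕ}

/-! ### Fourier series on the period cell -/

/-- The character `x ↦ exp (2πi m·x)`. -/
noncomputable def char (m : Fin d → ℤ) (x : Fin d → ℝ) : ℂ :=
  Complex.exp (2 * Real.pi * Complex.I * ((∑ i, (m i : ℝ) * x i : ℝ) : ℂ))

lemma char_eq_prod (m : Fin d → ℤ) (x : Fin d → ℝ) :
    char m x = ∏ i, Complex.exp (2 * Real.pi * Complex.I * ((m i : ℂ) * (x i : ℂ))) := by
  rw [char, ← Complex.exp_sum, ← Finset.mul_sum]
  push_cast
  rfl

lemma norm_char (m : Fin d → ℤ) (x : Fin d → ℝ) : ‖char m x‖ = 1 := by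
  rw [char, show (2 * Real.pi * Complex.I * ((∑ i, (m i : ℝ) * x i : ℝ) : ℂ)) =
    ((2 * Real.pi * ∑ i, (m i : ℝ) * x i : ℝ) : ℂ) * Complex.I by push_cast; ring]
  exact Complex.norm_exp_ofReal_mul_I _

lemma char_zero (x : Fin d → ℝ) : char 0 x = 1 := by simp [char]

lemma char_add (m m' : Fin d → ℤ) (x : Fin d → ℝ) :
    char (m + m') x = char m x * char m' x := by
  rw [char, char, char, ← Complex.exp_add, ← mul_add, ← Complex.ofReal_add,
    ← Finset.sum_add_distrib]
  simp [add_mul]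

lemma char_add_right (m : Fin d → ℤ) (x y : Fin d → ℝ) :
    char m (x + y) = char m x * char m y := by
  rw [char, char, char, ← Complex.exp_add, ← mul_add, ← Complex.ofReal_add,
    ← Finset.sum_add_distrib]
  simp [mul_add]

lemma char_neg (m : Fin d → ℤ) (x : Fin d → ℝ) :
    char (-m) x = starRingEnd ℂ (char m x) := by
  rw [char, char, ← Complex.exp_conj]
  congr 1
  simp only [Pi.neg_apply, Int.cast_neg, neg_mul, Finset.sum_neg_distrib, map_mul, map_ofNat,
    Complex.conj_ofReal, Complex.conj_I, Complex.ofReal_neg]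
  ring

lemma char_int (m n : Fin d → ℤ) : char m (fun i => (n i : ℝ)) = 1 := by
  rw [char, show (2 * Real.pi * Complex.I * ((∑ i, (m i : ℝ) * (n i : ℝ) : ℝ) : ℂ)) =
    ((∑ i, m i * n i : ℤ) : ℂ) * (2 * Real.pi * Complex.I) by push_cast; ring]
  exact Complex.exp_int_mul_two_pi_mul_I _

lemma char_single_one (m : Fin d → ℤ) (i : Fin d) : char m (Pi.single i 1) = 1 := by
  rw [show (Pi.single i 1 : Fin d → ℝ) = fun j => ((Pi.single i 1 : Fin d → ℤ) j : ℝ) by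
    ext j; by_cases h : j = i
    · subst h; simp
    · simp [h]]
  exact char_int m _

lemma continuous_char (m : Fin d → ℤ) : Continuous (char m) := by
  unfold char; fun_prop

lemma contDiff_char (m : Fin d → ℤ) {n : WithTop ℕ∞} : ContDiff ℝ n (char m) := by
  unfold char
  refine ContDiff.cexp (contDiff_const.mul ?_)
  have h : ContDiff ℝ n fun x : Fin d → ℝ => ∑ i, (m i : ℝ) * x i :=
    ContDiff.sum fun i _ => contDiff_const.mul (contDiff_apply ℝ ℝ i)
  exact Complex.ofRealCLM.contDiff.comp h

instance : IsProbabilityMeasure (cellMeasure d) := by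
  constructor
  rw [cellMeasure, Measure.restrict_apply MeasurableSet.univ, Set.univ_inter]
  rw [Real.volume_Icc_pi]; simp

/-- The circle is parametrised by a half-open interval, so the closed cell is exchanged for one that
differs from it by a null set. -/
lemma cellMeasure_eq_ioc :
    cellMeasure d = volume.restrict {x : Fin d → ℝ | ∀ i, x i ∈ Set.Ioc ((0 : Fin d → ℝ) i) ((0 : Fin d → ℝ) i + 1)} := by
  rw [cellMeasure]
  refine Measure.restrict_congr_set ?_
  have h := (Measure.univ_pi_Ioc_ae_eq_Icc (μ := fun _ : Fin d => (volume : Measure ℝ)) (f := 0) (g := 1)).symm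
  refine h.trans (Filter.EventuallyEq.of_eq ?_)
  ext x
  change x ∈ Set.univ.pi _ ↔ ∀ i, x i ∈ Set.Ioc ((0 : Fin d → ℝ) i) ((0 : Fin d → ℝ) i + 1)
  simp

/-- The Fourier coefficients of a function on the cell. -/
noncomputable def fc (g : (Fin d → ℝ) → ℂ) (m : Fin d → ℤ) : ℂ :=
  ∫ x, char (-m) x * g x ∂(cellMeasure d)

noncomputable local instance : MeasureSpace UnitAddCircle := ⟨AddCircle.haarAddCircle⟩

lemma mFourier_coe (m : Fin d → ℤ) (x : Fin d → ℝ) :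
    UnitAddTorus.mFourier m (fun i => (x i : UnitAddCircle)) = char m x := by
  rw [char_eq_prod]
  simp only [UnitAddTorus.mFourier, ContinuousMap.coe_mk, fourier_coe_apply]
  refine Finset.prod_congr rfl fun i _ => ?_
  congr 1; push_cast; ring

/-- The function on the torus that is given by `g` on the cell. -/
noncomputable def toTorus (g : (Fin d → ℝ) → ℂ) (t : UnitAddTorus (Fin d)) : ℂ :=
  g (fun i => (AddCircle.equivIoc 1 (0 : ℝ) (t i)).1)

lemma toTorus_coe (g : (Fin d → ℝ) → ℂ) {x : Fin d → ℝ}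
    (hx : ∀ i, x i ∈ Set.Ioc ((0 : Fin d → ℝ) i) ((0 : Fin d → ℝ) i + 1)) :
    toTorus g (fun i => (x i : UnitAddCircle)) = g x := by
  unfold toTorus
  congr 1; ext i
  exact AddCircle.equivIoc_coe_of_mem (p := (1 : ℝ)) (a := 0) (hx i)

lemma measurePreserving_toIoc : MeasurePreserving
    (fun (t : UnitAddTorus (Fin d)) (i : Fin d) => (AddCircle.equivIoc 1 (0 : ℝ) (t i)).1)
    volume (cellMeasure d) := by
  have h := UnitAddTorus.measurePreserving_equivPiIoc (0 : Fin d → ℝ)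
  rw [cellMeasure_eq_ioc]
  exact (MeasureTheory.measurePreserving_subtype_coe
    (MeasurableSet.univ_pi' (fun i => measurableSet_Ioc))).comp h

lemma memLp_toTorus {g : (Fin d → ℝ) → ℂ} (hg : MemLp g 2 (cellMeasure d)) :
    MemLp (toTorus g) 2 (volume : Measure (UnitAddTorus (Fin d))) :=
  hg.comp_measurePreserving measurePreserving_toIoc

lemma mFourierCoeff_toTorus (g : (Fin d → ℝ) → ℂ) (m : Fin d → ℤ) :
    UnitAddTorus.mFourierCoeff (toTorus g) m = fc g m := by
  rw [UnitAddTorus.mFourierCoeff_eq_integral _ _ 0, fc, cellMeasure_eq_ioc]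
  refine setIntegral_congr_fun (MeasurableSet.univ_pi' (fun i => measurableSet_Ioc)) ?_
  intro x hx
  simp only [smul_eq_mul]
  rw [toTorus_coe g hx, mFourier_coe]

/-- Parseval's identity on the cell. -/
lemma hasSum_sq_fc {g : (Fin d → ℝ) → ℂ} (hg : MemLp g 2 (cellMeasure d)) :
    HasSum (fun m => ‖fc g m‖ ^ 2) (∫ x, ‖g x‖ ^ 2 ∂(cellMeasure d)) := by
  have h := UnitAddTorus.hasSum_sq_mFourierCoeff ((memLp_toTorus hg).toLp _)
  have h1 : ∀ m, UnitAddTorus.mFourierCoeff ((memLp_toTorus hg).toLp _) m = fc g m := fun m => by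
    rw [← mFourierCoeff_toTorus]
    exact integral_congr_ae (ae_eq_rfl.mul (MemLp.coeFn_toLp _))
  simp only [h1] at h
  convert! h using 1
  have h2 : (fun t => ‖(memLp_toTorus hg).toLp _ t‖ ^ 2) =ᵐ[volume] fun t => ‖toTorus g t‖ ^ 2 :=
    (MemLp.coeFn_toLp (memLp_toTorus hg)).fun_comp (fun z => ‖z‖ ^ 2)
  rw [integral_congr_ae h2, UnitAddTorus.integral_preimage _ 0, cellMeasure_eq_ioc]
  refine setIntegral_congr_fun (MeasurableSet.univ_pi' (fun i => measurableSet_Ioc)) ?_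
  intro x hx
  simp only
  rw [toTorus_coe g hx]

end Fourier

end MIND
namespace MIND

section WeakDerivFourier

variable {d : ℕ}

/-! ### Derivatives of periodic functions -/

/-- The classical partial derivative along the directions `i`. -/
noncomputable def partialDeriv {E : Type*} [NormedAddCommGroup E] [NormedSpace ℝ E] {j : ℕ}
    (i : Fin j → Fin d) (φ : (Fin d → ℝ) → E) (x : Fin d → ℝ) : E :=
  iteratedFDeriv ℝ j φ x (fun l => Pi.single (i l) 1)

section

variable {E : Type*} [NormedAddCommGroup E] [NormedSpace ℝ E]

lemma partialDeriv_zero (i : Fin 0 → Fin d) (φ : (Fin d → ℝ) → E) : partialDeriv i φ = φ := by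
  ext x; simp [partialDeriv]

lemma contDiff_partialDeriv {φ : (Fin d → ℝ) → E} (hφ : ContDiff ℝ ((⊤ : ℕ∞) : WithTop ℕ∞) φ)
    {j : ℕ} (i : Fin j → Fin d) : ContDiff ℝ ((⊤ : ℕ∞) : WithTop ℕ∞) (partialDeriv i φ) := by
  have h : ContDiff ℝ ((⊤ : ℕ∞) : WithTop ℕ∞) (iteratedFDeriv ℝ j φ) :=
    hφ.iteratedFDeriv_right (by exact_mod_cast le_top)
  exact (ContinuousMultilinearMap.apply ℝ (fun _ : Fin j => Fin d → ℝ) E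
    (fun l => Pi.single (i l) 1)).contDiff.comp h

lemma partialDeriv_periodic {φ : (Fin d → ℝ) → E}
    (hφ : ∀ (x : Fin d → ℝ) (a : Fin d), φ (x + Pi.single a 1) = φ x) {j : ℕ} (i : Fin j → Fin d)
    (x : Fin d → ℝ) (a : Fin d) : partialDeriv i φ (x + Pi.single a 1) = partialDeriv i φ x := by
  unfold partialDeriv
  rw [← iteratedFDeriv_comp_add_right]
  simp only [hφ]

lemma partialDeriv_succ {φ : (Fin d → ℝ) → E} (hφ : ContDiff ℝ ((⊤ : ℕ∞) : WithTop ℕ∞) φ)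
    {j : ℕ} (i : Fin (j + 1) → Fin d) (x : Fin d → ℝ) :
    partialDeriv i φ x = fderiv ℝ (partialDeriv (Fin.tail i) φ) x (Pi.single (i 0) 1) := by
  unfold partialDeriv
  rw [DifferentiableAt.iteratedFDeriv_succ_apply_left']
  · rfl
  · exact (hφ.differentiable_iteratedFDeriv (by exact_mod_cast WithTop.coe_lt_top _)) x

end

lemma partialDeriv_char (m : Fin d → ℤ) {j : ℕ} (i : Fin j → Fin d) (x : Fin d → ℝ) :
    partialDeriv i (char m) x = (∏ l, (2 * Real.pi * Complex.I * m (i l))) * char m x := by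
  induction j generalizing x with
  | zero => simp [partialDeriv]
  | succ j ih =>
    rw [partialDeriv_succ (contDiff_char m)]
    have h1 : partialDeriv (Fin.tail i) (char m) =
        fun x => (∏ l, (2 * Real.pi * Complex.I * m (Fin.tail i l))) * char m x :=
      funext fun x => ih _ x
    have h2 : HasFDerivAt (fun x : Fin d → ℝ => ∑ a, (m a : ℝ) * x a)
        (∑ a, (m a : ℝ) • (ContinuousLinearMap.proj a : (Fin d → ℝ) →L[ℝ] ℝ)) x :=
      HasFDerivAt.fun_sum fun a _ => (hasFDerivAt_apply a x).const_mul _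
    have h3 : HasFDerivAt (char m) _ x :=
      ((Complex.ofRealCLM.hasFDerivAt.comp x h2).const_mul (2 * Real.pi * Complex.I)).cexp
    rw [h1, (h3.const_mul _).fderiv, Fin.prod_univ_succ]
    simp only [smul_apply, ContinuousLinearMap.comp_apply,
      sum_apply, ContinuousLinearMap.proj_apply, smul_eq_mul,
      Complex.ofRealCLM_apply, Pi.single_apply, mul_ite, mul_one, mul_zero, Finset.sum_ite_eq',
      Finset.mem_univ, if_true, Function.comp_apply, Complex.ofReal_intCast]
    rw [char]
    simp only [Fin.tail]
    ring

lemma integrable_cell {E : Type*} [NormedAddCommGroup E] {g : (Fin d → ℝ) → E}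
    (hg : Continuous g) : Integrable g (cellMeasure d) :=
  hg.continuousOn.integrableOn_compact isCompact_Icc

lemma memLp_cell {E : Type*} [NormedAddCommGroup E] {g : (Fin d → ℝ) → E}
    (hg : Continuous g) (p : ℝ≥0∞) : MemLp g p (cellMeasure d) := by
  obtain ⟨C, hC⟩ := (isCompact_Icc (a := (0 : Fin d → ℝ)) (b := 1)).exists_bound_of_continuousOn
    hg.continuousOn
  refine MemLp.of_bound hg.aestronglyMeasurable C ?_
  exact (ae_restrict_iff' measurableSet_Icc).2 (Eventually.of_forall hC)

/-- Divergence theorem for the field with `F` in direction `a` and zero elsewhere: the integrals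
over opposite faces cancel by periodicity. -/
lemma integral_fderiv_eq_zero {F : (Fin d → ℝ) → ℂ} (hF : ContDiff ℝ 1 F)
    (hper : ∀ (x : Fin d → ℝ) (a : Fin d), F (x + Pi.single a 1) = F x) (a : Fin d) :
    ∫ x, fderiv ℝ F x (Pi.single a 1) ∂(cellMeasure d) = 0 := by
  obtain _ | n := d
  · exact a.elim0
  have hc : Continuous fun x => fderiv ℝ F x (Pi.single a 1) :=
    (hF.continuous_fderiv one_ne_zero).clm_apply continuous_const
  have h := integral_divergence_of_hasFDerivAt_off_countable' (0 : Fin (n + 1) → ℝ) 1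
    zero_le_one (fun i => if i = a then F else 0)
    (fun i x => if i = a then fderiv ℝ F x else 0) ∅ Set.countable_empty
    (fun i => by
      split_ifs
      · exact hF.continuous.continuousOn
      · exact continuousOn_const)
    (fun x _ i => by
      split_ifs
      · exact (hF.differentiable one_ne_zero x).hasFDerivAt
      · exact hasFDerivAt_const _ _)
    (by
      refine ContinuousOn.integrableOn_compact isCompact_Icc (Continuous.continuousOn ?_)
      refine continuous_finsetSum _ fun i _ => ?_
      by_cases hi : i = a
      · subst hi; simpa using hc
      · simp only [if_neg hi]; exact continuous_const)
  have h1 : ∀ x : Fin (n + 1) → ℝ, ∑ i, (if i = a then fderiv ℝ F x else 0) (Pi.single i 1) =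
      fderiv ℝ F x (Pi.single a 1) := fun x => by
    rw [Finset.sum_eq_single a]
    · simp
    · intro b _ hb; simp [hb]
    · simp
  simp only [h1] at h
  rw [cellMeasure, h]
  refine Finset.sum_eq_zero fun i _ => ?_
  by_cases hi : i = a
  · subst hi
    simp only [if_true, Pi.one_apply, Pi.zero_apply]
    rw [sub_eq_zero]
    refine integral_congr_ae (Eventually.of_forall fun x => ?_)
    simp only
    rw [← hper (i.insertNth 0 x) i]
    congr 1
    ext b
    refine Fin.succAboveCases i ?_ (fun b => ?_) b <;> simp
  · simp [hi]

lemma char_periodic (m : Fin d → ℤ) (x : Fin d → ℝ) (a : Fin d) :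
    char m (x + Pi.single a 1) = char m x := by
  rw [char_add_right, char_single_one, mul_one]

lemma fderiv_char (m : Fin d → ℤ) (x : Fin d → ℝ) (a : Fin d) :
    fderiv ℝ (char m) x (Pi.single a 1) = 2 * Real.pi * Complex.I * m a * char m x := by
  have h := partialDeriv_char m (fun _ : Fin 1 => a) x
  rw [partialDeriv_succ (contDiff_char m)] at h
  simpa [partialDeriv_zero] using h

lemma integral_char_eq_zero {m : Fin d → ℤ} (hm : m ≠ 0) :
    ∫ x, char m x ∂(cellMeasure d) = 0 := by
  obtain ⟨a, ha⟩ := Function.ne_iff.1 hm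
  have h := integral_fderiv_eq_zero (contDiff_char m) (char_periodic m) a
  simp only [fderiv_char] at h
  rw [integral_const_mul] at h
  have h1 : (2 * Real.pi * Complex.I * m a : ℂ) ≠ 0 := by
    have : (m a : ℂ) ≠ 0 := by exact_mod_cast ha
    simp [Real.pi_ne_zero, this]
  exact (mul_eq_zero.1 h).resolve_left h1

/-- Integration by parts: `integral_fderiv_eq_zero` applied to the product of `G` with a character.
-/
lemma fc_fderiv {G : (Fin d → ℝ) → ℂ} (hG : ContDiff ℝ 1 G)
    (hper : ∀ (x : Fin d → ℝ) (a : Fin d), G (x + Pi.single a 1) = G x) (a : Fin d)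
    (m : Fin d → ℤ) :
    fc (fun x => fderiv ℝ G x (Pi.single a 1)) m = 2 * Real.pi * Complex.I * m a * fc G m := by
  have h := integral_fderiv_eq_zero (F := fun x => char (-m) x * G x) ((contDiff_char _).mul hG)
    (fun x b => by rw [char_periodic, hper]) a
  have h1 : ∀ x, fderiv ℝ (fun x => char (-m) x * G x) x (Pi.single a 1) =
      char (-m) x * fderiv ℝ G x (Pi.single a 1) -
        2 * Real.pi * Complex.I * m a * (char (-m) x * G x) := fun x => by
    rw [fderiv_fun_mul ((contDiff_char (-m) (n := 1)).differentiable one_ne_zero x)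
      (hG.differentiable one_ne_zero x)]
    simp only [add_apply, smul_apply, fderiv_char,
      smul_eq_mul, Pi.neg_apply, Int.cast_neg]
    ring
  simp only [h1] at h
  rw [integral_sub, integral_const_mul, sub_eq_zero] at h
  · exact h
  · exact integrable_cell ((continuous_char _).mul
      ((hG.continuous_fderiv one_ne_zero).clm_apply continuous_const))
  · exact integrable_cell (continuous_const.mul ((continuous_char _).mul hG.continuous))

lemma fc_partialDeriv {G : (Fin d → ℝ) → ℂ} (hG : ContDiff ℝ ((⊤ : ℕ∞) : WithTop ℕ∞) G)
    (hper : ∀ (x : Fin d → ℝ) (a : Fin d), G (x + Pi.single a 1) = G x) {j : ℕ}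
    (i : Fin j → Fin d) (m : Fin d → ℤ) :
    fc (partialDeriv i G) m = (∏ l, (2 * Real.pi * Complex.I * m (i l))) * fc G m := by
  induction j with
  | zero =>
    simp [partialDeriv_zero]
  | succ j ih =>
    rw [show partialDeriv i G = fun x => fderiv ℝ (partialDeriv (Fin.tail i) G) x
      (Pi.single (i 0) 1) from funext (partialDeriv_succ hG i),
      fc_fderiv ((contDiff_partialDeriv hG _).of_le (by exact_mod_cast le_top))
        (partialDeriv_periodic hper _), ih, Fin.prod_univ_succ]
    simp only [Fin.tail]
    ring

end WeakDerivFourier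

end MIND
namespace MIND

section SobolevSpace

variable {d : ℕ}

/-! ### Fourier coefficients of weak derivatives -/

/-- The Fourier coefficients of a real function. -/
noncomputable def fcoef (f : (Fin d → ℝ) → ℝ) (m : Fin d → ℤ) : ℂ := fc (fun x => (f x : ℂ)) m

lemma integrable_mul_char {f : (Fin d → ℝ) → ℝ} (hf : MemLp f 2 (cellMeasure d))
    (m : Fin d → ℤ) : Integrable (fun x => char m x * (f x : ℂ)) (cellMeasure d) := by
  refine (hf.integrable one_le_two).ofReal.bdd_mul (c := 1)
    (continuous_char m).aestronglyMeasurable ?_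
  exact Eventually.of_forall fun x => (norm_char m x).le

lemma fcoef_sub {f g : (Fin d → ℝ) → ℝ} (hf : MemLp f 2 (cellMeasure d))
    (hg : MemLp g 2 (cellMeasure d)) (m : Fin d → ℤ) :
    fcoef (fun x => f x - g x) m = fcoef f m - fcoef g m := by
  unfold fcoef fc
  rw [← integral_sub (integrable_mul_char hf _) (integrable_mul_char hg _)]
  simp only [Complex.ofReal_sub, mul_sub]

lemma hasSum_sq_fcoef {f : (Fin d → ℝ) → ℝ} (hf : MemLp f 2 (cellMeasure d)) :
    HasSum (fun m => ‖fcoef f m‖ ^ 2) (∫ x, f x ^ 2 ∂(cellMeasure d)) := by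
  have h := hasSum_sq_fc (g := fun x => (f x : ℂ)) hf.ofReal
  simpa only [Complex.norm_real, Real.norm_eq_abs, sq_abs, fcoef] using h

lemma ae_eq_of_fcoef_eq {f g : (Fin d → ℝ) → ℝ} (hf : MemLp f 2 (cellMeasure d))
    (hg : MemLp g 2 (cellMeasure d)) (h : ∀ m, fcoef f m = fcoef g m) :
    f =ᵐ[cellMeasure d] g := by
  have h1 := hasSum_sq_fcoef (hf.sub hg)
  have h2 : ∀ m, fcoef (f - g) m = 0 := fun m => by
    rw [show f - g = fun x => f x - g x from rfl, fcoef_sub hf hg, h, sub_self]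
  simp only [h2, norm_zero, ne_eq, OfNat.ofNat_ne_zero, not_false_eq_true, zero_pow] at h1
  have h3 := h1.unique hasSum_zero
  rw [integral_eq_zero_iff_of_nonneg (fun x => sq_nonneg _) (hf.sub hg).integrable_sq] at h3
  filter_upwards [h3] with x hx
  simpa [sub_eq_zero] using hx

/-- Weak derivatives are tested against real functions only, whereas characters are complex.
Composing with the real-linear maps `reCLM` and `imCLM` reduces to the real case. -/
lemma IsWeakDeriv.integral_eq {j : ℕ} {i : Fin j → Fin d} {f g : (Fin d → ℝ) → ℝ}
    (hf : MemLp f 2 (cellMeasure d)) (hg : MemLp g 2 (cellMeasure d)) (h : IsWeakDeriv i f g)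
    {φ : (Fin d → ℝ) → ℂ} (hφ : ContDiff ℝ ((⊤ : ℕ∞) : WithTop ℕ∞) φ)
    (hper : ∀ (x : Fin d → ℝ) (a : Fin d), φ (x + Pi.single a 1) = φ x) :
    ∫ x, (f x : ℂ) * partialDeriv i φ x ∂(cellMeasure d) =
      (-1) ^ j * ∫ x, (g x : ℂ) * φ x ∂(cellMeasure d) := by
  have key : ∀ L : ℂ →L[ℝ] ℝ, L (∫ x, (f x : ℂ) * partialDeriv i φ x ∂(cellMeasure d)) =
      L ((-1) ^ j * ∫ x, (g x : ℂ) * φ x ∂(cellMeasure d)) := by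
    intro L
    have hint : ∀ {u : (Fin d → ℝ) → ℝ} {v : (Fin d → ℝ) → ℂ}, MemLp u 2 (cellMeasure d) →
        Continuous v → Integrable (fun x => (u x : ℂ) * v x) (cellMeasure d) := fun {u v} hu hv => by
      simp only [mul_comm ((u _ : ℝ) : ℂ)]
      exact (memLp_cell hv 2).integrable_mul hu.ofReal
    have hL : ∀ (r : ℝ) (z : ℂ), L (r * z) = r * L z := fun r z => by
      rw [← Complex.real_smul, map_smul, smul_eq_mul]
    rw [show ((-1) ^ j : ℂ) = (((-1) ^ j : ℝ) : ℂ) by push_cast; rfl, hL,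
      ← L.integral_comp_comm (hint hf (contDiff_partialDeriv hφ i).continuous),
      ← L.integral_comp_comm (hint hg hφ.continuous)]
    simp only [hL]
    have := h (fun x => L (φ x)) (L.contDiff.comp hφ) (fun x a => by simp only [hper])
    rw [← this]
    congr 1; ext x
    rw [show (fun x => L (φ x)) = L ∘ φ from rfl, L.iteratedFDeriv_comp_left hφ.contDiffAt
      (by exact_mod_cast le_top)]
    rfl
  exact Complex.ext (key Complex.reCLM) (key Complex.imCLM)

lemma IsWeakDeriv.fcoef_eq {j : ℕ} {i : Fin j → Fin d} {f g : (Fin d → ℝ) → ℝ}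
    (hf : MemLp f 2 (cellMeasure d)) (hg : MemLp g 2 (cellMeasure d)) (h : IsWeakDeriv i f g)
    (m : Fin d → ℤ) :
    fcoef g m = (∏ l, (2 * Real.pi * Complex.I * m (i l))) * fcoef f m := by
  have h1 := h.integral_eq hf hg (contDiff_char (-m)) (char_periodic (-m))
  simp only [partialDeriv_char] at h1
  have h2 : ∏ l, (2 * Real.pi * Complex.I * ((-m) (i l) : ℤ)) =
      (-1) ^ j * ∏ l, (2 * Real.pi * Complex.I * m (i l)) := by
    rw [show ((-1) ^ j : ℂ) = ∏ _l : Fin j, (-1 : ℂ) by simp, ← Finset.prod_mul_distrib]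
    refine Finset.prod_congr rfl fun l _ => ?_
    simp
  unfold fcoef fc
  rw [h2] at h1
  have h3 : ((-1) ^ j : ℂ) ≠ 0 := by simp
  apply mul_left_cancel₀ h3
  simp only [mul_comm (char (-m) _)]
  rw [← h1, ← mul_assoc, ← integral_const_mul]
  congr 1; ext x; ring

lemma IsWeakDeriv.ae_unique {j : ℕ} {i : Fin j → Fin d} {f g g' : (Fin d → ℝ) → ℝ}
    (hf : MemLp f 2 (cellMeasure d)) (hg : MemLp g 2 (cellMeasure d))
    (hg' : MemLp g' 2 (cellMeasure d)) (h : IsWeakDeriv i f g) (h' : IsWeakDeriv i f g') :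
    g =ᵐ[cellMeasure d] g' :=
  ae_eq_of_fcoef_eq hg hg' fun m => by rw [h.fcoef_eq hf hg, h'.fcoef_eq hf hg']

lemma integrable_mul_cell {u v : (Fin d → ℝ) → ℝ} (hu : MemLp u 2 (cellMeasure d))
    (hv : Continuous v) : Integrable (fun x => u x * v x) (cellMeasure d) :=
  hu.integrable_mul (memLp_cell hv 2)

lemma IsWeakDeriv.add {j : ℕ} {i : Fin j → Fin d} {f f' g g' : (Fin d → ℝ) → ℝ}
    (hf : MemLp f 2 (cellMeasure d)) (hg : MemLp g 2 (cellMeasure d))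
    (hf' : MemLp f' 2 (cellMeasure d)) (hg' : MemLp g' 2 (cellMeasure d))
    (h : IsWeakDeriv i f g) (h' : IsWeakDeriv i f' g') :
    IsWeakDeriv i (fun x => f x + f' x) (fun x => g x + g' x) := by
  intro φ hφ hper
  have hc := (contDiff_partialDeriv hφ i).continuous
  change ∫ x, (f x + f' x) * partialDeriv i φ x ∂(cellMeasure d) = _
  simp only [add_mul]
  rw [integral_add (integrable_mul_cell hf hc) (integrable_mul_cell hf' hc),
    integral_add (integrable_mul_cell hg hφ.continuous) (integrable_mul_cell hg' hφ.continuous),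
    mul_add, ← h φ hφ hper, ← h' φ hφ hper]
  rfl

lemma IsWeakDeriv.const_mul {j : ℕ} {i : Fin j → Fin d} {f g : (Fin d → ℝ) → ℝ}
    (h : IsWeakDeriv i f g) (c : ℝ) :
    IsWeakDeriv i (fun x => c * f x) (fun x => c * g x) := by
  intro φ hφ hper
  simp only [mul_assoc]
  rw [integral_const_mul, integral_const_mul, h φ hφ hper]
  ring

/-! ### The space `H^k_0` -/

lemma MemHk0.memLp {k : ℕ} {f : (Fin d → ℝ) → ℝ} (hf : MemHk0 k f) (p : ℝ≥0∞) :
    MemLp f p (cellMeasure d) := memLp_cell hf.continuous p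

lemma MemHk0.weakDeriv_spec {k : ℕ} {f : (Fin d → ℝ) → ℝ} (hf : MemHk0 k f)
    (i : Fin k → Fin d) :
    MemLp (weakDeriv i f) 2 (cellMeasure d) ∧ IsWeakDeriv i f (weakDeriv i f) := by
  have h := hf.exists_weakDeriv k le_rfl i
  rw [weakDeriv, dif_pos h]
  exact h.choose_spec

lemma MemHk0.add {k : ℕ} {f g : (Fin d → ℝ) → ℝ} (hf : MemHk0 k f) (hg : MemHk0 k g) :
    MemHk0 k (fun x => f x + g x) where
  continuous := hf.continuous.add hg.continuous
  periodic x i := by simp only [hf.periodic x i, hg.periodic x i]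
  mean_zero := by
    rw [integral_add (integrable_cell hf.continuous) (integrable_cell hg.continuous),
      hf.mean_zero, hg.mean_zero, add_zero]
  exists_weakDeriv j hj i := by
    obtain ⟨u, hu, hu'⟩ := hf.exists_weakDeriv j hj i
    obtain ⟨v, hv, hv'⟩ := hg.exists_weakDeriv j hj i
    exact ⟨_, hu.add hv, hu'.add (hf.memLp 2) hu (hg.memLp 2) hv hv'⟩

lemma MemHk0.const_mul {k : ℕ} {f : (Fin d → ℝ) → ℝ} (hf : MemHk0 k f) (c : ℝ) :
    MemHk0 k (fun x => c * f x) where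
  continuous := hf.continuous.const_mul c
  periodic x i := by simp only [hf.periodic x i]
  mean_zero := by rw [integral_const_mul, hf.mean_zero, mul_zero]
  exists_weakDeriv j hj i := by
    obtain ⟨u, hu, hu'⟩ := hf.exists_weakDeriv j hj i
    exact ⟨_, hu.const_mul c, hu'.const_mul c⟩

lemma MemHk0.sub {k : ℕ} {f g : (Fin d → ℝ) → ℝ} (hf : MemHk0 k f) (hg : MemHk0 k g) :
    MemHk0 k (fun x => f x - g x) := by
  simpa [sub_eq_add_neg] using hf.add (hg.const_mul (-1))

lemma MemHk0.zero (k : ℕ) : MemHk0 k (fun _ : Fin d → ℝ => (0 : ℝ)) where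
  continuous := continuous_const
  periodic x i := rfl
  mean_zero := by simp
  exists_weakDeriv j _ i := ⟨fun _ => 0, MemLp.zero' , fun φ _ _ => by simp⟩

lemma MemHk0.weakDeriv_add {k : ℕ} {f g : (Fin d → ℝ) → ℝ} (hf : MemHk0 k f) (hg : MemHk0 k g)
    (i : Fin k → Fin d) : weakDeriv i (fun x => f x + g x) =ᵐ[cellMeasure d]
      fun x => weakDeriv i f x + weakDeriv i g x := by
  obtain ⟨h1, h1'⟩ := hf.weakDeriv_spec i
  obtain ⟨h2, h2'⟩ := hg.weakDeriv_spec i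
  obtain ⟨h3, h3'⟩ := (hf.add hg).weakDeriv_spec i
  exact h3'.ae_unique ((hf.add hg).memLp 2) h3 (h1.add h2)
    (h1'.add (hf.memLp 2) h1 (hg.memLp 2) h2 h2')

lemma MemHk0.weakDeriv_const_mul {k : ℕ} {f : (Fin d → ℝ) → ℝ} (hf : MemHk0 k f) (c : ℝ)
    (i : Fin k → Fin d) : weakDeriv i (fun x => c * f x) =ᵐ[cellMeasure d]
      fun x => c * weakDeriv i f x := by
  obtain ⟨h1, h1'⟩ := hf.weakDeriv_spec i
  obtain ⟨h3, h3'⟩ := (hf.const_mul c).weakDeriv_spec i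
  exact h3'.ae_unique ((hf.const_mul c).memLp 2) h3 (h1.const_mul c) (h1'.const_mul c)

lemma sobolevInner_comm {k : ℕ} (f g : (Fin d → ℝ) → ℝ) :
    sobolevInner k f g = sobolevInner k g f := by
  simp only [sobolevInner, mul_comm]

lemma sobolevInner_add_left {k : ℕ} {f g u : (Fin d → ℝ) → ℝ} (hf : MemHk0 k f)
    (hg : MemHk0 k g) (hu : MemHk0 k u) :
    sobolevInner k (fun x => f x + g x) u = sobolevInner k f u + sobolevInner k g u := by
  unfold sobolevInner
  rw [← Finset.sum_add_distrib]
  refine Finset.sum_congr rfl fun i _ => ?_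
  obtain ⟨h1, -⟩ := hf.weakDeriv_spec i
  obtain ⟨h2, -⟩ := hg.weakDeriv_spec i
  obtain ⟨h3, -⟩ := hu.weakDeriv_spec i
  have h4 := integral_add (h1.integrable_mul h3) (h2.integrable_mul h3)
  simp only [Pi.mul_apply] at h4
  rw [← h4]
  refine integral_congr_ae ?_
  filter_upwards [hf.weakDeriv_add hg i] with x hx
  rw [hx]; ring

lemma sobolevInner_const_mul_left {k : ℕ} {f : (Fin d → ℝ) → ℝ} (hf : MemHk0 k f) (c : ℝ)
    (u : (Fin d → ℝ) → ℝ) :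
    sobolevInner k (fun x => c * f x) u = c * sobolevInner k f u := by
  unfold sobolevInner
  rw [Finset.mul_sum]
  refine Finset.sum_congr rfl fun i _ => ?_
  rw [← integral_const_mul]
  refine integral_congr_ae ?_
  filter_upwards [hf.weakDeriv_const_mul c i] with x hx
  rw [hx]; ring

lemma sobolevInner_sub_left {k : ℕ} {f g u : (Fin d → ℝ) → ℝ} (hf : MemHk0 k f)
    (hg : MemHk0 k g) (hu : MemHk0 k u) :
    sobolevInner k (fun x => f x - g x) u = sobolevInner k f u - sobolevInner k g u := by
  have h := sobolevInner_add_left hf (hg.const_mul (-1)) hu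
  rw [sobolevInner_const_mul_left hg] at h
  simpa [sub_eq_add_neg] using h

lemma sobolevInner_add_right {k : ℕ} {f g u : (Fin d → ℝ) → ℝ} (hf : MemHk0 k f)
    (hg : MemHk0 k g) (hu : MemHk0 k u) :
    sobolevInner k u (fun x => f x + g x) = sobolevInner k u f + sobolevInner k u g := by
  rw [sobolevInner_comm, sobolevInner_add_left hf hg hu, sobolevInner_comm f, sobolevInner_comm g]

lemma sobolevInner_sub_right {k : ℕ} {f g u : (Fin d → ℝ) → ℝ} (hf : MemHk0 k f)
    (hg : MemHk0 k g) (hu : MemHk0 k u) :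
    sobolevInner k u (fun x => f x - g x) = sobolevInner k u f - sobolevInner k u g := by
  rw [sobolevInner_comm, sobolevInner_sub_left hf hg hu, sobolevInner_comm f, sobolevInner_comm g]

lemma sobolevInner_const_mul_right {k : ℕ} {f : (Fin d → ℝ) → ℝ} (hf : MemHk0 k f) (c : ℝ)
    (u : (Fin d → ℝ) → ℝ) :
    sobolevInner k u (fun x => c * f x) = c * sobolevInner k u f := by
  rw [sobolevInner_comm, sobolevInner_const_mul_left hf, sobolevInner_comm f]

lemma sobolevInner_self_nonneg (k : ℕ) (f : (Fin d → ℝ) → ℝ) : 0 ≤ sobolevInner k f f :=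
  Finset.sum_nonneg fun _ _ => integral_nonneg fun _ => mul_self_nonneg _

lemma sobolevNorm_nonneg (k : ℕ) (f : (Fin d → ℝ) → ℝ) : 0 ≤ sobolevNorm k f := Real.sqrt_nonneg _

lemma sobolevNorm_sq (k : ℕ) (f : (Fin d → ℝ) → ℝ) : sobolevNorm k f ^ 2 = sobolevInner k f f :=
  Real.sq_sqrt (sobolevInner_self_nonneg k f)

/-- Cauchy–Schwarz, from the discriminant of the nonnegative quadratic polynomial t ↦ ‖D^k(f + t
g)‖². -/
lemma abs_sobolevInner_le {k : ℕ} {f g : (Fin d → ℝ) → ℝ} (hf : MemHk0 k f) (hg : MemHk0 k g) :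
    |sobolevInner k f g| ≤ sobolevNorm k f * sobolevNorm k g := by
  have h : ∀ t : ℝ, 0 ≤ sobolevInner k g g * (t * t) + 2 * sobolevInner k f g * t +
      sobolevInner k f f := fun t => by
    have h1 := sobolevInner_self_nonneg k (fun x => f x + t * g x)
    rw [sobolevInner_add_left hf (hg.const_mul t) (hf.add (hg.const_mul t)),
      sobolevInner_add_right hf (hg.const_mul t) hf,
      sobolevInner_add_right hf (hg.const_mul t) (hg.const_mul t),
      sobolevInner_const_mul_left hg, sobolevInner_const_mul_left hg,
      sobolevInner_const_mul_right hg, sobolevInner_const_mul_right hg,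
      sobolevInner_comm g f] at h1
    linarith
  have h2 := discrim_le_zero h
  rw [discrim] at h2
  rw [← Real.sqrt_sq (abs_nonneg _), sobolevNorm, sobolevNorm,
    ← Real.sqrt_mul (sobolevInner_self_nonneg k f), sq_abs]
  exact Real.sqrt_le_sqrt (by nlinarith)

lemma sobolevNorm_add_le {k : ℕ} {f g : (Fin d → ℝ) → ℝ} (hf : MemHk0 k f) (hg : MemHk0 k g) :
    sobolevNorm k (fun x => f x + g x) ≤ sobolevNorm k f + sobolevNorm k g := by
  refine Real.sqrt_le_iff.2 ⟨add_nonneg (sobolevNorm_nonneg _ _) (sobolevNorm_nonneg _ _), ?_⟩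
  rw [sobolevInner_add_left hf hg (hf.add hg), sobolevInner_add_right hf hg hf,
    sobolevInner_add_right hf hg hg, sobolevInner_comm g f, add_sq, sobolevNorm_sq, sobolevNorm_sq]
  have := (le_abs_self _).trans (abs_sobolevInner_le hf hg)
  linarith

lemma sobolevNorm_sub_comm {k : ℕ} {f g : (Fin d → ℝ) → ℝ} (hf : MemHk0 k f) (hg : MemHk0 k g) :
    sobolevNorm k (fun x => f x - g x) = sobolevNorm k (fun x => g x - f x) := by
  rw [sobolevNorm, sobolevNorm, sobolevInner_sub_left hf hg (hf.sub hg),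
    sobolevInner_sub_left hg hf (hg.sub hf), sobolevInner_sub_right hf hg hf,
    sobolevInner_sub_right hf hg hg, sobolevInner_sub_right hg hf hf, sobolevInner_sub_right hg hf hg]
  congr 1; ring

/-- Parseval's identity for the Sobolev norm. -/
lemma MemHk0.hasSum_sobolevNorm {k : ℕ} {f : (Fin d → ℝ) → ℝ} (hf : MemHk0 k f) :
    HasSum (fun m => (2 * Real.pi) ^ (2 * k) * (∑ a, (m a : ℝ) ^ 2) ^ k * ‖fcoef f m‖ ^ 2)
      (sobolevNorm k f ^ 2) := by
  rw [sobolevNorm_sq, sobolevInner]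
  have h := hasSum_sum (s := (Finset.univ : Finset (Fin k → Fin d)))
    fun i _ => hasSum_sq_fcoef (hf.weakDeriv_spec i).1
  simp only [← sq]
  convert! h using 1
  ext m
  simp only [fun i => (hf.weakDeriv_spec i).2.fcoef_eq (hf.memLp 2) (hf.weakDeriv_spec i).1 m]
  simp only [norm_mul, norm_prod, mul_pow, Complex.norm_I, mul_one, Complex.norm_intCast,
    Complex.norm_real, Complex.norm_ofNat, Real.norm_eq_abs, abs_of_pos Real.pi_pos,
    ← Finset.prod_pow, sq_abs]
  rw [← Finset.sum_mul]
  congr 1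
  -- Summing the products of squared frequencies over all index tuples gives the k-th power of ∑
  -- m_a².
  rw [Finset.sum_pow', ← Fintype.piFinset_univ] 
  simp only [Finset.prod_mul_distrib, Finset.prod_const, Finset.card_univ, Fintype.card_fin]
  rw [← Finset.mul_sum]
  simp only [pow_mul]

lemma MemHk0.fcoef_zero {k : ℕ} {f : (Fin d → ℝ) → ℝ} (hf : MemHk0 k f) : fcoef f 0 = 0 := by
  unfold fcoef fc
  simp only [neg_zero, char_zero, one_mul]
  rw [integral_complex_ofReal, hf.mean_zero, Complex.ofReal_zero]

/-- A continuous function on the cell with summable Fourier coefficients is the sum of its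
Fourier series. -/
lemma hasSum_fcoef_char {f : (Fin d → ℝ) → ℝ} (hf : Continuous f)
    (hs : Summable fun m => ‖fcoef f m‖) {x : Fin d → ℝ} (hx : x ∈ Set.Icc (0 : Fin d → ℝ) 1) :
    HasSum (fun m => fcoef f m * char m x) (f x : ℂ) := by
  have hsx : ∀ x, Summable fun m => fcoef f m * char m x := fun x =>
    Summable.of_norm (by simpa only [norm_mul, norm_char, mul_one] using hs)
  -- The sum of the series is continuous by uniform convergence and has the same Fourier
  -- coefficients as `f`, so Parseval gives equality almost everywhere.
  set T : (Fin d → ℝ) → ℂ := fun x => ∑' m, fcoef f m * char m x with hT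
  have hTc : Continuous T := continuous_tsum
    (fun m => continuous_const.mul (continuous_char m)) hs (fun m x => by simp [norm_char])
  have hcoef : ∀ m, fc (fun x => (f x : ℂ) - T x) m = 0 := by
    intro m
    unfold fc
    simp only [mul_sub]
    have hfi : Integrable (fun x => char (-m) x * (f x : ℂ)) (cellMeasure d) :=
      integrable_cell ((continuous_char _).mul (Complex.continuous_ofReal.comp hf))
    have hTi : Integrable (fun x => char (-m) x * T x) (cellMeasure d) :=
      integrable_cell ((continuous_char _).mul hTc)
    rw [integral_sub hfi hTi, sub_eq_zero]
    change fcoef f m = _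
    have h1 : ∀ x, char (-m) x * T x = ∑' m', fcoef f m' * char (m' - m) x := fun x => by
      rw [hT, ← tsum_mul_left]
      congr 1; ext m'
      rw [sub_eq_add_neg, char_add]; ring
    simp only [h1]
    rw [← integral_tsum_of_summable_integral_norm]
    · rw [tsum_eq_single m]
      · simp [char_zero]
      · intro m' hm'
        rw [integral_const_mul]
        have : ∫ x, char (m' - m) x ∂(cellMeasure d) = 0 := integral_char_eq_zero (sub_ne_zero.2 hm')
        rw [this, mul_zero]
    · exact fun m' => integrable_cell (continuous_const.mul (continuous_char _))
    · simpa [norm_char] using hs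
  have hcont : Continuous fun x => (f x : ℂ) - T x := (Complex.continuous_ofReal.comp hf).sub hTc
  have h1 := hasSum_sq_fc (memLp_cell hcont 2)
  simp only [hcoef, norm_zero, ne_eq, OfNat.ofNat_ne_zero, not_false_eq_true, zero_pow] at h1
  have h3 := h1.unique hasSum_zero
  rw [integral_eq_zero_iff_of_nonneg (fun x => sq_nonneg _)
    (integrable_cell (hcont.norm.pow 2))] at h3
  have h4 : (fun x => (f x : ℂ)) =ᵐ[volume.restrict (Set.Icc (0 : Fin d → ℝ) 1)] T := by
    filter_upwards [h3] with x hx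
    simpa [sub_eq_zero] using hx
  -- Almost everywhere equality of continuous functions extends to every point of the cell, boundary
  -- included, because the cell is the closure of its interior.
  have h5 := MeasureTheory.Measure.eqOn_of_ae_eq h4 (Complex.continuous_ofReal.comp hf).continuousOn
    hTc.continuousOn (by
      rw [← Set.pi_univ_Icc, interior_pi_set Set.finite_univ, closure_pi_set]
      simp) hx
  have h6 := (hsx x).hasSum
  simp only at h5
  rw [h5]
  exact h6

end SobolevSpace

end MIND
namespace MIND

section Trigonometric

variable {d : ℕ}

/-! ### Trigonometric polynomials -/

/-- The trigonometric polynomial with coefficients `b` and frequencies in `s`. -/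
noncomputable def trigPoly (s : Finset (Fin d → ℤ)) (b : (Fin d → ℤ) → ℂ) (x : Fin d → ℝ) : ℂ :=
  ∑ m ∈ s, b m * char m x

lemma contDiff_trigPoly (s : Finset (Fin d → ℤ)) (b : (Fin d → ℤ) → ℂ) {n : WithTop ℕ∞} :
    ContDiff ℝ n (trigPoly s b) :=
  ContDiff.sum fun m _ => contDiff_const.mul (contDiff_char m)

lemma continuous_trigPoly (s : Finset (Fin d → ℤ)) (b : (Fin d → ℤ) → ℂ) :
    Continuous (trigPoly s b) := (contDiff_trigPoly s b (n := 0)).continuous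

lemma trigPoly_periodic (s : Finset (Fin d → ℤ)) (b : (Fin d → ℤ) → ℂ) (x : Fin d → ℝ)
    (a : Fin d) : trigPoly s b (x + Pi.single a 1) = trigPoly s b x := by
  simp only [trigPoly, char_periodic]

open Classical in
lemma fc_trigPoly (s : Finset (Fin d → ℤ)) (b : (Fin d → ℤ) → ℂ) (m : Fin d → ℤ) :
    fc (trigPoly s b) m = if m ∈ s then b m else 0 := by
  unfold fc trigPoly
  simp only [Finset.mul_sum]
  have hi : ∀ m' ∈ s, Integrable (fun x => char (-m) x * (b m' * char m' x)) (cellMeasure d) :=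
    fun m' _ => integrable_cell ((continuous_char _).mul (continuous_const.mul (continuous_char _)))
  rw [integral_finsetSum _ hi]
  have h : ∀ m', ∫ x, char (-m) x * (b m' * char m' x) ∂(cellMeasure d) =
      if m' = m then b m' else 0 := by
    intro m'
    have h1 : ∀ x, char (-m) x * (b m' * char m' x) = b m' * char (m' - m) x := fun x => by
      rw [sub_eq_add_neg, char_add]; ring
    simp only [h1, integral_const_mul]
    split_ifs with hm
    · subst hm; simp [char_zero]
    · rw [integral_char_eq_zero (sub_ne_zero.2 hm), mul_zero]
  simp only [h, Finset.sum_ite_eq']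

lemma integral_normSq_trigPoly (s : Finset (Fin d → ℤ)) (b : (Fin d → ℤ) → ℂ) :
    ∫ x, ‖trigPoly s b x‖ ^ 2 ∂(cellMeasure d) = ∑ m ∈ s, ‖b m‖ ^ 2 := by
  classical
  have h := hasSum_sq_fc (memLp_cell (continuous_trigPoly s b) 2)
  have h2 : HasSum (fun m => ‖fc (trigPoly s b) m‖ ^ 2) (∑ m ∈ s, ‖fc (trigPoly s b) m‖ ^ 2) :=
    hasSum_sum_of_ne_finset_zero fun m hm => by simp [fc_trigPoly, hm]
  rw [h.unique h2]
  exact Finset.sum_congr rfl fun m hm => by simp [fc_trigPoly, hm]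

lemma partialDeriv_ofReal {φ : (Fin d → ℝ) → ℝ} (hφ : ContDiff ℝ ((⊤ : ℕ∞) : WithTop ℕ∞) φ)
    {j : ℕ} (i : Fin j → Fin d) (x : Fin d → ℝ) :
    partialDeriv i (fun x => (φ x : ℂ)) x = (partialDeriv i φ x : ℝ) := by
  unfold partialDeriv
  rw [show (fun x => (φ x : ℂ)) = Complex.ofRealCLM ∘ φ from rfl,
    Complex.ofRealCLM.iteratedFDeriv_comp_left hφ.contDiffAt (by exact_mod_cast le_top)]
  rfl

/-- Both integrals are real parts of finite sums of coefficients times Fourier coefficients of the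
test function, and `fc_partialDeriv` moves the derivative. The frequencies appear as `-m`, which
produces the sign. -/
lemma isWeakDeriv_trigPoly (s : Finset (Fin d → ℤ)) (b : (Fin d → ℤ) → ℂ) {j : ℕ}
    (i : Fin j → Fin d) :
    IsWeakDeriv i (fun x => (trigPoly s b x).re)
      (fun x => (trigPoly s (fun m => b m * ∏ l, (2 * Real.pi * Complex.I * m (i l))) x).re) := by
  intro φ hφ hper
  have hΦ : ContDiff ℝ ((⊤ : ℕ∞) : WithTop ℕ∞) (fun x => (φ x : ℂ)) :=
    Complex.ofRealCLM.contDiff.comp hφ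
  have hre : ∀ (b : (Fin d → ℤ) → ℂ) (u : (Fin d → ℝ) → ℝ), Continuous u →
      ∫ x, (trigPoly s b x).re * u x ∂(cellMeasure d) =
        (∑ m ∈ s, b m * fc (fun x => (u x : ℂ)) (-m)).re := by
    intro b u hu
    have hu' : Continuous fun x => (u x : ℂ) := Complex.continuous_ofReal.comp hu
    have h1 : ∀ x, (trigPoly s b x).re * u x = Complex.reCLM (trigPoly s b x * u x) := fun x => by
      simp
    simp only [h1]
    have hi : Integrable (fun x => trigPoly s b x * u x) (cellMeasure d) :=
      integrable_cell ((continuous_trigPoly s b).mul hu')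
    rw [Complex.reCLM.integral_comp_comm hi]
    simp only [Complex.reCLM_apply, trigPoly, Finset.sum_mul]
    have hi : ∀ m ∈ s, Integrable (fun x => b m * char m x * u x) (cellMeasure d) :=
      fun m _ => integrable_cell ((continuous_const.mul (continuous_char _)).mul hu')
    rw [integral_finsetSum _ hi]
    congr 1
    refine Finset.sum_congr rfl fun m _ => ?_
    rw [fc, ← integral_const_mul]
    simp only [neg_neg, mul_assoc]
  rw [hre _ _ hφ.continuous]
  have h2 := hre b _ (contDiff_partialDeriv hφ i).continuous
  rw [show (fun x => (trigPoly s b x).re * iteratedFDeriv ℝ j φ x fun l => Pi.single (i l) 1) =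
    fun x => (trigPoly s b x).re * partialDeriv i φ x from rfl, h2]
  have h3 : ∀ m, fc (fun x => ((partialDeriv i φ x : ℝ) : ℂ)) (-m) =
      (-1) ^ j * (∏ l, (2 * Real.pi * Complex.I * m (i l))) * fc (fun x => (φ x : ℂ)) (-m) := by
    intro m
    simp only [← partialDeriv_ofReal hφ]
    rw [fc_partialDeriv hΦ (fun x a => by rw [hper])]
    congr 1
    rw [show ((-1) ^ j : ℂ) = ∏ _l : Fin j, (-1 : ℂ) by simp, ← Finset.prod_mul_distrib]
    refine Finset.prod_congr rfl fun l _ => ?_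
    simp
  simp only [h3]
  rw [← Complex.re_ofReal_mul, Finset.mul_sum]
  congr 1
  refine Finset.sum_congr rfl fun m _ => ?_
  push_cast; ring

lemma memHk0_trigPoly (k : ℕ) {s : Finset (Fin d → ℤ)} (hs : 0 ∉ s) (b : (Fin d → ℤ) → ℂ) :
    MemHk0 k (fun x => (trigPoly s b x).re) where
  continuous := Complex.continuous_re.comp (continuous_trigPoly s b)
  periodic x i := by simp only [trigPoly_periodic]
  mean_zero := by
    have h := fc_trigPoly s b 0
    rw [if_neg hs, fc] at h
    simp only [neg_zero, char_zero, one_mul] at h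
    have h1 := Complex.reCLM.integral_comp_comm (integrable_cell (continuous_trigPoly s b))
    rw [h] at h1
    simpa using h1
  exists_weakDeriv j _ i := ⟨_, memLp_cell (Complex.continuous_re.comp (continuous_trigPoly s _)) 2,
    isWeakDeriv_trigPoly s b i⟩

lemma sum_prod_frequency (k : ℕ) (m : Fin d → ℤ) :
    ∑ i : Fin k → Fin d, ‖∏ l, (2 * Real.pi * Complex.I * m (i l) : ℂ)‖ ^ 2 =
      (2 * Real.pi) ^ (2 * k) * (∑ a, (m a : ℝ) ^ 2) ^ k := by
  simp only [norm_mul, norm_prod, mul_pow, Complex.norm_I, mul_one, Complex.norm_intCast,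
    Complex.norm_real, Complex.norm_ofNat, Real.norm_eq_abs, abs_of_pos Real.pi_pos,
    ← Finset.prod_pow, sq_abs]
  rw [Finset.sum_pow', ← Fintype.piFinset_univ]
  simp only [Finset.prod_mul_distrib, Finset.prod_const, Finset.card_univ, Fintype.card_fin]
  rw [← Finset.mul_sum]
  simp only [pow_mul]

/-- Only an inequality, because the coefficients need not be symmetric and taking the real part may
lose mass. -/
lemma sobolevNorm_trigPoly_sq_le (k : ℕ) {s : Finset (Fin d → ℤ)} (hs : 0 ∉ s)
    (b : (Fin d → ℤ) → ℂ) :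
    sobolevNorm k (fun x => (trigPoly s b x).re) ^ 2 ≤
      ∑ m ∈ s, (2 * Real.pi) ^ (2 * k) * (∑ a, (m a : ℝ) ^ 2) ^ k * ‖b m‖ ^ 2 := by
  have hmem := memHk0_trigPoly k hs b
  rw [sobolevNorm_sq, sobolevInner]
  simp only [← sum_prod_frequency, Finset.sum_mul]
  rw [Finset.sum_comm]
  refine Finset.sum_le_sum fun i _ => ?_
  set b' : (Fin d → ℤ) → ℂ := fun m => b m * ∏ l, (2 * Real.pi * Complex.I * m (i l)) with hb'
  obtain ⟨h1, h2⟩ := hmem.weakDeriv_spec i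
  have hc : Continuous fun x => (trigPoly s b' x).re :=
    Complex.continuous_re.comp (continuous_trigPoly s b')
  have h3 := h2.ae_unique (hmem.memLp 2) h1 (memLp_cell hc 2) (isWeakDeriv_trigPoly s b i)
  calc ∫ x, weakDeriv i (fun x => (trigPoly s b x).re) x *
        weakDeriv i (fun x => (trigPoly s b x).re) x ∂(cellMeasure d)
      = ∫ x, (trigPoly s b' x).re * (trigPoly s b' x).re ∂(cellMeasure d) := by
        refine integral_congr_ae ?_
        filter_upwards [h3] with x hx
        rw [hx]
    _ ≤ ∫ x, ‖trigPoly s b' x‖ ^ 2 ∂(cellMeasure d) := by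
        refine integral_mono (integrable_cell (hc.mul hc))
          (integrable_cell ((continuous_trigPoly s b').norm.pow 2)) fun x => ?_
        simp only
        rw [← abs_mul_abs_self, ← sq]
        exact pow_le_pow_left₀ (abs_nonneg _) (Complex.abs_re_le_norm _) 2
    _ = _ := by
        rw [integral_normSq_trigPoly]
        refine Finset.sum_congr rfl fun m _ => ?_
        rw [hb', norm_mul, mul_pow, mul_comm]

end Trigonometric

end MIND
namespace MIND

section Lattice

variable {d : ℕ}

/-! ### Lattice sums and sampling -/

/-- Cauchy–Schwarz for series in the form used throughout: a factorised bound on the squared terms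
gives both summability and the estimate. -/
lemma tsum_norm_sq_le {ι E : Type*} [NormedAddCommGroup E] {c : ι → E} {f g : ι → ℝ}
    (hf0 : ∀ i, 0 ≤ f i) (hg0 : ∀ i, 0 ≤ g i) (hf : Summable f) (hg : Summable g)
    (h : ∀ i, ‖c i‖ ^ 2 ≤ f i * g i) :
    Summable (fun i => ‖c i‖) ∧ (∑' i, ‖c i‖) ^ 2 ≤ (∑' i, f i) * ∑' i, g i := by
  have hs : Summable (fun i => ‖c i‖) := by
    refine Summable.of_nonneg_of_le (fun _ => norm_nonneg _) (fun i => ?_) (hf.add hg)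
    refine (sq_le_sq₀ (norm_nonneg _) (add_nonneg (hf0 i) (hg0 i))).1 ?_
    nlinarith [h i, hf0 i, hg0 i, mul_nonneg (hf0 i) (hg0 i)]
  refine ⟨hs, ?_⟩
  refine le_of_tendsto (hs.hasSum.pow 2) (Eventually.of_forall fun s => ?_)
  calc (∑ i ∈ s, ‖c i‖) ^ 2 ≤ (∑ i ∈ s, f i) * ∑ i ∈ s, g i :=
        Finset.sum_sq_le_sum_mul_sum_of_sq_le_mul s (fun i _ => hf0 i) (fun i _ => hg0 i)
          (fun i _ => h i)
    _ ≤ _ := mul_le_mul (hf.sum_le_tsum s fun i _ => hf0 i) (hg.sum_le_tsum s fun i _ => hg0 i)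
        (Finset.sum_nonneg fun i _ => hg0 i) (tsum_nonneg hf0)

lemma norm_tsum_sq_le {ι E : Type*} [NormedAddCommGroup E] {c : ι → E} {f g : ι → ℝ}
    (hf0 : ∀ i, 0 ≤ f i) (hg0 : ∀ i, 0 ≤ g i) (hf : Summable f) (hg : Summable g)
    (h : ∀ i, ‖c i‖ ^ 2 ≤ f i * g i) :
    ‖∑' i, c i‖ ^ 2 ≤ (∑' i, f i) * ∑' i, g i := by
  obtain ⟨h1, h2⟩ := tsum_norm_sq_le hf0 hg0 hf hg h
  exact (pow_le_pow_left₀ (norm_nonneg _) (norm_tsum_le_tsum_norm h1) 2).trans h2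

/-- The weight `(1 + ‖m‖ / N) ^ (2k)`. -/
noncomputable def freqWeight (k : ℕ) (N : ℕ) (m : Fin d → ℤ) : ℝ := (1 + ‖m‖ / N) ^ (2 * k)

lemma freqWeight_pos (k N : ℕ) (m : Fin d → ℤ) : 0 < freqWeight k N m := by
  unfold freqWeight; positivity

lemma norm_intCast_pi (m : Fin d → ℤ) : ‖(fun a => (m a : ℝ))‖ = ‖m‖ := by
  simp only [Pi.norm_def, NNReal.coe_inj]
  exact Finset.sup_congr rfl fun a _ => NNReal.eq (Int.norm_cast_real (m a))

/-- Comparison with ∑ ‖m‖^{-2k} over the integer lattice, convergent as 2k > d. The frequency 0,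
where the inverse norm is 0 by convention, is covered by an extra summand. -/
lemma summable_freqWeight_one {k : ℕ} (hk : d < 2 * k) :
    Summable fun m : Fin d → ℤ => (freqWeight k 1 m)⁻¹ := by
  classical
  set L : Submodule ℤ (Fin d → ℝ) := Submodule.span ℤ (Set.range (Pi.basisFun ℝ (Fin d))) with hL
  have hrank : Module.finrank ℤ L = d := by
    rw [ZLattice.rank ℝ L]; simp
  let φ : (Fin d → ℤ) → L := fun m => ⟨fun a => (m a : ℝ), by
    rw [hL, Module.Basis.mem_span_iff_repr_mem]
    intro i
    exact ⟨m i, by simp⟩⟩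
  have hφ : Function.Injective φ := fun m m' h => by
    ext a
    have : (m a : ℝ) = (m' a : ℝ) := congr_fun (congr_arg Subtype.val h) a
    exact_mod_cast this
  have h1 := (ZLattice.summable_norm_pow_inv L (2 * k) (by rw [hrank]; exact hk)).comp_injective hφ
  have h2 : Summable fun m : Fin d → ℤ => if m = 0 then (1 : ℝ) else 0 :=
    summable_of_ne_finset_zero (s := {0}) fun m hm => by
      rw [if_neg]; simpa using hm
  refine Summable.of_nonneg_of_le (fun m => inv_nonneg.2 (freqWeight_pos k 1 m).le)
    (fun m => ?_) (h1.add h2)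
  have hn : ‖φ m‖ = ‖m‖ := norm_intCast_pi m
  simp only [Function.comp_apply, hn]
  by_cases hm : m = 0
  · subst hm
    simp only [freqWeight, norm_zero, zero_div, add_zero, one_pow, inv_one, inv_zero, if_true]
    have : (0 : ℝ) ≤ 0 ^ (2 * k) := by positivity
    linarith
  · rw [if_neg hm, add_zero, freqWeight, ← inv_pow]
    have : 0 < ‖m‖ := norm_pos_iff.2 hm
    gcongr
    simp

/-- The lattice sum `∑ (1 + ‖m‖) ^ (-2k)`. -/
noncomputable def latticeSum (d k : ℕ) : ℝ := ∑' m : Fin d → ℤ, (freqWeight k 1 m)⁻¹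

lemma latticeSum_nonneg (d k : ℕ) : 0 ≤ latticeSum d k :=
  tsum_nonneg fun m => inv_nonneg.2 (freqWeight_pos k 1 m).le

/-- Division with remainder in every coordinate. -/
def residueEquiv (d N : ℕ) [NeZero N] : (Fin d → Fin N) × (Fin d → ℤ) ≃ (Fin d → ℤ) :=
  (Equiv.prodComm _ _).trans <| (Equiv.arrowProdEquivProdArrow (Fin d) (fun _ => ℤ)
    (fun _ => Fin N)).symm.trans (Equiv.piCongrRight fun _ => (Int.divModEquiv N).symm)

lemma residueEquiv_apply {N : ℕ} [NeZero N] (ρ : Fin d → Fin N) (l : Fin d → ℤ) (a : Fin d) :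
    residueEquiv d N (ρ, l) a = l a * N + (ρ a : ℕ) := rfl

/-- If m = lN + ρ with 0 ≤ ρ < N, then ‖l‖ ≤ ‖m‖/N + 1, so 1 + ‖l‖ ≤ 2(1 + ‖m‖/N); the factor 2^{2k}
is the constant. -/
lemma freqWeight_residue {k N : ℕ} [NeZero N] (ρ : Fin d → Fin N) (l : Fin d → ℤ) :
    (freqWeight k N (residueEquiv d N (ρ, l)))⁻¹ ≤ 4 ^ k * (freqWeight k 1 l)⁻¹ := by
  have hN : (0 : ℝ) < N := Nat.cast_pos.2 (Nat.pos_of_neZero N)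
  have h1 : ‖l‖ ≤ ‖residueEquiv d N (ρ, l)‖ / N + 1 := by
    rw [← sub_le_iff_le_add, le_div_iff₀ hN, sub_mul, one_mul, sub_le_iff_le_add]
    rw [← le_div_iff₀ hN]
    refine (pi_norm_le_iff_of_nonneg (by positivity)).2 fun a => ?_
    rw [le_div_iff₀ hN]
    have h2 : (|(l a * N + (ρ a : ℕ) : ℝ)|) ≤ ‖residueEquiv d N (ρ, l)‖ := by
      have := norm_le_pi_norm (residueEquiv d N (ρ, l)) a
      rw [residueEquiv_apply, Int.norm_eq_abs] at this
      exact_mod_cast this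
    have h3 : ((ρ a : ℕ) : ℝ) ≤ N := by exact_mod_cast (ρ a).2.le
    have h4 : (0 : ℝ) ≤ ((ρ a : ℕ) : ℝ) := Nat.cast_nonneg _
    rw [Int.norm_eq_abs]
    calc |(l a : ℝ)| * N = |(l a * N : ℝ)| := by rw [abs_mul, abs_of_pos hN]
      _ = |(l a * N + (ρ a : ℕ) : ℝ) - (ρ a : ℕ)| := by rw [add_sub_cancel_right]
      _ ≤ |(l a * N + (ρ a : ℕ) : ℝ)| + |((ρ a : ℕ) : ℝ)| := abs_sub _ _
      _ ≤ _ := by rw [abs_of_nonneg h4]; linarith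
  have h2 : freqWeight k 1 l ≤ 4 ^ k * freqWeight k N (residueEquiv d N (ρ, l)) := by
    unfold freqWeight
    rw [show (4 : ℝ) ^ k = 2 ^ (2 * k) by rw [pow_mul]; norm_num, ← mul_pow]
    refine pow_le_pow_left₀ (by positivity) ?_ _
    have : 0 ≤ ‖residueEquiv d N (ρ, l)‖ / N := by positivity
    simp only [Nat.cast_one, div_one]
    linarith
  rw [← div_eq_mul_inv, inv_le_comm₀ (freqWeight_pos _ _ _) (div_pos (by positivity) (freqWeight_pos _ _ _)),
    inv_div, div_le_iff₀ (by positivity)]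
  linarith

lemma summable_freqWeight_residue {k : ℕ} (hk : d < 2 * k) {N : ℕ} [NeZero N]
    (ρ : Fin d → Fin N) :
    Summable (fun l => (freqWeight k N (residueEquiv d N (ρ, l)))⁻¹) ∧
    ∑' l, (freqWeight k N (residueEquiv d N (ρ, l)))⁻¹ ≤ 4 ^ k * latticeSum d k := by
  have h1 := (summable_freqWeight_one hk).mul_left ((4 : ℝ) ^ k)
  have h2 : Summable (fun l => (freqWeight k N (residueEquiv d N (ρ, l)))⁻¹) :=
    Summable.of_nonneg_of_le (fun l => inv_nonneg.2 (freqWeight_pos _ _ _).le)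
      (fun l => freqWeight_residue ρ l) h1
  refine ⟨h2, ?_⟩
  rw [latticeSum, ← tsum_mul_left]
  exact h2.tsum_le_tsum (fun l => freqWeight_residue ρ l) h1

/-- There are N^d residue classes modulo N, each with a sum bounded independently of N. -/
lemma tsum_freqWeight_le {k : ℕ} (hk : d < 2 * k) (N : ℕ) [NeZero N] :
    Summable (fun m : Fin d → ℤ => (freqWeight k N m)⁻¹) ∧
    ∑' m : Fin d → ℤ, (freqWeight k N m)⁻¹ ≤ (N : ℝ) ^ d * (4 ^ k * latticeSum d k) := by
  have h1 : Summable fun p : (Fin d → Fin N) × (Fin d → ℤ) =>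
      (freqWeight k N (residueEquiv d N p))⁻¹ := by
    rw [summable_prod_of_nonneg (fun p => inv_nonneg.2 (freqWeight_pos _ _ _).le)]
    exact ⟨fun ρ => (summable_freqWeight_residue hk ρ).1, Summable.of_finite⟩
  refine ⟨(residueEquiv d N).summable_iff.1 h1, ?_⟩
  rw [← (residueEquiv d N).tsum_eq, h1.tsum_prod, tsum_fintype]
  refine (Finset.sum_le_sum fun ρ _ => (summable_freqWeight_residue hk ρ).2).trans (le_of_eq ?_)
  simp

lemma sum_exp_eq {N : ℕ} (p p' : Fin N) :
    ∑ t : Fin N, Complex.exp (2 * Real.pi * Complex.I *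
      ((((p : ℕ) : ℂ) - ((p' : ℕ) : ℂ)) * (((t : ℕ) : ℂ) / N))) =
      if p = p' then (N : ℂ) else 0 := by
  have hN : (N : ℂ) ≠ 0 := by
    have := p.pos; exact_mod_cast this.ne'
  split_ifs with h
  · subst h; simp
  set z := Complex.exp (2 * Real.pi * Complex.I * ((((p : ℕ) : ℂ) - ((p' : ℕ) : ℂ)) / N)) with hz
  have h1 : ∀ t : Fin N, Complex.exp (2 * Real.pi * Complex.I *
      ((((p : ℕ) : ℂ) - ((p' : ℕ) : ℂ)) * (((t : ℕ) : ℂ) / N))) = z ^ (t : ℕ) := fun t => by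
    rw [hz, ← Complex.exp_nat_mul]; congr 1; ring
  simp only [h1]
  rw [Fin.sum_univ_eq_sum_range (fun t => z ^ t) N]
  have h2 : z ≠ 1 := by
    intro h2
    rw [hz, Complex.exp_eq_one_iff] at h2
    obtain ⟨n, hn⟩ := h2
    have h3 : (((p : ℕ) : ℂ) - ((p' : ℕ) : ℂ)) = n * N := by
      have h4 : (2 * Real.pi * Complex.I : ℂ) ≠ 0 := Complex.two_pi_I_ne_zero
      rw [mul_comm (n : ℂ)] at hn
      have := mul_left_cancel₀ h4 hn
      field_simp at this
      linear_combination this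
    have h5 : ((p : ℕ) : ℤ) - ((p' : ℕ) : ℤ) = n * N := by exact_mod_cast h3
    have h6 := p.2
    have h7 := p'.2
    have h8 : n = 0 := by
      by_contra hn0
      rcases lt_or_gt_of_ne hn0 with h | h
      · have : n * N ≤ -1 * (N : ℤ) := by
          apply mul_le_mul_of_nonneg_right <;> omega
        omega
      · have : 1 * (N : ℤ) ≤ n * N := by
          apply mul_le_mul_of_nonneg_right <;> omega
        omega
    rw [h8, zero_mul] at h5
    exact h (Fin.ext (by omega))
  have h9 : z ^ N = 1 := by
    rw [hz, ← Complex.exp_nat_mul, Complex.exp_eq_one_iff]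
    refine ⟨((p : ℕ) : ℤ) - ((p' : ℕ) : ℤ), ?_⟩
    push_cast; field_simp
  have := geom_sum_mul z N
  rw [h9, sub_self] at this
  exact (mul_eq_zero.1 this).resolve_right (sub_ne_zero.2 h2)

/-- A vector of natural numbers below `N`, as a frequency. -/
def toFreq {N : ℕ} (ρ : Fin d → Fin N) : Fin d → ℤ := fun a => ((ρ a : ℕ) : ℤ)

lemma sum_char_grid {N : ℕ} (ρ ρ' : Fin d → Fin N) :
    ∑ τ : Fin d → Fin N, char (toFreq ρ - toFreq ρ') (gridPoint τ) =
      if ρ = ρ' then (N : ℂ) ^ d else 0 := by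
  simp only [char_eq_prod]
  have h := (Finset.prod_univ_sum (fun _ : Fin d => (Finset.univ : Finset (Fin N)))
    (fun a t => Complex.exp (2 * Real.pi * Complex.I *
      ((((ρ a : ℕ) : ℂ) - ((ρ' a : ℕ) : ℂ)) * (((t : ℕ) : ℂ) / N))))).symm
  rw [Fintype.piFinset_univ] at h
  simp only [sum_exp_eq] at h
  convert! h using 1
  · simp [toFreq, gridPoint]
  · split_ifs with hρ
    · subst hρ; simp
    · obtain ⟨a, ha⟩ := Function.ne_iff.1 hρ
      exact (Finset.prod_eq_zero (Finset.mem_univ a) (if_neg ha)).symm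

lemma sum_char_freq {N : ℕ} (τ τ' : Fin d → Fin N) :
    ∑ ρ : Fin d → Fin N, char (toFreq ρ) (gridPoint τ - gridPoint τ') =
      if τ = τ' then (N : ℂ) ^ d else 0 := by
  rw [← sum_char_grid τ τ']
  refine Finset.sum_congr rfl fun ρ _ => ?_
  unfold char
  congr 2
  push_cast
  refine Finset.sum_congr rfl fun a _ => ?_
  simp [toFreq, gridPoint]; ring

/-- Parseval's identity on the grid. -/
lemma sum_normSq_grid {N : ℕ} (b : (Fin d → Fin N) → ℂ) :
    ∑ τ : Fin d → Fin N, ‖∑ ρ, b ρ * char (toFreq ρ) (gridPoint τ)‖ ^ 2 =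
      (N : ℝ) ^ d * ∑ ρ, ‖b ρ‖ ^ 2 := by
  have key : ∀ z : ℂ, ((‖z‖ ^ 2 : ℝ) : ℂ) = z * starRingEnd ℂ z := fun z => by
    rw [Complex.mul_conj, Complex.normSq_eq_norm_sq]
  apply Complex.ofReal_injective
  rw [Complex.ofReal_sum, Complex.ofReal_mul, Complex.ofReal_sum, Finset.mul_sum]
  simp only [key, map_sum, map_mul, Finset.sum_mul_sum, ← char_neg]
  rw [Finset.sum_comm]
  refine Finset.sum_congr rfl fun ρ _ => ?_
  rw [Finset.sum_comm, Finset.sum_eq_single ρ]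
  · have h := sum_char_grid ρ ρ
    rw [if_pos rfl] at h
    push_cast
    rw [← h, Finset.sum_mul]
    refine Finset.sum_congr rfl fun τ _ => ?_
    rw [sub_eq_add_neg, char_add]; ring
  · intro ρ' _ hρ'
    have h := sum_char_grid ρ ρ'
    rw [if_neg hρ'.symm] at h
    rw [← mul_zero (b ρ * starRingEnd ℂ (b ρ')), ← h, Finset.mul_sum]
    refine Finset.sum_congr rfl fun τ _ => ?_
    rw [sub_eq_add_neg, char_add]; ring
  · simp

/-- Aliasing: on the grid a character depends only on the residue class of its frequency. -/
lemma char_residue {N : ℕ} [NeZero N] (ρ : Fin d → Fin N) (l : Fin d → ℤ) (τ : Fin d → Fin N) :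
    char (residueEquiv d N (ρ, l)) (gridPoint τ) = char (toFreq ρ) (gridPoint τ) := by
  have hN : (N : ℝ) ≠ 0 := Nat.cast_ne_zero.2 (NeZero.ne N)
  have h1 : residueEquiv d N (ρ, l) = toFreq ρ + (N : ℤ) • l := by
    ext a; simp [residueEquiv_apply, toFreq]; ring
  have h2 : char ((N : ℤ) • l) (gridPoint τ) = 1 := by
    rw [← char_int l (fun a => ((τ a : ℕ) : ℤ)), char, char]
    congr 3
    refine Finset.sum_congr rfl fun a _ => ?_
    simp only [gridPoint, Pi.smul_apply, smul_eq_mul, Int.cast_mul, Int.cast_natCast]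
    field_simp
  rw [h1, char_add, h2, mul_one]

lemma tsum_eq_sum_residue {E : Type*} [NormedAddCommGroup E] [CompleteSpace E] {N : ℕ} [NeZero N]
    {f : (Fin d → ℤ) → E} (hf : Summable f) :
    ∑' m, f m = ∑ ρ, ∑' l, f (residueEquiv d N (ρ, l)) := by
  have hs : Summable fun p => f (residueEquiv d N p) :=
    hf.comp_injective (residueEquiv d N).injective
  rw [← (residueEquiv d N).tsum_eq f, hs.tsum_prod, tsum_fintype]

/-- The sampling inequality. -/
lemma sum_normSq_sample_le {k : ℕ} (hk : d < 2 * k) {N : ℕ} [NeZero N] {c : (Fin d → ℤ) → ℂ}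
    (hc : Summable fun m => freqWeight k N m * ‖c m‖ ^ 2) :
    ∑ τ : Fin d → Fin N, ‖∑' m, c m * char m (gridPoint τ)‖ ^ 2 ≤
      (N : ℝ) ^ d * (4 ^ k * latticeSum d k) * ∑' m, freqWeight k N m * ‖c m‖ ^ 2 := by
  have hW0 : ∀ m : Fin d → ℤ, 0 ≤ (freqWeight k N m)⁻¹ :=
    fun m => inv_nonneg.2 (freqWeight_pos _ _ _).le
  have hWc0 : ∀ m, 0 ≤ freqWeight k N m * ‖c m‖ ^ 2 :=
    fun m => mul_nonneg (freqWeight_pos _ _ _).le (sq_nonneg _)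
  have hprod : ∀ m, ‖c m‖ ^ 2 ≤ (freqWeight k N m)⁻¹ * (freqWeight k N m * ‖c m‖ ^ 2) := fun m => by
    rw [← mul_assoc, inv_mul_cancel₀ (freqWeight_pos k N m).ne', one_mul]
  have hcs : Summable fun m => ‖c m‖ :=
    (tsum_norm_sq_le hW0 hWc0 (tsum_freqWeight_le hk N).1 hc hprod).1
  -- Aliased coefficients are collected in one number per residue class. Discrete Parseval then
  -- applies to the classes, and weighted Cauchy–Schwarz within each class.
  set b : (Fin d → Fin N) → ℂ := fun ρ => ∑' l, c (residueEquiv d N (ρ, l)) with hb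
  have h1 : ∀ τ : Fin d → Fin N, ∑' m, c m * char m (gridPoint τ) =
      ∑ ρ, b ρ * char (toFreq ρ) (gridPoint τ) := by
    intro τ
    rw [tsum_eq_sum_residue (N := N) (f := fun m => c m * char m (gridPoint τ))
      (Summable.of_norm (by simpa only [norm_mul, norm_char, mul_one] using hcs))]
    refine Finset.sum_congr rfl fun ρ _ => ?_
    simp only [char_residue, hb, tsum_mul_right]
  simp only [h1]
  rw [sum_normSq_grid, mul_assoc]
  refine mul_le_mul_of_nonneg_left ?_ (by positivity)
  rw [tsum_eq_sum_residue (N := N) hc, Finset.mul_sum]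
  refine Finset.sum_le_sum fun ρ _ => ?_
  have hp' : Summable fun l => freqWeight k N (residueEquiv d N (ρ, l)) *
      ‖c (residueEquiv d N (ρ, l))‖ ^ 2 :=
    hc.comp_injective (i := fun l => residueEquiv d N (ρ, l))
      ((residueEquiv d N).injective.comp (Prod.mk_right_injective ρ))
  refine (norm_tsum_sq_le (fun l => hW0 _) (fun l => hWc0 _) (summable_freqWeight_residue hk ρ).1
    hp' (fun l => hprod _)).trans ?_
  exact mul_le_mul_of_nonneg_right (summable_freqWeight_residue hk ρ).2
    (tsum_nonneg fun l => hWc0 _)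

end Lattice

end MIND
namespace MIND

section QuasiInterpolation

variable {d : ℕ}

/-! ### The multiresolution norm -/

lemma bddAbove_mrNorm {N : ℕ} (𝓑 : Set (Cube d)) (y : (Fin d → Fin N) → ℝ) :
    BddAbove (Set.range fun B : 𝓑 => |∑ τ ∈ (B : Cube d).gridPoints N, y τ| /
      √((((B : Cube d).gridPoints N).card : ℕ) : ℝ)) := by
  refine ((Set.finite_range fun s : Finset (Fin d → Fin N) =>
    |∑ τ ∈ s, y τ| / √((s.card : ℕ) : ℝ)).subset ?_).bddAbove
  rintro _ ⟨B, rfl⟩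
  exact ⟨(B : Cube d).gridPoints N, rfl⟩

lemma le_mrNorm {N : ℕ} {𝓑 : Set (Cube d)} (y : (Fin d → Fin N) → ℝ) {B : Cube d} (hB : B ∈ 𝓑) :
    |∑ τ ∈ B.gridPoints N, y τ| / √(((B.gridPoints N).card : ℕ) : ℝ) ≤ mrNorm 𝓑 y :=
  le_ciSup (bddAbove_mrNorm 𝓑 y) (⟨B, hB⟩ : 𝓑)

lemma mrNorm_nonneg {N : ℕ} (𝓑 : Set (Cube d)) (y : (Fin d → Fin N) → ℝ) : 0 ≤ mrNorm 𝓑 y :=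
  Real.iSup_nonneg fun _ => by positivity

lemma mrNorm_add_le {N : ℕ} (𝓑 : Set (Cube d)) (y z : (Fin d → Fin N) → ℝ) :
    mrNorm 𝓑 (y + z) ≤ mrNorm 𝓑 y + mrNorm 𝓑 z := by
  refine Real.iSup_le (fun B => ?_) (add_nonneg (mrNorm_nonneg _ _) (mrNorm_nonneg _ _))
  refine le_trans ?_ (add_le_add (le_mrNorm y B.2) (le_mrNorm z B.2))
  rw [← add_div]
  simp only [Pi.add_apply, Finset.sum_add_distrib]
  gcongr
  exact abs_add_le _ _

lemma mrNorm_smul {N : ℕ} (𝓑 : Set (Cube d)) (c : ℝ) (y : (Fin d → Fin N) → ℝ) :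
    mrNorm 𝓑 (c • y) = |c| * mrNorm 𝓑 y := by
  unfold mrNorm
  rw [Real.mul_iSup_of_nonneg (abs_nonneg c)]
  congr 1; ext B
  simp only [Pi.smul_apply, smul_eq_mul, ← Finset.mul_sum, abs_mul, mul_div_assoc]

/-! ### Reproducing polynomials from averages over small cubes -/

/-- A matrix entrywise this close to the identity satisfies ‖a‖₁ ≤ 2‖aA‖₁, since the perturbation
takes at most half of the ℓ¹ norm. So it is injective, hence surjective, with a bounded inverse. -/
lemma exists_vecMul_eq {J : Type*} [Fintype J] [DecidableEq J] (A : J → J → ℝ)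
    (hA : ∀ j l, |A j l - if j = l then 1 else 0| ≤ 1 / (2 * Fintype.card J)) (v : J → ℝ) :
    ∃ a : J → ℝ, (∀ l, ∑ j, a j * A j l = v l) ∧ ∑ j, |a j| ≤ 2 * ∑ l, |v l| := by
  have key : ∀ a : J → ℝ, ∑ j, |a j| ≤ 2 * ∑ l, |∑ j, a j * A j l| := by
    intro a
    have h1 : ∀ l, |a l| ≤ |∑ j, a j * A j l| + ∑ j, |a j| * (1 / (2 * Fintype.card J)) := by
      intro l
      have h2 : a l = ∑ j, a j * A j l - ∑ j, a j * (A j l - if j = l then 1 else 0) := by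
        rw [← Finset.sum_sub_distrib]
        simp [mul_sub]
      calc |a l| ≤ |∑ j, a j * A j l| + |∑ j, a j * (A j l - if j = l then 1 else 0)| := by
            conv_lhs => rw [h2]
            exact abs_sub _ _
        _ ≤ _ := by
            gcongr
            refine (Finset.abs_sum_le_sum_abs _ _).trans (Finset.sum_le_sum fun j _ => ?_)
            rw [abs_mul]
            exact mul_le_mul_of_nonneg_left (hA j l) (abs_nonneg _)
    have h3 := Finset.sum_le_sum fun l (_ : l ∈ Finset.univ) => h1 l
    rw [Finset.sum_add_distrib] at h3
    have h4 : ∑ _l : J, ∑ j, |a j| * (1 / (2 * Fintype.card J)) ≤ (∑ j, |a j|) / 2 := by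
      rw [← Finset.sum_mul, Finset.sum_const, Finset.card_univ, nsmul_eq_mul]
      have hs : 0 ≤ ∑ j, |a j| := Finset.sum_nonneg fun j _ => abs_nonneg _
      rcases Nat.eq_zero_or_pos (Fintype.card J) with h | h
      · rw [h]; simp; positivity
      · have : (0 : ℝ) < Fintype.card J := by exact_mod_cast h
        apply le_of_eq; field_simp
    linarith
  let T : (J → ℝ) →ₗ[ℝ] (J → ℝ) :=
    { toFun := fun a l => ∑ j, a j * A j l
      map_add' := fun a b => by ext l; simp [add_mul, Finset.sum_add_distrib]
      map_smul' := fun c a => by ext l; simp [mul_assoc, Finset.mul_sum] }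
  have hinj : Function.Injective T := by
    rw [← LinearMap.ker_eq_bot, LinearMap.ker_eq_bot']
    intro a ha
    have h1 : ∀ l, ∑ j, a j * A j l = 0 := fun l => congr_fun ha l
    have h2 := key a
    simp only [h1, abs_zero, Finset.sum_const_zero, mul_zero] at h2
    ext j
    have h3 := (Finset.sum_eq_zero_iff_of_nonneg fun j _ => abs_nonneg (a j)).1
      (le_antisymm h2 (Finset.sum_nonneg fun j _ => abs_nonneg _)) j (Finset.mem_univ j)
    simpa using h3
  obtain ⟨a, ha⟩ := (LinearMap.injective_iff_surjective.1 hinj) v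
  have h1 : ∀ l, ∑ j, a j * A j l = v l := fun l => congr_fun ha l
  refine ⟨a, h1, ?_⟩
  simpa only [h1] using key a

/-- The interpolation nodes. -/
noncomputable def node (k : ℕ) (s : Fin (k + 1)) : ℝ := (s : ℕ) / (k + 1 : ℝ)

lemma node_injective (k : ℕ) : Function.Injective (node k) := fun s t h => by
  have hk : (k + 1 : ℝ) ≠ 0 := by positivity
  unfold node at h
  rw [div_left_inj' hk] at h
  exact Fin.ext (by exact_mod_cast h)

lemma node_nonneg (k : ℕ) (s : Fin (k + 1)) : 0 ≤ node k s := by unfold node; positivity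

lemma node_add_le (k : ℕ) (s : Fin (k + 1)) {ε : ℝ} (hε : ε ≤ 1 / (k + 1)) : node k s + ε ≤ 1 := by
  have hk : (0 : ℝ) < k + 1 := by positivity
  have h1 : ((s : ℕ) : ℝ) + 1 ≤ k + 1 := by exact_mod_cast s.2
  calc node k s + ε ≤ (s : ℕ) / (k + 1 : ℝ) + 1 / (k + 1) := by unfold node; gcongr
    _ = ((s : ℕ) + 1) / (k + 1 : ℝ) := by rw [add_div]
    _ ≤ 1 := (div_le_one hk).2 h1

/-- The tensor product Lagrange polynomials. -/
noncomputable def tensorLagrange (k : ℕ) (l : Fin d → Fin (k + 1)) (z : Fin d → ℝ) : ℝ :=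
  ∏ a, (Lagrange.basis Finset.univ (node k) (l a)).eval (z a)

lemma continuous_tensorLagrange (k : ℕ) (l : Fin d → Fin (k + 1)) :
    Continuous (tensorLagrange k l) :=
  continuous_finsetProd _ fun a _ =>
    (Lagrange.basis Finset.univ (node k) (l a)).continuous.comp (continuous_apply a)

lemma tensorLagrange_node (k : ℕ) (l j : Fin d → Fin (k + 1)) :
    tensorLagrange k l (fun a => node k (j a)) = if j = l then 1 else 0 := by
  unfold tensorLagrange
  split_ifs with h
  · subst h
    exact Finset.prod_eq_one fun a _ =>
      Lagrange.eval_basis_self (node_injective k).injOn (Finset.mem_univ _)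
  · obtain ⟨a, ha⟩ := Function.ne_iff.1 h
    exact Finset.prod_eq_zero (Finset.mem_univ a)
      (Lagrange.eval_basis_of_ne ha.symm (Finset.mem_univ _))

lemma sum_tensorLagrange (k : ℕ) (P : Fin d → Polynomial ℝ) (hP : ∀ a, (P a).natDegree ≤ k)
    (z : Fin d → ℝ) :
    ∑ l : Fin d → Fin (k + 1), (∏ a, (P a).eval (node k (l a))) * tensorLagrange k l z =
      ∏ a, (P a).eval (z a) := by
  have h1 : ∀ a, (P a).eval (z a) = ∑ s, (P a).eval (node k s) *
      (Lagrange.basis Finset.univ (node k) s).eval (z a) := by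
    intro a
    have h2 := Lagrange.eq_interpolate (s := (Finset.univ : Finset (Fin (k + 1)))) (f := P a)
      (node_injective k).injOn (by
        refine lt_of_le_of_lt Polynomial.degree_le_natDegree ?_
        simp only [Finset.card_univ, Fintype.card_fin]
        exact_mod_cast Nat.lt_succ_of_le (hP a))
    conv_lhs => rw [h2]
    simp [Lagrange.interpolate_apply, Polynomial.eval_finsetSum]
  simp only [h1]
  rw [Finset.prod_univ_sum, Fintype.piFinset_univ]
  simp only [tensorLagrange, Finset.prod_mul_distrib]

/-- Compactness of the unit cube. The tolerance is the one required by `exists_vecMul_eq`, and `ε ≤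
1 / (k + 1)` keeps the cubes of side `ε` at the nodes inside the unit cube. -/
lemma exists_tensorLagrange_bounds (d k : ℕ) : ∃ ε K : ℝ, 0 < ε ∧ ε ≤ 1 / (k + 1) ∧ 0 < K ∧
    (∀ z ∈ Set.Icc (0 : Fin d → ℝ) 1, ∑ l, |tensorLagrange k l z| ≤ K) ∧
    ∀ z ∈ Set.Icc (0 : Fin d → ℝ) 1, ∀ z' ∈ Set.Icc (0 : Fin d → ℝ) 1, ‖z - z'‖ ≤ ε →
      ∀ l, |tensorLagrange k l z - tensorLagrange k l z'| ≤
        1 / (2 * Fintype.card (Fin d → Fin (k + 1))) := by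
  have hcomp := isCompact_Icc (a := (0 : Fin d → ℝ)) (b := 1)
  have hc : Continuous fun z : Fin d → ℝ => fun l => tensorLagrange k l z :=
    continuous_pi fun l => continuous_tensorLagrange k l
  have hc' : Continuous fun z : Fin d → ℝ => ∑ l, |tensorLagrange k l z| :=
    continuous_finsetSum _ fun l _ => (continuous_tensorLagrange k l).abs
  obtain ⟨K, hK⟩ := hcomp.exists_bound_of_continuousOn hc'.continuousOn
  have hu := hcomp.uniformContinuousOn_of_continuous hc.continuousOn
  have hpos : (0 : ℝ) < 1 / (2 * Fintype.card (Fin d → Fin (k + 1))) := by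
    have : 0 < Fintype.card (Fin d → Fin (k + 1)) := Fintype.card_pos
    positivity
  obtain ⟨δ, hδ, h⟩ := Metric.uniformContinuousOn_iff.1 hu _ hpos
  refine ⟨min (δ / 2) (1 / (k + 1)), max K 1, by positivity, min_le_right _ _,
    by positivity, fun z hz => ?_, fun z hz z' hz' hzz l => ?_⟩
  · exact (le_abs_self _).trans ((hK z hz).trans (le_max_left _ _))
  · have h1 := h z hz z' hz' (by
      rw [dist_eq_norm]
      have := min_le_left (δ / 2) (1 / ((k : ℝ) + 1))
      linarith)
    have h2 := (dist_le_pi_dist (fun l => tensorLagrange k l z)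
      (fun l => tensorLagrange k l z') l).trans h1.le
    rwa [Real.dist_eq] at h2

lemma Cube.mem_gridPoints {N : ℕ} {B : Cube d} {τ : Fin d → Fin N} :
    τ ∈ B.gridPoints N ↔ gridPoint τ ∈ B.toSet := by
  simp [Cube.gridPoints]

/-- A cube of side at least `1 / N` contains a proportional number of grid points. -/
lemma Cube.le_card_gridPoints {N : ℕ} (B : Cube d) (h : 1 ≤ N * B.side) :
    (N * B.side / 2) ^ d ≤ ((B.gridPoints N).card : ℝ) := by
  have hN : 0 < (N : ℝ) := by
    by_contra hN
    have : (N : ℝ) = 0 := le_antisymm (not_lt.1 hN) (Nat.cast_nonneg _)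
    rw [this] at h; norm_num at h
  -- In each coordinate, `q` consecutive indices starting at the rounded-up corner lie in the cube;
  -- `q` is at least half of `N * B.side` because the latter is at least 1.
  set q := ⌊N * B.side⌋₊ with hq
  have hq1 : 1 ≤ q := Nat.le_floor (by simpa using h)
  have hq2 : (q : ℝ) ≤ N * B.side := Nat.floor_le (by linarith)
  have hq3 : N * B.side / 2 ≤ q := by
    have h1 : N * B.side < q + 1 := Nat.lt_floor_add_one _
    have h2 : (1 : ℝ) ≤ q := by exact_mod_cast hq1
    linarith
  have hb : ∀ (a : Fin d) (u : Fin q), N * B.corner a ≤ (⌈N * B.corner a⌉₊ + (u : ℕ) : ℕ) ∧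
      ((⌈N * B.corner a⌉₊ + (u : ℕ) : ℕ) : ℝ) < N * (B.corner a + B.side) := by
    intro a u
    have h0 : 0 ≤ N * B.corner a := mul_nonneg hN.le (B.corner_nonneg a)
    have h1 := Nat.le_ceil (N * B.corner a)
    have h2 := Nat.ceil_lt_add_one h0
    have h3 : ((u : ℕ) : ℝ) + 1 ≤ q := by exact_mod_cast u.2
    have h4 : (0 : ℝ) ≤ ((u : ℕ) : ℝ) := Nat.cast_nonneg _
    push_cast
    constructor
    · linarith
    · rw [mul_add]; linarith
  have hlt : ∀ (a : Fin d) (u : Fin q), ⌈N * B.corner a⌉₊ + (u : ℕ) < N := by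
    intro a u
    have h1 := (hb a u).2
    have h2 : N * (B.corner a + B.side) ≤ N * 1 :=
      mul_le_mul_of_nonneg_left (B.corner_add_side_le_one a) hN.le
    have h3 : ((⌈N * B.corner a⌉₊ + (u : ℕ) : ℕ) : ℝ) < N := by linarith
    exact_mod_cast h3
  have hcard : (Fintype.card (Fin d → Fin q)) ≤ (B.gridPoints N).card := by
    rw [← Finset.card_univ]
    refine Finset.card_le_card_of_injOn (fun u a => ⟨⌈N * B.corner a⌉₊ + (u a : ℕ), hlt a (u a)⟩)
      (fun u _ => ?_) (fun u _ u' _ h => ?_)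
    · rw [Finset.mem_coe, Cube.mem_gridPoints]
      intro a
      simp only [gridPoint, Set.mem_Ico]
      rw [le_div_iff₀ hN, div_lt_iff₀ hN, mul_comm, mul_comm (B.corner a + B.side)]
      exact hb a (u a)
    · ext a
      have := congr_fun h a
      simp only [Fin.mk.injEq] at this
      omega
  rw [Fintype.card_fun, Fintype.card_fin, Fintype.card_fin] at hcard
  calc (N * B.side / 2) ^ d ≤ (q : ℝ) ^ d := by
        refine pow_le_pow_left₀ ?_ hq3 d
        linarith
    _ ≤ _ := by exact_mod_cast hcard

end QuasiInterpolation

end MIND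
namespace MIND

/-! ### Local polynomial-reproducing weights built from a normal system of cubes -/

section QuasiInterpolationExists

variable {d : ℕ}

/-- Weights `w` on the grid that reproduce polynomials of degree at most `k` at the point `x`, are
located near `x` and are controlled by the multiresolution norm. -/
structure IsQuasiInterp {N : ℕ} (𝓑 : Set (Cube d)) (k M : ℕ) (C : ℝ) (x : Fin d → ℝ)
    (w : (Fin d → Fin N) → ℝ) : Prop where
  near : ∀ τ, w τ ≠ 0 → ‖gridPoint τ - x‖ ≤ 1 / M
  sum_eq_one : ∑ τ, w τ = 1
  sum_moment : ∀ r, 1 ≤ r → r ≤ k → ∀ i : Fin r → Fin d,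
    ∑ τ, w τ * ∏ l, (gridPoint τ - x) (i l) = 0
  sum_abs_le : ∑ τ, |w τ| ≤ C
  abs_le : ∀ τ, |w τ| ≤ C * ((M : ℝ) / N) ^ d
  abs_sum_le : ∀ y : (Fin d → Fin N) → ℝ, |∑ τ, w τ * y τ| ≤ C * √(((M : ℝ) / N) ^ d) * mrNorm 𝓑 y

/-- Normality compares volumes; since c > 1 and d ≥ 1, a volume ratio 1/c gives a side ratio of at
least 1/c. -/
lemma exists_subcubes (hd : 1 ≤ d) {𝓑 : Set (Cube d)} (h𝓑 : IsNormal 𝓑) : ∃ c : ℝ, 1 < c ∧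
    ∀ (b : Fin d → ℝ) (s : ℝ), 0 < s → (∀ a, 0 ≤ b a) → (∀ a, b a + s ≤ 1) →
      ∃ B ∈ 𝓑, s / c ≤ B.side ∧ ∀ x ∈ B.toSet, ∀ a, x a ∈ Set.Ico (b a) (b a + s) := by
  obtain ⟨c, hc, h⟩ := h𝓑
  refine ⟨c, hc, fun b s hs hb hbs => ?_⟩
  have hs1 : s ≤ 1 := by linarith [hb ⟨0, hd⟩, hbs ⟨0, hd⟩]
  obtain ⟨B, hB, hsub, hvol⟩ := h ⟨b, s, hs, hs1, hb, hbs⟩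
  refine ⟨B, hB, ?_, fun x hx => hsub hx⟩
  simp only [Cube.vol] at hvol
  have hc0 : 0 < c := by linarith
  refine le_of_pow_le_pow_left₀ (n := d) (by omega) B.side_pos.le ?_
  refine le_trans ?_ hvol
  rw [div_pow]
  gcongr
  exact le_self_pow₀ hc.le (by omega)

theorem exists_isQuasiInterp (hd : 1 ≤ d) (k : ℕ) {𝓑 : Set (Cube d)} (h𝓑 : IsNormal 𝓑) :
    ∃ C c₀ : ℝ, 0 < C ∧ 0 < c₀ ∧ ∀ M N : ℕ, 1 ≤ M → (M : ℝ) ≤ c₀ * N →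
      ∀ x ∈ Set.Icc (0 : Fin d → ℝ) 1, ∃ w : (Fin d → Fin N) → ℝ, IsQuasiInterp 𝓑 k M C x w := by
  classical
  obtain ⟨c, hc, hcube⟩ := exists_subcubes hd h𝓑
  obtain ⟨ε, K, hε, hεk, hK, hbound, hunif⟩ := exists_tensorLagrange_bounds d k
  have hc0 : 0 < c := by linarith
  have hε1 : ε ≤ 1 := hεk.trans (by
    rw [div_le_one (by positivity)]
    have : (0 : ℝ) ≤ k := Nat.cast_nonneg _
    linarith)
  -- The cubes found below have side at least `ε / (c * M)`, hence at least `(κ * N / M) ^ d` grid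
  -- points; the extra 2 is the rounding loss in `Cube.le_card_gridPoints`.
  set κ := ε / (2 * c) with hκ
  have hκ0 : 0 < κ := by positivity
  have hκ1 : κ ≤ 1 := by rw [hκ, div_le_one (by positivity)]; linarith
  refine ⟨2 * K * (1 / κ ^ d), ε / c, by positivity, by positivity, ?_⟩
  intro M N hM hMN x hx
  have hM0 : (0 : ℝ) < M := by exact_mod_cast hM
  have hM1 : (1 : ℝ) ≤ M := by exact_mod_cast hM
  have hN0 : (0 : ℝ) < N := by
    by_contra hN
    have : (N : ℝ) = 0 := le_antisymm (not_lt.1 hN) (Nat.cast_nonneg _)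
    rw [this] at hMN; linarith
  set h : ℝ := 1 / M with hh
  have hh0 : 0 < h := by positivity
  have hh1 : h ≤ 1 := by rw [hh, div_le_one hM0]; exact hM1
  have hx0 : ∀ a, 0 ≤ x a := fun a => hx.1 a
  have hx1 : ∀ a, x a ≤ 1 := fun a => hx.2 a
  -- With this corner the cube of side `h` contains `x` and stays in the unit cube, and the local
  -- coordinates of `x` in it are `x` itself.
  set b : Fin d → ℝ := fun a => x a * (1 - h) with hb
  have hb0 : ∀ a, 0 ≤ b a := fun a => mul_nonneg (hx0 a) (by linarith)
  have hb1 : ∀ a, b a + h ≤ 1 := fun a => by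
    have : b a ≤ 1 * (1 - h) := mul_le_mul_of_nonneg_right (hx1 a) (by linarith)
    linarith
  -- One cube of the system is taken next to every node of the rescaled interpolation grid.
  have hQ := fun j : Fin d → Fin (k + 1) =>
    hcube (fun a => b a + h * node k (j a)) (h * ε) (by positivity)
      (fun a => add_nonneg (hb0 a) (mul_nonneg hh0.le (node_nonneg k _)))
      (fun a => by
        have h1 := node_add_le k (j a) hεk
        have h2 : h * (node k (j a) + ε) ≤ h * 1 := mul_le_mul_of_nonneg_left h1 hh0.le
        have h3 := hb1 a
        nlinarith)
  choose B hB hside hsub using hQ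
  -- local coordinates
  set Z : (Fin d → Fin N) → Fin d → ℝ := fun τ a => (gridPoint τ a - b a) / h with hZ
  have hZx : ∀ τ a, (gridPoint τ - x) a = h * (Z τ a - x a) := fun τ a => by
    simp only [hZ, hb, Pi.sub_apply]; field_simp; ring
  set G : (Fin d → Fin (k + 1)) → Finset (Fin d → Fin N) := fun j => (B j).gridPoints N with hG
  have hZmem : ∀ j, ∀ τ ∈ G j, ∀ a, node k (j a) ≤ Z τ a ∧ Z τ a ≤ node k (j a) + ε := by
    intro j τ hτ a
    have h1 := hsub j _ (Cube.mem_gridPoints.1 hτ) a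
    simp only [hZ]
    rw [le_div_iff₀ hh0, div_le_iff₀ hh0]
    constructor <;> nlinarith [h1.1, h1.2]
  have hZ01 : ∀ j, ∀ τ ∈ G j, Z τ ∈ Set.Icc (0 : Fin d → ℝ) 1 := fun j τ hτ =>
    ⟨fun a => (node_nonneg k _).trans (hZmem j τ hτ a).1,
      fun a => (hZmem j τ hτ a).2.trans (node_add_le k _ hεk)⟩
  have hnode01 : ∀ j : Fin d → Fin (k + 1), (fun a => node k (j a)) ∈ Set.Icc (0 : Fin d → ℝ) 1 :=
    fun j => ⟨fun a => node_nonneg k _, fun a => by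
      have := node_add_le k (j a) hεk
      simp only [Pi.one_apply]; linarith⟩
  have hside1 : ∀ j, 2 * κ * (N / M) ≤ N * (B j).side := fun j => by
    calc 2 * κ * (N / M) = N * (h * ε / c) := by rw [hκ, hh]; field_simp
      _ ≤ _ := mul_le_mul_of_nonneg_left (hside j) hN0.le
  have hcard : ∀ j, (κ * (N / M)) ^ d ≤ ((G j).card : ℝ) := fun j => by
    refine le_trans ?_ ((B j).le_card_gridPoints ?_)
    · refine pow_le_pow_left₀ (by positivity) ?_ d
      linarith [hside1 j]
    · refine le_trans ?_ (hside1 j)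
      calc (1 : ℝ) = M / M := (div_self hM0.ne').symm
        _ ≤ (ε / c * N) / M := by gcongr
        _ = _ := by rw [hκ]; field_simp
  have hcard0 : ∀ j, 0 < ((G j).card : ℝ) := fun j => lt_of_lt_of_le (by positivity) (hcard j)
  have hcardinv : ∀ j, 1 / ((G j).card : ℝ) ≤ 1 / κ ^ d * ((M : ℝ) / N) ^ d := fun j => by
    calc 1 / ((G j).card : ℝ) ≤ 1 / (κ * (N / M)) ^ d :=
          one_div_le_one_div_of_le (by positivity) (hcard j)
      _ = _ := by simp only [mul_pow, div_pow]; field_simp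
  -- averages
  set avg : (Fin d → Fin (k + 1)) → ((Fin d → Fin N) → ℝ) → ℝ :=
    fun j g => (∑ τ ∈ G j, g τ) / (G j).card with havg
  -- Averages of the Lagrange polynomials over the small cubes are close to their values at the
  -- nodes, that is, to the identity matrix. So the point evaluations at `x` can be written through
  -- these averages.
  obtain ⟨α, hα, hαs⟩ := exists_vecMul_eq (fun j l => avg j fun τ => tensorLagrange k l (Z τ))
    (fun j l => by
      have h1 : (if j = l then (1 : ℝ) else 0) =
          (∑ _τ ∈ G j, tensorLagrange k l (fun a => node k (j a))) / (G j).card := by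
        rw [tensorLagrange_node, Finset.sum_const, nsmul_eq_mul, mul_div_cancel_left₀ _ (hcard0 j).ne']
      simp only [havg]
      rw [h1, ← sub_div, ← Finset.sum_sub_distrib, abs_div, abs_of_pos (hcard0 j),
        div_le_iff₀ (hcard0 j)]
      refine (Finset.abs_sum_le_sum_abs _ _).trans ?_
      refine (Finset.sum_le_card_nsmul _ _ (1 / (2 * Fintype.card (Fin d → Fin (k + 1))) : ℝ)
        fun τ hτ => ?_).trans (le_of_eq (by rw [nsmul_eq_mul, mul_comm]))
      refine hunif _ (hZ01 j τ hτ) _ (hnode01 j) ?_ l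
      refine (pi_norm_le_iff_of_nonneg hε.le).2 fun a => ?_
      have := hZmem j τ hτ a
      rw [Pi.sub_apply, Real.norm_eq_abs, abs_le]
      constructor <;> linarith [this.1, this.2])
    (fun l => tensorLagrange k l x)
  have hαK : ∑ j, |α j| ≤ 2 * K := hαs.trans (mul_le_mul_of_nonneg_left (hbound x hx) zero_le_two)
  set w : (Fin d → Fin N) → ℝ := fun τ => ∑ j, if τ ∈ G j then α j / (G j).card else 0 with hw
  have hwsum : ∀ g : (Fin d → Fin N) → ℝ, ∑ τ, w τ * g τ = ∑ j, α j * avg j g := by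
    intro g
    simp only [hw, Finset.sum_mul]
    rw [Finset.sum_comm]
    refine Finset.sum_congr rfl fun j _ => ?_
    simp only [ite_mul, zero_mul, Finset.sum_ite_mem, Finset.univ_inter, havg]
    rw [← Finset.mul_sum]; ring
  have hrep : ∀ P : Fin d → Polynomial ℝ, (∀ a, (P a).natDegree ≤ k) →
      ∑ τ, w τ * ∏ a, (P a).eval (Z τ a) = ∏ a, (P a).eval (x a) := by
    intro P hP
    rw [hwsum, ← sum_tensorLagrange k P hP x]
    simp only [← hα, ← sum_tensorLagrange k P hP (Z _), havg, Finset.mul_sum]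
    rw [Finset.sum_comm]
    refine Finset.sum_congr rfl fun j _ => ?_
    rw [Finset.sum_comm, Finset.sum_div, Finset.mul_sum]
    refine Finset.sum_congr rfl fun l _ => ?_
    rw [← Finset.mul_sum]; ring
  have hC1 : (1 : ℝ) ≤ 1 / κ ^ d := by
    rw [le_div_iff₀ (by positivity), one_mul]
    exact pow_le_one₀ hκ0.le hκ1
  -- The factors are grouped by coordinate, giving a product of powers of X - x_a. As `0 ^ 0 = 1`,
  -- the value is 1 for r = 0; it is 0 for r ≥ 1, since some coordinate then occurs.
  have hmom : ∀ r, r ≤ k → ∀ i : Fin r → Fin d, ∑ τ, w τ * ∏ l, (Z τ (i l) - x (i l)) =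
      ∏ a, ((0 : ℝ) ^ (Finset.univ.filter fun l => i l = a).card) := by
    intro r hr i
    have h1 := hrep (fun a => (Polynomial.X - Polynomial.C (x a)) ^
      (Finset.univ.filter fun l => i l = a).card) (fun a => by
        rw [Polynomial.natDegree_pow, Polynomial.natDegree_X_sub_C, mul_one]
        exact (Finset.card_le_univ _).trans (by simpa using hr))
    simp only [Polynomial.eval_pow, Polynomial.eval_sub, Polynomial.eval_X, Polynomial.eval_C,
      sub_self] at h1
    rw [← h1]
    refine Finset.sum_congr rfl fun τ _ => ?_
    congr 1
    rw [← Finset.prod_fiberwise Finset.univ i]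
    refine Finset.prod_congr rfl fun a _ => ?_
    rw [Finset.prod_congr rfl (g := fun _ => Z τ a - x a), Finset.prod_const]
    intro l hl
    rw [(Finset.mem_filter.1 hl).2]
  have habs : ∀ τ, |w τ| ≤ ∑ j, if τ ∈ G j then |α j| / (G j).card else 0 := fun τ => by
    refine (Finset.abs_sum_le_sum_abs _ _).trans (le_of_eq (Finset.sum_congr rfl fun j _ => ?_))
    split_ifs
    · rw [abs_div, abs_of_pos (hcard0 j)]
    · exact abs_zero
  refine ⟨w, ⟨?_, ?_, ?_, ?_, ?_, ?_⟩⟩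
  · intro τ hτ
    obtain ⟨j, -, hj⟩ := Finset.exists_ne_zero_of_sum_ne_zero hτ
    have hj' : τ ∈ G j := by by_contra h; exact hj (if_neg h)
    refine (pi_norm_le_iff_of_nonneg (by positivity)).2 fun a => ?_
    rw [hZx, Real.norm_eq_abs, abs_mul, abs_of_pos hh0]
    refine mul_le_of_le_one_right hh0.le (abs_le.2 ?_)
    have h1 := (hZ01 j τ hj').1 a
    have h2 := (hZ01 j τ hj').2 a
    simp only [Pi.zero_apply, Pi.one_apply] at h1 h2
    constructor <;> linarith [hx0 a, hx1 a]
  · simpa using hmom 0 (Nat.zero_le k) (fun l => l.elim0)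
  · intro r hr hrk i
    simp only [hZx, Finset.prod_mul_distrib, Finset.prod_const]
    have h1 := hmom r hrk i
    rw [Finset.prod_eq_zero (Finset.mem_univ (i ⟨0, hr⟩))] at h1
    · calc _ = h ^ r * ∑ τ, w τ * ∏ l, (Z τ (i l) - x (i l)) := by
            rw [Finset.mul_sum]
            refine Finset.sum_congr rfl fun τ _ => ?_
            simp; ring
        _ = 0 := by rw [h1, mul_zero]
    · refine zero_pow (Finset.card_ne_zero_of_mem (a := ⟨0, hr⟩) ?_)
      simp
  · calc ∑ τ, |w τ| ≤ ∑ τ, ∑ j, if τ ∈ G j then |α j| / (G j).card else 0 :=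
          Finset.sum_le_sum fun τ _ => habs τ
      _ = ∑ j, |α j| := by
          rw [Finset.sum_comm]
          refine Finset.sum_congr rfl fun j _ => ?_
          rw [Finset.sum_ite_mem, Finset.univ_inter, Finset.sum_const, nsmul_eq_mul,
            mul_div_cancel₀ _ (hcard0 j).ne']
      _ ≤ 2 * K := hαK
      _ ≤ _ := le_mul_of_one_le_right (by positivity) hC1
  · intro τ
    calc |w τ| ≤ ∑ j, if τ ∈ G j then |α j| / (G j).card else 0 := habs τ
      _ ≤ ∑ j, |α j| * (1 / κ ^ d * ((M : ℝ) / N) ^ d) := by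
          refine Finset.sum_le_sum fun j _ => ?_
          split_ifs
          · rw [div_eq_mul_one_div]
            exact mul_le_mul_of_nonneg_left (hcardinv j) (abs_nonneg _)
          · positivity
      _ ≤ 2 * K * (1 / κ ^ d * ((M : ℝ) / N) ^ d) := by
          rw [← Finset.sum_mul]
          exact mul_le_mul_of_nonneg_right hαK (by positivity)
      _ = _ := by ring
  · intro y
    rw [hwsum]
    have hS := mrNorm_nonneg 𝓑 y
    -- An average is 1/√(number of points) times a term of the multiresolution norm, which is where
    -- the factor √((M/N)^d) comes from.
    have h1 : ∀ j, |avg j y| ≤ 1 / κ ^ d * √(((M : ℝ) / N) ^ d) * mrNorm 𝓑 y := by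
      intro j
      have h2 := le_mrNorm y (hB j)
      have h3 : |avg j y| = √(1 / (G j).card) * (|∑ τ ∈ G j, y τ| / √((G j).card)) := by
        simp only [havg]
        rw [abs_div, abs_of_pos (hcard0 j), Real.sqrt_div zero_le_one, Real.sqrt_one,
          one_div_mul_eq_div, div_div, Real.mul_self_sqrt (hcard0 j).le]
      rw [h3]
      refine mul_le_mul ?_ h2 (by positivity) (by positivity)
      calc √(1 / (G j).card) ≤ √((1 / κ ^ d) ^ 2 * ((M : ℝ) / N) ^ d) := by
            refine Real.sqrt_le_sqrt ((hcardinv j).trans ?_)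
            refine mul_le_mul_of_nonneg_right ?_ (by positivity)
            exact le_self_pow₀ hC1 two_ne_zero
        _ = _ := by rw [Real.sqrt_mul (by positivity), Real.sqrt_sq (by positivity)]
    calc |∑ j, α j * avg j y| ≤ ∑ j, |α j| * (1 / κ ^ d * √(((M : ℝ) / N) ^ d) * mrNorm 𝓑 y) := by
          refine (Finset.abs_sum_le_sum_abs _ _).trans (Finset.sum_le_sum fun j _ => ?_)
          rw [abs_mul]
          exact mul_le_mul_of_nonneg_left (h1 j) (abs_nonneg _)
      _ ≤ 2 * K * (1 / κ ^ d * √(((M : ℝ) / N) ^ d) * mrNorm 𝓑 y) := by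
          rw [← Finset.sum_mul]
          exact mul_le_mul_of_nonneg_right hαK (by positivity)
      _ = _ := by ring

end QuasiInterpolationExists

end MIND
namespace MIND

section Approximation

variable {d : ℕ}

/-! ### Approximation by quasi-interpolation -/

lemma gridPoint_mem {N : ℕ} (τ : Fin d → Fin N) : gridPoint τ ∈ Set.Icc (0 : Fin d → ℝ) 1 := by
  refine ⟨fun a => ?_, fun a => ?_⟩
  · simp only [gridPoint, Pi.zero_apply]; positivity
  · simp only [gridPoint, Pi.one_apply]
    refine div_le_one_of_le₀ ?_ (Nat.cast_nonneg _)
    exact_mod_cast (τ a).2.le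

lemma one_le_norm_of_ne_zero {m : Fin d → ℤ} (hm : m ≠ 0) : 1 ≤ ‖m‖ := by
  obtain ⟨a, ha⟩ := Function.ne_iff.1 hm
  refine le_trans ?_ (norm_le_pi_norm m a)
  rw [Int.norm_eq_abs]
  exact_mod_cast Int.one_le_abs ha

lemma abs_le_norm_int (m : Fin d → ℤ) (a : Fin d) : |(m a : ℝ)| ≤ ‖m‖ := by
  rw [← Int.norm_eq_abs]; exact norm_le_pi_norm m a

lemma pow_norm_le_sum_sq (m : Fin d → ℤ) : ‖m‖ ^ 2 ≤ ∑ a, (m a : ℝ) ^ 2 := by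
  have h0 : 0 ≤ ∑ a, (m a : ℝ) ^ 2 := Finset.sum_nonneg fun a _ => sq_nonneg _
  rw [← Real.le_sqrt (norm_nonneg _) h0]
  refine (pi_norm_le_iff_of_nonneg (Real.sqrt_nonneg _)).2 fun a => ?_
  rw [Int.norm_eq_abs]
  refine Real.abs_le_sqrt ?_
  exact Finset.single_le_sum (f := fun a => (m a : ℝ) ^ 2) (fun a _ => sq_nonneg _)
    (Finset.mem_univ a)

lemma MemHk0.summable_pow_norm {k : ℕ} {f : (Fin d → ℝ) → ℝ} (hf : MemHk0 k f) :
    Summable (fun m => ‖m‖ ^ (2 * k) * ‖fcoef f m‖ ^ 2) ∧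
    ∑' m, ‖m‖ ^ (2 * k) * ‖fcoef f m‖ ^ 2 ≤ sobolevNorm k f ^ 2 := by
  have h := hf.hasSum_sobolevNorm
  have hle : ∀ m, ‖m‖ ^ (2 * k) * ‖fcoef f m‖ ^ 2 ≤
      (2 * Real.pi) ^ (2 * k) * (∑ a, (m a : ℝ) ^ 2) ^ k * ‖fcoef f m‖ ^ 2 := fun m => by
    refine mul_le_mul_of_nonneg_right ?_ (sq_nonneg _)
    rw [pow_mul ‖m‖]
    have h1 : (‖m‖ ^ 2) ^ k ≤ (∑ a, (m a : ℝ) ^ 2) ^ k :=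
      pow_le_pow_left₀ (sq_nonneg _) (pow_norm_le_sum_sq m) k
    have h2 : (1 : ℝ) ≤ (2 * Real.pi) ^ (2 * k) :=
      one_le_pow₀ (by linarith [Real.pi_gt_three])
    have h3 : 0 ≤ (∑ a, (m a : ℝ) ^ 2) ^ k := pow_nonneg (Finset.sum_nonneg fun a _ => sq_nonneg _) _
    nlinarith
  have hs : Summable (fun m => ‖m‖ ^ (2 * k) * ‖fcoef f m‖ ^ 2) :=
    Summable.of_nonneg_of_le (fun m => by positivity) hle h.summable
  refine ⟨hs, ?_⟩
  rw [← h.tsum_eq]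
  exact hs.tsum_le_tsum hle h.summable

lemma freqWeight_mul_le {k N : ℕ} (hN : 1 ≤ N) {f : (Fin d → ℝ) → ℝ} (hf : MemHk0 k f)
    (m : Fin d → ℤ) :
    freqWeight k N m * ‖fcoef f m‖ ^ 2 ≤ 4 ^ k * (‖m‖ ^ (2 * k) * ‖fcoef f m‖ ^ 2) := by
  by_cases hm : m = 0
  · subst hm; simp only [hf.fcoef_zero]; simp
  · rw [← mul_assoc]
    refine mul_le_mul_of_nonneg_right ?_ (sq_nonneg _)
    have h1 := one_le_norm_of_ne_zero hm
    rw [show (4 : ℝ) ^ k = 2 ^ (2 * k) by rw [pow_mul]; norm_num, ← mul_pow, freqWeight]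
    refine pow_le_pow_left₀ (by positivity) ?_ _
    have h2 : ‖m‖ / N ≤ ‖m‖ := div_le_self (norm_nonneg _) (by exact_mod_cast hN)
    linarith

/-- Cauchy–Schwarz against the convergent sum of (1 + ‖m‖)^{-2k}. -/
lemma MemHk0.summable_fcoef {k : ℕ} (hk : d < 2 * k) {f : (Fin d → ℝ) → ℝ} (hf : MemHk0 k f) :
    Summable fun m => ‖fcoef f m‖ := by
  have h1 : Summable fun m => freqWeight k 1 m * ‖fcoef f m‖ ^ 2 :=
    Summable.of_nonneg_of_le (fun m => mul_nonneg (freqWeight_pos _ _ _).le (sq_nonneg _))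
      (freqWeight_mul_le le_rfl hf) (hf.summable_pow_norm.1.mul_left _)
  refine (tsum_norm_sq_le (fun m => inv_nonneg.2 (freqWeight_pos k 1 m).le)
    (fun m => mul_nonneg (freqWeight_pos k 1 m).le (sq_nonneg _))
    (summable_freqWeight_one hk) h1 fun m => ?_).1
  rw [← mul_assoc, inv_mul_cancel₀ (freqWeight_pos k 1 m).ne', one_mul]

lemma MemHk0.hasSum_char {k : ℕ} (hk : d < 2 * k) {f : (Fin d → ℝ) → ℝ} (hf : MemHk0 k f)
    {x : Fin d → ℝ} (hx : x ∈ Set.Icc (0 : Fin d → ℝ) 1) :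
    HasSum (fun m => fcoef f m * char m x) (f x : ℂ) :=
  hasSum_fcoef_char hf.continuous (hf.summable_fcoef hk) hx

section

variable {N : ℕ} {𝓑 : Set (Cube d)} {k M : ℕ} {C : ℝ} {x : Fin d → ℝ} {w : (Fin d → Fin N) → ℝ}

lemma sum_mul_pow_eq (w : (Fin d → Fin N) → ℝ) (x : Fin d → ℝ) (m : Fin d → ℤ) (r : ℕ) :
    ∑ τ, w τ * (∑ a, (m a : ℝ) * (gridPoint τ - x) a) ^ r =
      ∑ i : Fin r → Fin d, (∏ l, (m (i l) : ℝ)) * ∑ τ, w τ * ∏ l, (gridPoint τ - x) (i l) := by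
  simp only [Finset.sum_pow', ← Fintype.piFinset_univ, Finset.mul_sum, Finset.prod_mul_distrib]
  rw [Fintype.piFinset_univ, Finset.sum_comm]
  refine Finset.sum_congr rfl fun i _ => Finset.sum_congr rfl fun τ _ => ?_
  ring

lemma IsQuasiInterp.sum_mul_pow (hw : IsQuasiInterp 𝓑 k M C x w) (m : Fin d → ℤ) {r : ℕ}
    (hr : 1 ≤ r) (hrk : r ≤ k) :
    ∑ τ, w τ * (∑ a, (m a : ℝ) * (gridPoint τ - x) a) ^ r = 0 := by
  rw [sum_mul_pow_eq]
  exact Finset.sum_eq_zero fun i _ => by rw [hw.sum_moment r hr hrk i, mul_zero]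

lemma char_gridPoint (m : Fin d → ℤ) (x : Fin d → ℝ) (τ : Fin d → Fin N) :
    char m (gridPoint τ) = char m x * Complex.exp
      (2 * Real.pi * Complex.I * ((∑ a, (m a : ℝ) * (gridPoint τ - x) a : ℝ) : ℂ)) := by
  conv_lhs => rw [show gridPoint τ = x + (gridPoint τ - x) by abel, char_add_right]
  rfl

lemma IsQuasiInterp.nonneg (hw : IsQuasiInterp 𝓑 k M C x w) : 0 ≤ C :=
  (Finset.sum_nonneg fun _ _ => abs_nonneg _).trans hw.sum_abs_le

/-- The error of quasi-interpolation on a character. -/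
lemma IsQuasiInterp.norm_char_sub_le (hw : IsQuasiInterp 𝓑 k M C x w) (hM : 1 ≤ M)
    (m : Fin d → ℤ) :
    ‖char m x - ∑ τ, (w τ : ℂ) * char m (gridPoint τ)‖ ≤
      (1 + C * ((2 * Real.pi * d) ^ (k + 1) * Real.exp (2 * Real.pi * d)) + C) *
        (2 * (‖m‖ / M) / (1 + ‖m‖ / M)) ^ k := by
  have hC := hw.nonneg
  have hM0 : (0 : ℝ) < M := by exact_mod_cast hM
  set t := ‖m‖ / M with ht
  have ht0 : 0 ≤ t := by positivity
  set A := (2 * Real.pi * d) ^ (k + 1) * Real.exp (2 * Real.pi * d) with hA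
  have hA0 : 0 ≤ A := by positivity
  -- For frequencies up to `M`, Taylor expansion of the exponential gives an error of order t^{k+1}.
  -- For higher ones the trivial bound 1 + C suffices, since 2t/(1+t) ≥ 1.
  rcases le_or_gt t 1 with ht1 | ht1
  · have hz : ∀ τ, w τ ≠ 0 → ‖(2 * Real.pi * Complex.I *
        ((∑ a, (m a : ℝ) * (gridPoint τ - x) a : ℝ) : ℂ))‖ ≤ 2 * Real.pi * d * t := by
      intro τ hτ
      have h1 : |∑ a, (m a : ℝ) * (gridPoint τ - x) a| ≤ d * t := by
        calc |∑ a, (m a : ℝ) * (gridPoint τ - x) a| ≤ ∑ _a : Fin d, ‖m‖ * (1 / M) := by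
              refine (Finset.abs_sum_le_sum_abs _ _).trans (Finset.sum_le_sum fun a _ => ?_)
              rw [abs_mul]
              refine mul_le_mul (abs_le_norm_int m a) ?_ (abs_nonneg _) (norm_nonneg _)
              exact (norm_le_pi_norm (gridPoint τ - x) a).trans (hw.near τ hτ)
          _ = d * t := by
              simp only [Finset.sum_const, Finset.card_univ, Fintype.card_fin, nsmul_eq_mul, ht]; ring
      simp only [norm_mul, Complex.norm_ofNat, Complex.norm_real, Complex.norm_I, mul_one,
        Real.norm_eq_abs, abs_of_pos Real.pi_pos]
      rw [mul_assoc (2 * Real.pi)]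
      exact mul_le_mul_of_nonneg_left h1 (by positivity)
    set z : (Fin d → Fin N) → ℂ := fun τ => 2 * Real.pi * Complex.I *
        ((∑ a, (m a : ℝ) * (gridPoint τ - x) a : ℝ) : ℂ) with hzdef
    -- The moment conditions remove the Taylor terms of orders 1 to k, and order 0 gives 1.
    have hpoly : ∑ τ, (w τ : ℂ) * ∑ r ∈ Finset.range (k + 1), z τ ^ r / r.factorial = 1 := by
      simp only [Finset.mul_sum]
      rw [Finset.sum_comm, Finset.sum_range_succ', Finset.sum_eq_zero, zero_add]
      · simp only [pow_zero, Nat.factorial_zero, Nat.cast_one, div_one, mul_one]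
        exact_mod_cast hw.sum_eq_one
      · intro r hr
        have h1 := hw.sum_mul_pow m (r := r + 1) (by omega) (by
          have := Finset.mem_range.1 hr; omega)
        have h2 : ∑ τ, (w τ : ℂ) * ((∑ a, (m a : ℝ) * (gridPoint τ - x) a : ℝ) : ℂ) ^ (r + 1) = 0 := by
          exact_mod_cast congr_arg (fun s : ℝ => (s : ℂ)) h1
        calc _ = (2 * Real.pi * Complex.I) ^ (r + 1) / (r + 1).factorial *
              ∑ τ, (w τ : ℂ) * ((∑ a, (m a : ℝ) * (gridPoint τ - x) a : ℝ) : ℂ) ^ (r + 1) := by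
              rw [Finset.mul_sum]
              refine Finset.sum_congr rfl fun τ _ => ?_
              rw [hzdef, mul_pow]; ring
          _ = 0 := by rw [h2, mul_zero]
    have h2 : char m x - ∑ τ, (w τ : ℂ) * char m (gridPoint τ) = -(char m x * ∑ τ, (w τ : ℂ) *
        (Complex.exp (z τ) - ∑ r ∈ Finset.range (k + 1), z τ ^ r / r.factorial)) := by
      simp only [mul_sub, Finset.sum_sub_distrib, hpoly, char_gridPoint m x]
      rw [mul_one, neg_sub, Finset.mul_sum]
      congr 1
      refine Finset.sum_congr rfl fun τ _ => ?_
      ring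
    rw [h2, norm_neg, norm_mul, norm_char, one_mul]
    calc ‖∑ τ, (w τ : ℂ) * (Complex.exp (z τ) - ∑ r ∈ Finset.range (k + 1), z τ ^ r / r.factorial)‖
        ≤ ∑ τ, |w τ| * (A * t ^ (k + 1)) := by
          refine (norm_sum_le _ _).trans (Finset.sum_le_sum fun τ _ => ?_)
          rw [norm_mul, Complex.norm_real, Real.norm_eq_abs]
          by_cases hτ : w τ = 0
          · simp [hτ]
          refine mul_le_mul_of_nonneg_left ?_ (abs_nonneg _)
          refine (Complex.norm_exp_sub_sum_le_norm_mul_exp (z τ) (k + 1)).trans ?_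
          have h3 := hz τ hτ
          have h4 : ‖z τ‖ ≤ 2 * Real.pi * d :=
            h3.trans (mul_le_of_le_one_right (by positivity) ht1)
          calc ‖z τ‖ ^ (k + 1) * Real.exp ‖z τ‖
              ≤ (2 * Real.pi * d * t) ^ (k + 1) * Real.exp (2 * Real.pi * d) := by gcongr
            _ = _ := by rw [hA, mul_pow]; ring
      _ ≤ C * (A * t ^ (k + 1)) := by
          rw [← Finset.sum_mul]
          exact mul_le_mul_of_nonneg_right hw.sum_abs_le (by positivity)
      _ = (C * A) * t ^ (k + 1) := by ring
      _ ≤ (1 + C * A + C) * (2 * t / (1 + t)) ^ k := by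
          have h5 : t ^ (k + 1) ≤ (2 * t / (1 + t)) ^ k := by
            calc t ^ (k + 1) ≤ t ^ k := pow_le_pow_of_le_one ht0 ht1 (Nat.le_succ k)
              _ ≤ _ := by
                refine pow_le_pow_left₀ ht0 ?_ k
                rw [le_div_iff₀ (by linarith)]
                nlinarith
          exact mul_le_mul (by linarith) h5 (by positivity) (by positivity)
  · calc ‖char m x - ∑ τ, (w τ : ℂ) * char m (gridPoint τ)‖
        ≤ ‖char m x‖ + ‖∑ τ, (w τ : ℂ) * char m (gridPoint τ)‖ := norm_sub_le _ _
      _ ≤ 1 + C := by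
          rw [norm_char]
          refine add_le_add le_rfl (le_trans ((norm_sum_le _ _).trans (le_of_eq ?_)) hw.sum_abs_le)
          refine Finset.sum_congr rfl fun τ _ => ?_
          rw [norm_mul, norm_char, mul_one, Complex.norm_real, Real.norm_eq_abs]
      _ ≤ (1 + C * A + C) * 1 := by nlinarith
      _ ≤ _ := by
          refine mul_le_mul_of_nonneg_left ?_ (by positivity)
          refine one_le_pow₀ ?_
          rw [le_div_iff₀ (by linarith)]
          linarith

lemma IsQuasiInterp.hasSum_sub (hk : d < 2 * k) {g : (Fin d → ℝ) → ℝ} (hg : MemHk0 k g)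
    (hx : x ∈ Set.Icc (0 : Fin d → ℝ) 1) (w : (Fin d → Fin N) → ℝ) :
    HasSum (fun m => fcoef g m * (char m x - ∑ τ, (w τ : ℂ) * char m (gridPoint τ)))
      (((g x - ∑ τ, w τ * g (gridPoint τ) : ℝ)) : ℂ) := by
  have h1 := hg.hasSum_char hk hx
  have h2 := hasSum_sum (s := Finset.univ) fun (τ : Fin d → Fin N) _ =>
    (hg.hasSum_char hk (gridPoint_mem τ)).mul_left (w τ : ℂ)
  have h3 := h1.sub h2
  convert! h3 using 1
  · ext m
    rw [mul_sub, Finset.mul_sum]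
    congr 1
    refine Finset.sum_congr rfl fun τ _ => ?_
    ring
  · push_cast; rfl

/-- The pointwise error of quasi-interpolation. -/
theorem exists_abs_sub_le (hk : d < 2 * k) (hC : 0 ≤ C) :
    ∃ C' : ℝ, 0 ≤ C' ∧ ∀ (N M : ℕ), 1 ≤ M → ∀ x ∈ Set.Icc (0 : Fin d → ℝ) 1,
      ∀ w : (Fin d → Fin N) → ℝ, IsQuasiInterp 𝓑 k M C x w → ∀ g, MemHk0 k g →
        (g x - ∑ τ, w τ * g (gridPoint τ)) ^ 2 ≤
          C' * ((M : ℝ) ^ d / (M : ℝ) ^ (2 * k)) * sobolevNorm k g ^ 2 := by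
  set A := 1 + C * ((2 * Real.pi * d) ^ (k + 1) * Real.exp (2 * Real.pi * d)) + C with hA
  refine ⟨A ^ 2 * 4 ^ k * (4 ^ k * latticeSum d k), ?_, ?_⟩
  · have := latticeSum_nonneg d k
    positivity
  intro N M hM x hx w hw g hg
  have hM0 : (0 : ℝ) < M := by exact_mod_cast hM
  have : NeZero M := ⟨by omega⟩
  obtain ⟨hs, hle⟩ := hg.summable_pow_norm
  obtain ⟨hws, hwle⟩ := tsum_freqWeight_le hk M
  have h1 := (IsQuasiInterp.hasSum_sub hk hg hx w).tsum_eq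
  -- The factor (2t/(1+t))^{2k} with t = ‖m‖/M splits as 4^k ‖m‖^{2k} M^{-2k} over `freqWeight k M
  -- m`: one part goes to the Sobolev norm, the other to the lattice sum of order M^d.
  have h2 : ∀ m, ‖fcoef g m * (char m x - ∑ τ, (w τ : ℂ) * char m (gridPoint τ))‖ ^ 2 ≤
      (A ^ 2 * 4 ^ k / (M : ℝ) ^ (2 * k) * (freqWeight k M m)⁻¹) *
        (‖m‖ ^ (2 * k) * ‖fcoef g m‖ ^ 2) := by
    intro m
    have h3 := pow_le_pow_left₀ (norm_nonneg _) (hw.norm_char_sub_le hM m) 2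
    rw [norm_mul, mul_pow]
    calc ‖fcoef g m‖ ^ 2 * ‖char m x - ∑ τ, (w τ : ℂ) * char m (gridPoint τ)‖ ^ 2
        ≤ ‖fcoef g m‖ ^ 2 * (A * (2 * (‖m‖ / M) / (1 + ‖m‖ / M)) ^ k) ^ 2 :=
          mul_le_mul_of_nonneg_left h3 (sq_nonneg _)
      _ = _ := by
          rw [freqWeight, show (4 : ℝ) ^ k = 2 ^ (2 * k) by rw [pow_mul]; norm_num]
          rw [mul_pow A, ← pow_mul _ k 2, mul_comm k 2, div_pow, mul_pow, div_pow]
          field_simp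
  have h4 := norm_tsum_sq_le (fun m => mul_nonneg (by positivity)
    (inv_nonneg.2 (freqWeight_pos k M m).le)) (fun m => by positivity) (hws.mul_left _) hs h2
  rw [h1, Complex.norm_real, Real.norm_eq_abs, sq_abs, tsum_mul_left] at h4
  refine h4.trans (mul_le_mul ?_ hle (tsum_nonneg fun m => by positivity) ?_)
  · calc _ ≤ A ^ 2 * 4 ^ k / (M : ℝ) ^ (2 * k) * ((M : ℝ) ^ d * (4 ^ k * latticeSum d k)) :=
          mul_le_mul_of_nonneg_left hwle (by positivity)
      _ = _ := by ring
  · have := latticeSum_nonneg d k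
    positivity

end

end Approximation

end MIND
namespace MIND

/-! ### Quasi-interpolation of band-limited functions -/

section LowFrequency

variable {d : ℕ}

/-- The trigonometric polynomials in the Taylor expansion of a band-limited function. -/
noncomputable def taylorPart (F : Finset (Fin d → ℤ)) (c : (Fin d → ℤ) → ℂ) (M : ℕ) {r : ℕ}
    (i : Fin r → Fin d) : (Fin d → ℝ) → ℂ :=
  trigPoly F (fun m => c m * ((∏ l, ((m (i l) : ℝ) / M) : ℝ) : ℂ))

/-- A pointwise majorant for the error of quasi-interpolation of a band-limited function. -/
noncomputable def lowSq (F : Finset (Fin d → ℤ)) (c : (Fin d → ℤ) → ℂ) (k M : ℕ)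
    (x : Fin d → ℝ) : ℝ :=
  ∑' r : ℕ, if r ≤ k then 0 else
    (2 * Real.pi) ^ r / r.factorial * ∑ i : Fin r → Fin d, ‖taylorPart F c M i x‖ ^ 2

variable {F : Finset (Fin d → ℤ)} {c : (Fin d → ℤ) → ℂ} {k M : ℕ}

lemma abs_prod_div_le (hM : 1 ≤ M) {m : Fin d → ℤ} {r : ℕ}
    (i : Fin r → Fin d) : |∏ l, ((m (i l) : ℝ) / M)| ≤ (‖m‖ / M) ^ r := by
  have hM0 : (0 : ℝ) < M := by exact_mod_cast hM
  rw [Finset.abs_prod]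
  calc ∏ l, |(m (i l) : ℝ) / M| ≤ ∏ _l : Fin r, ‖m‖ / M := by
        refine Finset.prod_le_prod (fun _ _ => abs_nonneg _) fun l _ => ?_
        rw [abs_div, abs_of_pos hM0]
        exact div_le_div_of_nonneg_right (abs_le_norm_int m _) hM0.le
    _ = _ := by rw [Finset.prod_const, Finset.card_univ, Fintype.card_fin]

lemma norm_taylorPart_le (hF : ∀ m ∈ F, ‖m‖ ≤ M) (hM : 1 ≤ M) {r : ℕ} (i : Fin r → Fin d)
    (x : Fin d → ℝ) : ‖taylorPart F c M i x‖ ≤ ∑ m ∈ F, ‖c m‖ := by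
  have hM0 : (0 : ℝ) < M := by exact_mod_cast hM
  refine (norm_sum_le _ _).trans (Finset.sum_le_sum fun m hm => ?_)
  rw [norm_mul, norm_char, mul_one, norm_mul, Complex.norm_real, Real.norm_eq_abs]
  refine mul_le_of_le_one_right (norm_nonneg _) ((abs_prod_div_le hM i).trans ?_)
  exact pow_le_one₀ (by positivity) ((div_le_one hM0).2 (hF m hm))

lemma hasSum_exp_div (z : ℂ) : HasSum (fun r : ℕ => z ^ r / r.factorial) (Complex.exp z) := by
  rw [Complex.exp_eq_exp_ℂ]; exact NormedSpace.expSeries_div_hasSum_exp z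

lemma hasSum_real_exp_div (t : ℝ) : HasSum (fun r : ℕ => t ^ r / r.factorial) (Real.exp t) := by
  rw [Real.exp_eq_exp_ℝ]; exact NormedSpace.expSeries_div_hasSum_exp t

lemma lowSq_term_nonneg (r : ℕ) (x : Fin d → ℝ) : 0 ≤ if r ≤ k then 0 else
    (2 * Real.pi) ^ r / r.factorial * ∑ i : Fin r → Fin d, ‖taylorPart F c M i x‖ ^ 2 := by
  split_ifs <;> positivity

lemma lowSq_term_le (hF : ∀ m ∈ F, ‖m‖ ≤ M) (hM : 1 ≤ M) (r : ℕ) (x : Fin d → ℝ) :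
    (if r ≤ k then 0 else
      (2 * Real.pi) ^ r / r.factorial * ∑ i : Fin r → Fin d, ‖taylorPart F c M i x‖ ^ 2) ≤
    (2 * Real.pi * d) ^ r / r.factorial * (∑ m ∈ F, ‖c m‖) ^ 2 := by
  split_ifs with h
  · positivity
  · calc _ ≤ (2 * Real.pi) ^ r / r.factorial * ∑ _i : Fin r → Fin d, (∑ m ∈ F, ‖c m‖) ^ 2 := by
          gcongr with i
          exact norm_taylorPart_le hF hM i x
      _ = _ := by
          simp only [Finset.sum_const, Finset.card_univ, Fintype.card_fun, Fintype.card_fin,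
            nsmul_eq_mul]
          push_cast
          rw [mul_pow _ (d : ℝ)]; ring

lemma summable_lowSq (hF : ∀ m ∈ F, ‖m‖ ≤ M) (hM : 1 ≤ M) (x : Fin d → ℝ) :
    Summable fun r : ℕ => if r ≤ k then 0 else
      (2 * Real.pi) ^ r / r.factorial * ∑ i : Fin r → Fin d, ‖taylorPart F c M i x‖ ^ 2 :=
  Summable.of_nonneg_of_le (fun r => lowSq_term_nonneg r x) (fun r => lowSq_term_le hF hM r x)
    ((hasSum_real_exp_div _).summable.mul_right _)

lemma continuous_lowSq_term (r : ℕ) : Continuous fun x => if r ≤ k then 0 else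
    (2 * Real.pi) ^ r / r.factorial * ∑ i : Fin r → Fin d, ‖taylorPart F c M i x‖ ^ 2 := by
  split_ifs
  · exact continuous_const
  · exact continuous_const.mul (continuous_finsetSum _ fun i _ =>
      (continuous_trigPoly F _).norm.pow 2)

lemma continuous_lowSq (hF : ∀ m ∈ F, ‖m‖ ≤ M) (hM : 1 ≤ M) : Continuous (lowSq F c k M) := by
  refine continuous_tsum (fun r => continuous_lowSq_term r)
    ((hasSum_real_exp_div (2 * Real.pi * d)).summable.mul_right ((∑ m ∈ F, ‖c m‖) ^ 2))
    fun r x => ?_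
  rw [Real.norm_eq_abs, abs_of_nonneg (lowSq_term_nonneg r x)]
  exact lowSq_term_le hF hM r x

lemma lowSq_nonneg (x : Fin d → ℝ) : 0 ≤ lowSq F c k M x := tsum_nonneg fun r => lowSq_term_nonneg r x

/-- Parseval for each `taylorPart`. Only orders r ≥ k + 1 occur and ‖m‖ ≤ M, so (‖m‖/M)^{2r} is at
most its (2k+2)-th power; the d^r index tuples of order r make the factorial series sum to exp(2πd).
-/
lemma integral_lowSq_le (hF : ∀ m ∈ F, ‖m‖ ≤ M) (hM : 1 ≤ M) :
    ∫ x, lowSq F c k M x ∂(cellMeasure d) ≤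
      Real.exp (2 * Real.pi * d) * ∑ m ∈ F, (‖m‖ / M) ^ (2 * k + 2) * ‖c m‖ ^ 2 := by
  have hM0 : (0 : ℝ) < M := by exact_mod_cast hM
  set S := ∑ m ∈ F, (‖m‖ / M) ^ (2 * k + 2) * ‖c m‖ ^ 2 with hS
  have hS0 : 0 ≤ S := Finset.sum_nonneg fun m _ => by positivity
  have hint : ∀ r : ℕ, Integrable (fun x => if r ≤ k then 0 else
      (2 * Real.pi) ^ r / r.factorial * ∑ i : Fin r → Fin d, ‖taylorPart F c M i x‖ ^ 2)
      (cellMeasure d) := fun r => integrable_cell (continuous_lowSq_term r)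
  have hterm : ∀ r : ℕ, ∫ x, (if r ≤ k then 0 else
      (2 * Real.pi) ^ r / r.factorial * ∑ i : Fin r → Fin d, ‖taylorPart F c M i x‖ ^ 2)
      ∂(cellMeasure d) ≤ (2 * Real.pi * d) ^ r / r.factorial * S := by
    intro r
    split_ifs with h
    · simp only [integral_zero]; positivity
    · have hi : ∀ i ∈ (Finset.univ : Finset (Fin r → Fin d)),
          Integrable (fun x => ‖taylorPart F c M i x‖ ^ 2) (cellMeasure d) :=
        fun i _ => integrable_cell ((continuous_trigPoly F _).norm.pow 2)
      rw [integral_const_mul, integral_finsetSum _ hi]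
      calc _ ≤ (2 * Real.pi) ^ r / r.factorial * ∑ _i : Fin r → Fin d, S := by
            refine mul_le_mul_of_nonneg_left (Finset.sum_le_sum fun i _ => ?_) (by positivity)
            rw [taylorPart, integral_normSq_trigPoly]
            refine Finset.sum_le_sum fun m hm => ?_
            rw [norm_mul, mul_pow, mul_comm, Complex.norm_real, Real.norm_eq_abs]
            refine mul_le_mul_of_nonneg_right ?_ (sq_nonneg _)
            refine (pow_le_pow_left₀ (abs_nonneg _) (abs_prod_div_le hM i) 2).trans ?_
            rw [← pow_mul]
            exact pow_le_pow_of_le_one (by positivity) ((div_le_one hM0).2 (hF m hm)) (by omega)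
        _ = _ := by
          simp only [Finset.sum_const, Finset.card_univ, Fintype.card_fun, Fintype.card_fin,
            nsmul_eq_mul]
          push_cast
          rw [mul_pow _ (d : ℝ)]; ring
  have hsum := (hasSum_real_exp_div (2 * Real.pi * d)).mul_right S
  have hnn : ∀ r : ℕ, 0 ≤ ∫ x, (if r ≤ k then 0 else
      (2 * Real.pi) ^ r / r.factorial * ∑ i : Fin r → Fin d, ‖taylorPart F c M i x‖ ^ 2)
      ∂(cellMeasure d) := fun r => integral_nonneg fun x => lowSq_term_nonneg r x
  have hs := Summable.of_nonneg_of_le hnn hterm hsum.summable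
  unfold lowSq
  rw [← integral_tsum_of_summable_integral_norm hint (by
    simpa only [Real.norm_eq_abs, abs_of_nonneg (lowSq_term_nonneg _ _)] using hs), ← hsum.tsum_eq]
  exact hs.tsum_le_tsum hterm hsum.summable

/-- The error of quasi-interpolation of a band-limited function. -/
lemma IsQuasiInterp.norm_trigPoly_sub_sq_le {N : ℕ} {𝓑 : Set (Cube d)} {C : ℝ} {x : Fin d → ℝ}
    {w : (Fin d → Fin N) → ℝ} (hw : IsQuasiInterp 𝓑 k M C x w) (hF : ∀ m ∈ F, ‖m‖ ≤ M)
    (hM : 1 ≤ M) :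
    ‖∑ τ, (w τ : ℂ) * trigPoly F c (gridPoint τ) - trigPoly F c x‖ ^ 2 ≤
      C ^ 2 * Real.exp (2 * Real.pi * d) * lowSq F c k M x := by
  have hC := hw.nonneg
  have hM0 : (0 : ℝ) < M := by exact_mod_cast hM
  set y : (Fin d → ℤ) → (Fin d → Fin N) → ℝ := fun m τ =>
    ∑ a, (m a : ℝ) * (gridPoint τ - x) a with hy
  set μ : (r : ℕ) → (Fin r → Fin d) → ℝ := fun r i => ∑ τ, w τ * ∏ l, (gridPoint τ - x) (i l)
    with hμ
  set T : ℕ → ℂ := fun r => ∑ m ∈ F, c m * char m x *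
    ∑ τ, (w τ : ℂ) * ((2 * Real.pi * Complex.I * (y m τ : ℂ)) ^ r / r.factorial) with hT
  have hsumT : HasSum T (∑ τ, (w τ : ℂ) * trigPoly F c (gridPoint τ)) := by
    have h1 := hasSum_sum (s := F) fun m _ => (hasSum_sum (s := Finset.univ)
      fun (τ : Fin d → Fin N) _ => (hasSum_exp_div (2 * Real.pi * Complex.I * (y m τ : ℂ))).mul_left
        (w τ : ℂ)).mul_left (c m * char m x)
    convert! h1 using 1
    simp only [trigPoly, Finset.mul_sum, char_gridPoint _ x]
    rw [Finset.sum_comm]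
    refine Finset.sum_congr rfl fun m _ => Finset.sum_congr rfl fun τ _ => ?_
    simp only [hy]; ring
  -- The order-r term separates into moments of the weights, rescaled by M^r, and trigonometric
  -- polynomials at `x` that do not involve the weights.
  have hTμ : ∀ r, T r = (2 * Real.pi * Complex.I) ^ r / r.factorial *
      ∑ i : Fin r → Fin d, ((μ r i * M ^ r : ℝ) : ℂ) * taylorPart F c M i x := by
    intro r
    have h1 : ∀ m, ∑ τ, (w τ : ℂ) * ((2 * Real.pi * Complex.I * (y m τ : ℂ)) ^ r / r.factorial) =
        (2 * Real.pi * Complex.I) ^ r / r.factorial *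
          ((∑ i : Fin r → Fin d, (∏ l, (m (i l) : ℝ)) * μ r i : ℝ) : ℂ) := by
      intro m
      rw [← sum_mul_pow_eq w x m r, Complex.ofReal_sum, Finset.mul_sum]
      refine Finset.sum_congr rfl fun τ _ => ?_
      simp only [hy]
      rw [mul_pow]; push_cast; ring
    have h2 : T r = ∑ m ∈ F, c m * char m x * ((2 * Real.pi * Complex.I) ^ r / r.factorial *
        ((∑ i : Fin r → Fin d, (∏ l, (m (i l) : ℝ)) * μ r i : ℝ) : ℂ)) :=
      Finset.sum_congr rfl fun m _ => by rw [h1 m]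
    rw [h2]
    simp only [taylorPart, trigPoly, Finset.mul_sum, Complex.ofReal_sum]
    rw [Finset.sum_comm]
    refine Finset.sum_congr rfl fun i _ => Finset.sum_congr rfl fun m _ => ?_
    rw [Finset.prod_div_distrib, Finset.prod_const, Finset.card_univ, Fintype.card_fin]
    have : (M : ℂ) ≠ 0 := by exact_mod_cast hM0.ne'
    push_cast
    field_simp
  have hT0 : T 0 = trigPoly F c x := by
    simp only [hT, pow_zero, Nat.factorial_zero, Nat.cast_one, div_one, mul_one, trigPoly]
    refine Finset.sum_congr rfl fun m _ => ?_
    have : ∑ τ, (w τ : ℂ) = 1 := by exact_mod_cast hw.sum_eq_one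
    rw [this, mul_one]
  have hTk : ∀ r, 1 ≤ r → r ≤ k → T r = 0 := by
    intro r h1 h2
    rw [hTμ, Finset.sum_eq_zero, mul_zero]
    intro i _
    simp only [hμ]
    rw [hw.sum_moment r h1 h2 i]; simp
  -- Order 0 reproduces the value at `x` and the orders 1 to k vanish by the moment conditions.
  have herr : HasSum (fun r => if r ≤ k then 0 else T r)
      (∑ τ, (w τ : ℂ) * trigPoly F c (gridPoint τ) - trigPoly F c x) := by
    have h1 := hsumT.sub (hasSum_ite_eq (0 : ℕ) (trigPoly F c x))
    convert! h1 using 1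
    ext r
    rcases Nat.eq_zero_or_pos r with h | h
    · subst h; simp [hT0]
    · rw [if_neg h.ne', sub_zero]
      split_ifs with hr
      · exact (hTk r h hr).symm
      · rfl
  -- The weights are supported within distance 1/M of `x`, so an r-th moment is at most C M^{-r}.
  have hμle : ∀ r (i : Fin r → Fin d), |μ r i * M ^ r| ≤ C := by
    intro r i
    rw [abs_mul, abs_of_pos (pow_pos hM0 r)]
    calc |μ r i| * (M : ℝ) ^ r ≤ (C * (1 / M) ^ r) * (M : ℝ) ^ r := by
          refine mul_le_mul_of_nonneg_right ?_ (by positivity)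
          refine (Finset.abs_sum_le_sum_abs _ _).trans (le_trans ?_
            (mul_le_mul_of_nonneg_right hw.sum_abs_le (by positivity)))
          rw [Finset.sum_mul]
          refine Finset.sum_le_sum fun τ _ => ?_
          rw [abs_mul]
          by_cases hτ : w τ = 0
          · simp [hτ]
          refine mul_le_mul_of_nonneg_left ?_ (abs_nonneg _)
          rw [Finset.abs_prod]
          calc ∏ l, |(gridPoint τ - x) (i l)| ≤ ∏ _l : Fin r, (1 / M : ℝ) :=
                Finset.prod_le_prod (fun _ _ => abs_nonneg _) fun l _ =>
                  (norm_le_pi_norm (gridPoint τ - x) (i l)).trans (hw.near τ hτ)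
            _ = _ := by simp
      _ = C := by rw [one_div, inv_pow, mul_assoc, inv_mul_cancel₀ (pow_pos hM0 r).ne', mul_one]
  rw [← herr.tsum_eq]
  have h1 := (hasSum_real_exp_div (2 * Real.pi * d)).mul_left (C ^ 2)
  rw [← h1.tsum_eq]
  -- Cauchy–Schwarz over the orders r, with weights C² (2πd)^r / r!.
  refine norm_tsum_sq_le (fun r => by positivity) (fun r => lowSq_term_nonneg r x) h1.summable
    (summable_lowSq hF hM x) fun r => ?_
  split_ifs with hr
  · simp
  · have h2 : ‖T r‖ ≤ (2 * Real.pi) ^ r / r.factorial *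
        (C * ∑ i : Fin r → Fin d, ‖taylorPart F c M i x‖) := by
      rw [hTμ, norm_mul]
      refine mul_le_mul (le_of_eq ?_) ?_ (norm_nonneg _) (by positivity)
      · simp [abs_of_pos Real.pi_pos]
      · rw [Finset.mul_sum]
        refine (norm_sum_le _ _).trans (Finset.sum_le_sum fun i _ => ?_)
        rw [norm_mul, Complex.norm_real, Real.norm_eq_abs]
        exact mul_le_mul_of_nonneg_right (hμle r i) (norm_nonneg _)
    have h3 := sq_sum_le_card_mul_sum_sq (s := (Finset.univ : Finset (Fin r → Fin d)))
      (f := fun i => ‖taylorPart F c M i x‖)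
    simp only [Finset.card_univ, Fintype.card_fun, Fintype.card_fin, Nat.cast_pow] at h3
    calc ‖T r‖ ^ 2 ≤ ((2 * Real.pi) ^ r / r.factorial *
          (C * ∑ i : Fin r → Fin d, ‖taylorPart F c M i x‖)) ^ 2 :=
          pow_le_pow_left₀ (norm_nonneg _) h2 2
      _ = ((2 * Real.pi) ^ r / r.factorial) ^ 2 * C ^ 2 *
          (∑ i : Fin r → Fin d, ‖taylorPart F c M i x‖) ^ 2 := by ring
      _ ≤ ((2 * Real.pi) ^ r / r.factorial) ^ 2 * C ^ 2 *
          ((d : ℝ) ^ r * ∑ i : Fin r → Fin d, ‖taylorPart F c M i x‖ ^ 2) :=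
          mul_le_mul_of_nonneg_left h3 (by positivity)
      _ = _ := by rw [mul_pow _ (d : ℝ)]; ring

end LowFrequency

end MIND
namespace MIND

/-! ### Mean square error of quasi-interpolation at one scale -/

section MeanSquareError

variable {d : ℕ}

lemma fc_sub {u v : (Fin d → ℝ) → ℂ} (hu : Continuous u) (hv : Continuous v) (m : Fin d → ℤ) :
    fc (fun x => u x - v x) m = fc u m - fc v m := by
  unfold fc
  have h1 : Integrable (fun x => char (-m) x * u x) (cellMeasure d) :=
    integrable_cell ((continuous_char _).mul hu)
  have h2 : Integrable (fun x => char (-m) x * v x) (cellMeasure d) :=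
    integrable_cell ((continuous_char _).mul hv)
  rw [← integral_sub h1 h2]
  simp only [mul_sub]

/-- The damping factor of quasi-interpolation at scale `1 / M`. -/
noncomputable def damping (k M : ℕ) (m : Fin d → ℤ) : ℝ :=
  if ‖m‖ ≤ M then (‖m‖ / M) ^ (2 * k + 2) else 1

lemma damping_nonneg (k M : ℕ) (m : Fin d → ℤ) : 0 ≤ damping k M m := by
  unfold damping; split_ifs <;> positivity

lemma damping_le_one (k M : ℕ) (m : Fin d → ℤ) : damping k M m ≤ 1 := by
  unfold damping
  split_ifs with h
  · exact pow_le_one₀ (by positivity) (div_le_one_of_le₀ h (Nat.cast_nonneg _))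
  · exact le_rfl

lemma summable_damping {k M : ℕ} {g : (Fin d → ℝ) → ℝ} (hg : MemHk0 k g) :
    Summable fun m => damping k M m * ‖fcoef g m‖ ^ 2 :=
  Summable.of_nonneg_of_le (fun m => mul_nonneg (damping_nonneg k M m) (sq_nonneg _))
    (fun m => mul_le_of_le_one_left (sq_nonneg _) (damping_le_one k M m))
    (hasSum_sq_fcoef (hg.memLp 2)).summable

lemma freqWeight_le {k N : ℕ} (hN : 1 ≤ N) (m : Fin d → ℤ) :
    freqWeight k N m ≤ 4 ^ k * (1 + ‖m‖ ^ (2 * k) / (N : ℝ) ^ (2 * k)) := by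
  have h := add_pow_le (zero_le_one (α := ℝ)) (show 0 ≤ ‖m‖ / N by positivity) (2 * k)
  rw [one_pow, div_pow] at h
  refine h.trans (mul_le_mul_of_nonneg_right ?_ (by positivity))
  rw [show (4 : ℝ) ^ k = 2 ^ (2 * k) by rw [pow_mul]; norm_num]
  exact pow_le_pow_right₀ one_le_two (Nat.sub_le _ _)

/-- Cauchy–Schwarz, then `abs_le` and `near`: the majorant involves balls around the grid points and
no longer the weights, so it can be integrated over `x` although the weights are chosen point by
point. -/
lemma IsQuasiInterp.norm_sum_sq_le {N : ℕ} {𝓑 : Set (Cube d)} {k M : ℕ} {C : ℝ} {x : Fin d → ℝ}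
    {w : (Fin d → Fin N) → ℝ} (hw : IsQuasiInterp 𝓑 k M C x w) (v : (Fin d → Fin N) → ℂ) :
    ‖∑ τ, (w τ : ℂ) * v τ‖ ^ 2 ≤ C ^ 2 * (((M : ℝ) / N) ^ d *
      ∑ τ, (Metric.closedBall (gridPoint τ) (1 / M)).indicator (fun _ => ‖v τ‖ ^ 2) x) := by
  have hC := hw.nonneg
  have h1 : ‖∑ τ, (w τ : ℂ) * v τ‖ ≤ ∑ τ, |w τ| * ‖v τ‖ :=
    (norm_sum_le _ _).trans (le_of_eq (Finset.sum_congr rfl fun τ _ => by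
      rw [norm_mul, Complex.norm_real, Real.norm_eq_abs]))
  have h2 : (∑ τ, |w τ| * ‖v τ‖) ^ 2 ≤ (∑ τ, |w τ|) * ∑ τ, |w τ| * ‖v τ‖ ^ 2 :=
    Finset.sum_sq_le_sum_mul_sum_of_sq_le_mul _ (fun τ _ => abs_nonneg _)
      (fun τ _ => by positivity) (fun τ _ => le_of_eq (by ring))
  have h3 : ∑ τ, |w τ| * ‖v τ‖ ^ 2 ≤ C * (((M : ℝ) / N) ^ d *
      ∑ τ, (Metric.closedBall (gridPoint τ) (1 / M)).indicator (fun _ => ‖v τ‖ ^ 2) x) := by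
    rw [← mul_assoc, Finset.mul_sum]
    refine Finset.sum_le_sum fun τ _ => ?_
    by_cases hτ : w τ = 0
    · rw [hτ, abs_zero, zero_mul]
      exact mul_nonneg (by positivity) (Set.indicator_nonneg (fun _ _ => sq_nonneg _) _)
    · rw [Set.indicator_of_mem]
      · exact mul_le_mul_of_nonneg_right (hw.abs_le τ) (sq_nonneg _)
      · rw [Metric.mem_closedBall, dist_comm, dist_eq_norm]
        exact hw.near τ hτ
  calc ‖∑ τ, (w τ : ℂ) * v τ‖ ^ 2 ≤ (∑ τ, |w τ| * ‖v τ‖) ^ 2 :=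
        pow_le_pow_left₀ (norm_nonneg _) h1 2
    _ ≤ C * (C * (((M : ℝ) / N) ^ d * ∑ τ, (Metric.closedBall (gridPoint τ) (1 / M)).indicator
          (fun _ => ‖v τ‖ ^ 2) x)) :=
        h2.trans (mul_le_mul hw.sum_abs_le h3
          (Finset.sum_nonneg fun τ _ => by positivity) hC)
    _ = _ := by ring

lemma integral_indicator_closedBall_le (y : Fin d → ℝ) {r c : ℝ} (hr : 0 ≤ r) (hc : 0 ≤ c) :
    Integrable ((Metric.closedBall y r).indicator fun _ => c) (cellMeasure d) ∧
    ∫ x, (Metric.closedBall y r).indicator (fun _ => c) x ∂(cellMeasure d) ≤ (2 * r) ^ d * c := by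
  refine ⟨(integrable_const c).indicator Metric.isClosed_closedBall.measurableSet, ?_⟩
  rw [integral_indicator_const _ Metric.isClosed_closedBall.measurableSet, smul_eq_mul]
  refine mul_le_mul_of_nonneg_right ?_ hc
  rw [Measure.real, cellMeasure]
  refine ENNReal.toReal_le_of_le_ofReal (by positivity) ?_
  refine (Measure.restrict_apply_le _ _).trans (le_of_eq ?_)
  rw [Real.volume_pi_closedBall _ hr, Fintype.card_fin]

/-- The mean square error of quasi-interpolation. -/
theorem exists_meanSquare_error {𝓑 : Set (Cube d)} {k : ℕ} (hk : d < 2 * k) {C : ℝ} :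
    ∃ C' : ℝ, 0 ≤ C' ∧ ∀ M N : ℕ, 1 ≤ M → 1 ≤ N → ∀ g, MemHk0 k g →
      ∃ E : (Fin d → ℝ) → ℝ, Integrable E (cellMeasure d) ∧ (∀ x, 0 ≤ E x) ∧
        (∀ x ∈ Set.Icc (0 : Fin d → ℝ) 1, ∀ w : (Fin d → Fin N) → ℝ, IsQuasiInterp 𝓑 k M C x w →
          (g x - ∑ τ, w τ * g (gridPoint τ)) ^ 2 ≤ E x) ∧
        ∫ x, E x ∂(cellMeasure d) ≤ C' * (∑' m, damping k M m * ‖fcoef g m‖ ^ 2 +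
          sobolevNorm k g ^ 2 / (N : ℝ) ^ (2 * k)) := by
  classical
  set e := Real.exp (2 * Real.pi * d) with he
  set Λ := 4 ^ k * latticeSum d k with hΛ
  have hΛ0 : 0 ≤ Λ := mul_nonneg (by positivity) (latticeSum_nonneg d k)
  refine ⟨3 * (C ^ 2 * e * e + 1 + C ^ 2 * (2 ^ d * Λ * 4 ^ k)), by positivity, ?_⟩
  intro M N hM hN g hg
  have hM0 : (0 : ℝ) < M := by exact_mod_cast hM
  have hN0 : (0 : ℝ) < N := by exact_mod_cast hN
  have : NeZero N := ⟨by omega⟩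
  set c := fcoef g with hc
  have hfin : {m : Fin d → ℤ | ‖m‖ ≤ M}.Finite := by
    have h := (isCompact_closedBall (0 : Fin d → ℤ) (M : ℝ)).finite_of_discrete
    refine h.subset fun m hm => ?_
    simpa using hm
  set F := hfin.toFinset with hF
  have hFle : ∀ m ∈ F, ‖m‖ ≤ M := fun m hm => by simpa [hF] using hm
  have hFmem : ∀ m, m ∈ F ↔ ‖m‖ ≤ M := fun m => by simp [hF]
  -- The function is split at frequency `M`: the low part is handled by Taylor expansion, while for
  -- the high part `v` both its value and its weighted samples are bounded.
  set c' : (Fin d → ℤ) → ℂ := fun m => if m ∈ F then 0 else c m with hc'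
  have hgc : Continuous fun x => (g x : ℂ) := Complex.continuous_ofReal.comp hg.continuous
  set v : (Fin d → ℝ) → ℂ := fun x => (g x : ℂ) - trigPoly F c x with hv
  have hvc : Continuous v := hgc.sub (continuous_trigPoly F c)
  have hfcv : ∀ m, fc v m = c' m := fun m => by
    rw [hv, fc_sub hgc (continuous_trigPoly F c), fc_trigPoly]
    change c m - _ = _
    simp only [hc']
    split_ifs <;> simp
  have hv2 := hasSum_sq_fc (memLp_cell hvc 2)
  simp only [hfcv] at hv2
  have hvsum : ∀ x ∈ Set.Icc (0 : Fin d → ℝ) 1, HasSum (fun m => c' m * char m x) (v x) := by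
    intro x hx
    have h1 : HasSum (fun m => if m ∈ F then c m * char m x else 0) (trigPoly F c x) := by
      have h2 : HasSum (fun m => if m ∈ F then c m * char m x else 0)
          (∑ m ∈ F, if m ∈ F then c m * char m x else 0) :=
        hasSum_sum_of_ne_finset_zero fun m hm => if_neg hm
      convert! h2 using 1
      exact Finset.sum_congr rfl fun m hm => (if_pos hm).symm
    have h3 := (hg.hasSum_char hk hx).sub h1
    convert! h3 using 1
    ext m
    simp only [hc', hc]
    split_ifs <;> simp
  -- comparison of the coefficient sums
  obtain ⟨hD, hDle⟩ := hg.summable_pow_norm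
  have hdamp := summable_damping (M := M) hg
  have hc'damp : ∀ m, ‖c' m‖ ^ 2 ≤ damping k M m * ‖c m‖ ^ 2 := fun m => by
    simp only [hc', damping, hFmem]
    split_ifs
    · have : (0 : ℝ) ≤ (‖m‖ / M) ^ (2 * k + 2) * ‖c m‖ ^ 2 := by positivity
      simpa using this
    · simp
  -- Frequencies below `N` are charged to the damped sum and those above to the term with N^{-2k}.
  have hWle : ∀ m, freqWeight k N m * ‖c' m‖ ^ 2 ≤ 4 ^ k * (damping k M m * ‖c m‖ ^ 2 +
      ‖m‖ ^ (2 * k) * ‖c m‖ ^ 2 / (N : ℝ) ^ (2 * k)) := fun m => by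
    have h1 : ‖c' m‖ ^ 2 ≤ ‖c m‖ ^ 2 := (hc'damp m).trans
      (mul_le_of_le_one_left (sq_nonneg _) (damping_le_one k M m))
    calc freqWeight k N m * ‖c' m‖ ^ 2
        ≤ 4 ^ k * (1 + ‖m‖ ^ (2 * k) / (N : ℝ) ^ (2 * k)) * ‖c' m‖ ^ 2 :=
          mul_le_mul_of_nonneg_right (freqWeight_le hN m) (sq_nonneg _)
      _ = 4 ^ k * (‖c' m‖ ^ 2 + ‖m‖ ^ (2 * k) * ‖c' m‖ ^ 2 / (N : ℝ) ^ (2 * k)) := by ring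
      _ ≤ _ := by
          have := hc'damp m
          gcongr
  have hWs0 := (hdamp.add (hD.div_const ((N : ℝ) ^ (2 * k)))).mul_left ((4 : ℝ) ^ k)
  have hWs : Summable fun m => freqWeight k N m * ‖c' m‖ ^ 2 :=
    Summable.of_nonneg_of_le (fun m => mul_nonneg (freqWeight_pos _ _ _).le (sq_nonneg _)) hWle hWs0
  set S := ∑' m, damping k M m * ‖c m‖ ^ 2 with hS
  set D2 := sobolevNorm k g ^ 2 / (N : ℝ) ^ (2 * k) with hD2
  have hD20 : 0 ≤ D2 := by positivity
  have hS0 : 0 ≤ S := tsum_nonneg fun m => mul_nonneg (damping_nonneg k M m) (sq_nonneg _)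
  have hWtsum : ∑' m, freqWeight k N m * ‖c' m‖ ^ 2 ≤ 4 ^ k * (S + D2) := by
    refine (hWs.tsum_le_tsum hWle hWs0).trans ?_
    rw [tsum_mul_left, hdamp.tsum_add (hD.div_const _), tsum_div_const]
    exact mul_le_mul_of_nonneg_left (add_le_add le_rfl
      (div_le_div_of_nonneg_right hDle (by positivity))) (by positivity)
  have hvint : ∫ x, ‖v x‖ ^ 2 ∂(cellMeasure d) ≤ S := by
    rw [← hv2.tsum_eq]
    exact hv2.summable.tsum_le_tsum hc'damp hdamp
  have hlow : ∫ x, lowSq F c k M x ∂(cellMeasure d) ≤ e * S := by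
    refine (integral_lowSq_le hFle hM).trans (mul_le_mul_of_nonneg_left ?_ (Real.exp_pos _).le)
    refine le_trans (le_of_eq (Finset.sum_congr rfl fun m hm => ?_))
      (hdamp.sum_le_tsum F fun m _ => mul_nonneg (damping_nonneg k M m) (sq_nonneg _))
    rw [damping, if_pos (hFle m hm)]
  -- The volume (2/M)^d of a ball turns the factor (M/N)^d into 2^d N^{-d}, and the sampling
  -- inequality supplies the compensating N^d.
  set R : (Fin d → ℝ) → ℝ := fun x => ((M : ℝ) / N) ^ d * ∑ τ : Fin d → Fin N,
    (Metric.closedBall (gridPoint τ) (1 / M)).indicator (fun _ => ‖v (gridPoint τ)‖ ^ 2) x with hR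
  have hball := fun τ : Fin d → Fin N => integral_indicator_closedBall_le (gridPoint τ)
    (r := 1 / M) (c := ‖v (gridPoint τ)‖ ^ 2) (by positivity) (sq_nonneg _)
  have hRi : Integrable R (cellMeasure d) :=
    (integrable_finsetSum _ fun τ _ => (hball τ).1).const_mul _
  have hRle : ∫ x, R x ∂(cellMeasure d) ≤ 2 ^ d * Λ * 4 ^ k * (S + D2) := by
    rw [hR, integral_const_mul, integral_finsetSum _ fun τ _ => (hball τ).1]
    have h1 := sum_normSq_sample_le hk hWs
    have h2 : ∀ τ : Fin d → Fin N, ∑' m, c' m * char m (gridPoint τ) = v (gridPoint τ) :=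
      fun τ => (hvsum _ (gridPoint_mem τ)).tsum_eq
    simp only [h2] at h1
    calc _ ≤ ((M : ℝ) / N) ^ d * ∑ τ : Fin d → Fin N, (2 * (1 / M : ℝ)) ^ d * ‖v (gridPoint τ)‖ ^ 2 := by
          gcongr with τ
          exact (hball τ).2
      _ = 2 ^ d / (N : ℝ) ^ d * ∑ τ : Fin d → Fin N, ‖v (gridPoint τ)‖ ^ 2 := by
          rw [← Finset.mul_sum, ← mul_assoc, ← mul_pow]
          congr 1
          rw [← div_pow]; congr 1; field_simp
      _ ≤ 2 ^ d / (N : ℝ) ^ d * ((N : ℝ) ^ d * Λ * (4 ^ k * (S + D2))) := by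
          refine mul_le_mul_of_nonneg_left (h1.trans ?_) (by positivity)
          exact mul_le_mul_of_nonneg_left hWtsum (by positivity)
      _ = _ := by field_simp
  have hvi : Integrable (fun x => ‖v x‖ ^ 2) (cellMeasure d) := integrable_cell (hvc.norm.pow 2)
  have hli : Integrable (fun x => C ^ 2 * e * lowSq F c k M x) (cellMeasure d) :=
    (integrable_cell (continuous_lowSq hFle hM)).const_mul _
  have hRi' : Integrable (fun x => C ^ 2 * R x) (cellMeasure d) := hRi.const_mul _
  have hR0 : ∀ x, 0 ≤ R x := fun x => mul_nonneg (by positivity) (Finset.sum_nonneg fun τ _ =>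
    Set.indicator_nonneg (fun _ _ => sq_nonneg _) _)
  refine ⟨fun x => 3 * (C ^ 2 * e * lowSq F c k M x + ‖v x‖ ^ 2 + C ^ 2 * R x),
    ((hli.add hvi).add hRi').const_mul 3, fun x => ?_, fun x hx w hw => ?_, ?_⟩
  · have h1 := lowSq_nonneg (F := F) (c := c) (k := k) (M := M) x
    have h2 := hR0 x
    have h3 : 0 < e := Real.exp_pos _
    positivity
  · have h1 := hw.norm_trigPoly_sub_sq_le (c := c) hFle hM
    have h2 := hw.norm_sum_sq_le fun τ => v (gridPoint τ)
    -- The error consists of the high part at `x`, its weighted samples, and the quasi-interpolation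
    -- error of the low part.
    have h3 : ((g x - ∑ τ, w τ * g (gridPoint τ) : ℝ) : ℂ) = v x -
        ∑ τ, (w τ : ℂ) * v (gridPoint τ) -
        (∑ τ, (w τ : ℂ) * trigPoly F c (gridPoint τ) - trigPoly F c x) := by
      simp only [hv, mul_sub, Finset.sum_sub_distrib]
      push_cast; ring
    rw [← sq_abs, ← Real.norm_eq_abs, ← Complex.norm_real, h3]
    set a := v x
    set b := ∑ τ, (w τ : ℂ) * v (gridPoint τ)
    set u := ∑ τ, (w τ : ℂ) * trigPoly F c (gridPoint τ) - trigPoly F c x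
    have h4 : ‖a - b - u‖ ≤ ‖a‖ + ‖b‖ + ‖u‖ :=
      (norm_sub_le _ _).trans (add_le_add (norm_sub_le _ _) le_rfl)
    have h5 := pow_le_pow_left₀ (norm_nonneg _) h4 2
    have h6 : (‖a‖ + ‖b‖ + ‖u‖) ^ 2 ≤ 3 * (‖u‖ ^ 2 + ‖a‖ ^ 2 + ‖b‖ ^ 2) := by
      nlinarith [sq_nonneg (‖a‖ - ‖b‖), sq_nonneg (‖a‖ - ‖u‖), sq_nonneg (‖b‖ - ‖u‖)]
    refine h5.trans (h6.trans ?_)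
    have h7 : ‖b‖ ^ 2 ≤ C ^ 2 * R x := h2
    exact mul_le_mul_of_nonneg_left (add_le_add (add_le_add h1 le_rfl) h7) (by norm_num)
  · have hsplit : ∫ x, 3 * (C ^ 2 * e * lowSq F c k M x + ‖v x‖ ^ 2 + C ^ 2 * R x) ∂(cellMeasure d) =
        3 * (C ^ 2 * e * ∫ x, lowSq F c k M x ∂(cellMeasure d) + ∫ x, ‖v x‖ ^ 2 ∂(cellMeasure d) +
          C ^ 2 * ∫ x, R x ∂(cellMeasure d)) := by
      have hs := integral_add (hli.add hvi) hRi'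
      simp only [Pi.add_apply] at hs
      rw [integral_const_mul, hs, integral_add hli hvi, integral_const_mul, integral_const_mul]
    rw [hsplit]
    have he0 : 0 < e := Real.exp_pos _
    calc _ ≤ 3 * (C ^ 2 * e * (e * S) + S + C ^ 2 * (2 ^ d * Λ * 4 ^ k * (S + D2))) := by gcongr
      _ ≤ 3 * (C ^ 2 * e * (e * (S + D2)) + (S + D2) + C ^ 2 * (2 ^ d * Λ * 4 ^ k * (S + D2))) := by
          have : S ≤ S + D2 := by linarith
          gcongr
      _ = _ := by ring

/-! ### Summation over dyadic scales -/

/-- Geometric growth up to 4^j = a, geometric decay beyond, each contributing at most 4/3. The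
induction carries a bound for either regime; their ranges overlap so that the passage between them
is possible. -/
lemma sum_min_le {a : ℝ} (ha : 0 < a) (n : ℕ) :
    ∑ j ∈ Finset.range n, min ((4 : ℝ) ^ j / a) (a / 4 ^ j) ≤ 8 / 3 := by
  have key : (((4 : ℝ) ^ n / a ≤ 4 → ∑ j ∈ Finset.range n, min ((4 : ℝ) ^ j / a) (a / 4 ^ j) ≤
      (4 : ℝ) ^ n / a / 3)) ∧ (1 < (4 : ℝ) ^ n / a →
      ∑ j ∈ Finset.range n, min ((4 : ℝ) ^ j / a) (a / 4 ^ j) ≤ 8 / 3 - 4 / 3 * (a / 4 ^ n)) := by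
    induction n with
    | zero =>
      simp only [Finset.range_zero, Finset.sum_empty, pow_zero, div_one]
      refine ⟨fun _ => by positivity, fun h => ?_⟩
      rw [lt_div_iff₀ ha] at h
      linarith
    | succ n ih =>
      obtain ⟨ih1, ih2⟩ := ih
      rw [Finset.sum_range_succ]
      set S := ∑ j ∈ Finset.range n, min ((4 : ℝ) ^ j / a) (a / 4 ^ j)
      set u := (4 : ℝ) ^ n / a with hu
      have hu0 : 0 < u := by positivity
      have h1 : (4 : ℝ) ^ (n + 1) / a = 4 * u := by rw [hu, pow_succ]; ring
      have h2 : a / (4 : ℝ) ^ n = 1 / u := by rw [hu, one_div_div]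
      have h3 : a / (4 : ℝ) ^ (n + 1) = 1 / (4 * u) := by rw [← h1, one_div_div]
      rw [h2] at ih2 ⊢
      rw [h1, h3]
      refine ⟨fun h => ?_, fun h => ?_⟩
      · have := ih1 (by linarith)
        have := min_le_left u (1 / u)
        linarith
      · rw [show 1 / (4 * u) = 1 / u / 4 by field_simp]
        rcases lt_or_ge 1 u with h4 | h4
        · have := ih2 h4
          have := min_le_right u (1 / u)
          linarith
        · have h5 := ih1 (by linarith)
          have h6 := min_le_left u (1 / u)
          have h7 : 1 / u < 4 := by rw [div_lt_iff₀ hu0]; linarith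
          linarith
  rcases lt_or_ge 1 ((4 : ℝ) ^ n / a) with h | h
  · refine (key.2 h).trans ?_
    have : 0 < a / 4 ^ n := by positivity
    linarith
  · have := key.1 (by linarith)
    linarith

/-- Relative to ‖m‖^{2k}, the j-th term is exactly ‖m‖²/4^j for scales above ‖m‖ and at most
4^j/‖m‖² below, so `sum_min_le` applies. The decay above comes from the surplus 2 in the exponent 2k
+ 2. -/
lemma sum_damping_le {k : ℕ} (hk : 1 ≤ k) {m : Fin d → ℤ} (hm : m ≠ 0) (n : ℕ) :
    ∑ j ∈ Finset.range n, ((2 : ℝ) ^ j) ^ (2 * k) * damping k (2 ^ j) m ≤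
      8 / 3 * ‖m‖ ^ (2 * k) := by
  have hm0 : 0 < ‖m‖ := lt_of_lt_of_le one_pos (one_le_norm_of_ne_zero hm)
  have h := sum_min_le (a := ‖m‖ ^ 2) (by positivity) n
  refine le_trans ?_ (mul_le_mul_of_nonneg_right h (by positivity))
  rw [Finset.sum_mul]
  refine Finset.sum_le_sum fun j _ => ?_
  have h4 : (4 : ℝ) ^ j = ((2 : ℝ) ^ j) ^ 2 := by rw [← pow_mul, mul_comm, pow_mul]; norm_num
  rw [h4, damping]
  push_cast
  set s := (2 : ℝ) ^ j with hs
  have hs0 : 0 < s := by positivity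
  rw [← div_pow, ← div_pow]
  split_ifs with hle
  · have h1 : ‖m‖ / s ≤ 1 := (div_le_one hs0).2 hle
    have h2 : 1 ≤ s / ‖m‖ := (one_le_div hm0).2 hle
    have h3 : (‖m‖ / s) ^ 2 ≤ (s / ‖m‖) ^ 2 :=
      (pow_le_one₀ (by positivity) h1).trans (one_le_pow₀ h2)
    rw [min_eq_right h3, div_pow, div_pow, pow_add ‖m‖, pow_add s]
    apply le_of_eq
    field_simp
  · have hle' := (not_le.1 hle).le
    have h1 : s / ‖m‖ ≤ 1 := (div_le_one hm0).2 hle'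
    have h2 : 1 ≤ ‖m‖ / s := (one_le_div hs0).2 hle'
    have h3 : (s / ‖m‖) ^ 2 ≤ (‖m‖ / s) ^ 2 :=
      (pow_le_one₀ (by positivity) h1).trans (one_le_pow₀ h2)
    rw [min_eq_left h3, mul_one]
    have h5 : (s / ‖m‖) ^ (2 * k) ≤ (s / ‖m‖) ^ 2 :=
      pow_le_pow_of_le_one (by positivity) h1 (by omega)
    calc s ^ (2 * k) = (s / ‖m‖) ^ (2 * k) * ‖m‖ ^ (2 * k) := by
          rw [div_pow]; field_simp
      _ ≤ _ := mul_le_mul_of_nonneg_right h5 (by positivity)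

end MeanSquareError

end MIND
namespace MIND

/-! ### Supremum and critical L^p bounds from all dyadic scales -/

section Interpolation

variable {d : ℕ}

lemma sqrt_pow_rpow {s : ℝ} (hs : 0 ≤ s) (hd : 1 ≤ d) (k : ℕ) :
    √(s ^ d) ^ (4 * (k : ℝ) / d) = s ^ (2 * k) := by
  have hd0 : (d : ℝ) ≠ 0 := by positivity
  rw [Real.sqrt_eq_rpow, ← Real.rpow_natCast s d, ← Real.rpow_mul hs, ← Real.rpow_mul hs,
    ← Real.rpow_natCast s (2 * k)]
  congr 1
  push_cast
  field_simp
  norm_num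

/-- Either a number is small or it is comparable to some dyadic level, up to a bounded factor. -/
lemma exists_dyadic_level {t : ℝ} {J : ℕ} (l : ℕ → ℝ) (h0 : l 0 < t) :
    l J < t ∨ ∃ j < J, l j < t ∧ t ≤ l (j + 1) := by
  induction J with
  | zero => exact Or.inl h0
  | succ J ih =>
    rcases ih with h | ⟨j, hj, h⟩
    · rcases lt_or_ge (l (J + 1)) t with h' | h'
      · exact Or.inl h'
      · exact Or.inr ⟨J, by omega, h, h'⟩
    · exact Or.inr ⟨j, by omega, h⟩

/-- A large |y| lies between the bounds 2CA·2^{jd/2} and KA·2^{jd/2} for some level j. There `b` is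
at most half of |y|, so |y|² ≤ 4 E_j, while |y|^{4k/d} is at most (KA)^{4k/d} 2^{2kj}. Adding all
levels removes the dependence of j on y. -/
lemma abs_rpow_le_dyadic {k J : ℕ} (hd : 1 ≤ d) {y A C K : ℝ} (hA : 0 < A) (hC : 0 < C)
    (E : ℕ → ℝ) (hE : ∀ j, 0 ≤ E j)
    (h : ∀ j ≤ J, ∃ b, |b| ≤ C * A * √(((2 : ℝ) ^ j) ^ d) ∧ (y - b) ^ 2 ≤ E j)
    (hK : 2 * C * √(2 ^ d) ≤ K) (hy : |y| ≤ K * A * √(((2 : ℝ) ^ J) ^ d)) :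
    |y| ^ (2 + 4 * (k : ℝ) / d) ≤ (2 * C * A) ^ (2 + 4 * (k : ℝ) / d) +
      4 * (K * A) ^ (4 * (k : ℝ) / d) *
        ∑ j ∈ Finset.range (J + 1), ((2 : ℝ) ^ j) ^ (2 * k) * E j := by
  have hK0 : 0 < K := lt_of_lt_of_le (by positivity) hK
  have hsum : 0 ≤ ∑ j ∈ Finset.range (J + 1), ((2 : ℝ) ^ j) ^ (2 * k) * E j :=
    Finset.sum_nonneg fun j _ => mul_nonneg (by positivity) (hE j)
  rcases le_or_gt |y| (2 * C * A) with hle | hgt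
  · exact (Real.rpow_le_rpow (abs_nonneg _) hle (by positivity)).trans
      (le_add_of_nonneg_right (by positivity))
  have hlev : ∃ j ≤ J, 2 * C * A * √(((2 : ℝ) ^ j) ^ d) < |y| ∧
      |y| ≤ K * A * √(((2 : ℝ) ^ j) ^ d) := by
    rcases exists_dyadic_level (J := J) (fun j => 2 * C * A * √(((2 : ℝ) ^ j) ^ d))
      (by simpa using hgt) with h1 | ⟨j, hj, h1, h2⟩
    · exact ⟨J, le_rfl, h1, hy⟩
    · refine ⟨j, hj.le, h1, h2.trans ?_⟩
      simp only [pow_succ (2 : ℝ) j]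
      rw [mul_pow, Real.sqrt_mul (by positivity)]
      calc 2 * C * A * (√(((2 : ℝ) ^ j) ^ d) * √(2 ^ d))
          = (2 * C * √(2 ^ d)) * (A * √(((2 : ℝ) ^ j) ^ d)) := by ring
        _ ≤ K * (A * √(((2 : ℝ) ^ j) ^ d)) := by gcongr
        _ = _ := by ring
  obtain ⟨j, hj, h1, h2⟩ := hlev
  obtain ⟨b, hb, hyb⟩ := h j hj
  have h3 : |y| ^ 2 ≤ 4 * E j := by
    have h4 : |y| ≤ 2 * |y - b| := by
      have := abs_sub_abs_le_abs_sub y b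
      linarith
    have h5 := pow_le_pow_left₀ (abs_nonneg _) h4 2
    rw [mul_pow, sq_abs (y - b)] at h5
    linarith
  have hypos : 0 < |y| := lt_of_le_of_lt (by positivity) hgt
  calc |y| ^ (2 + 4 * (k : ℝ) / d) = |y| ^ (4 * (k : ℝ) / d) * |y| ^ 2 := by
        rw [Real.rpow_add hypos, Real.rpow_two, mul_comm]
    _ ≤ (K * A * √(((2 : ℝ) ^ j) ^ d)) ^ (4 * (k : ℝ) / d) * (4 * E j) :=
        mul_le_mul (Real.rpow_le_rpow hypos.le h2 (by positivity)) h3 (by positivity)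
          (by positivity)
    _ = 4 * (K * A) ^ (4 * (k : ℝ) / d) * (((2 : ℝ) ^ j) ^ (2 * k) * E j) := by
        rw [Real.mul_rpow (by positivity) (by positivity), sqrt_pow_rpow (by positivity) hd]
        ring
    _ ≤ 4 * (K * A) ^ (4 * (k : ℝ) / d) *
        ∑ j ∈ Finset.range (J + 1), ((2 : ℝ) ^ j) ^ (2 * k) * E j := by
        refine mul_le_mul_of_nonneg_left ?_ (by positivity)
        exact Finset.single_le_sum (f := fun j => ((2 : ℝ) ^ j) ^ (2 * k) * E j)
          (fun j _ => mul_nonneg (by positivity) (hE j)) (Finset.mem_range.2 (by omega))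
    _ ≤ _ := le_add_of_nonneg_left (by positivity)

lemma sum_two_pow_le {k : ℕ} (hk : 1 ≤ k) (J : ℕ) :
    ∑ j ∈ Finset.range (J + 1), ((2 : ℝ) ^ j) ^ (2 * k) ≤ 2 * ((2 : ℝ) ^ J) ^ (2 * k) := by
  induction J with
  | zero => simp
  | succ J ih =>
    rw [Finset.sum_range_succ]
    have h1 : ((2 : ℝ) ^ (J + 1)) ^ (2 * k) = 4 ^ k * ((2 : ℝ) ^ J) ^ (2 * k) := by
      rw [pow_succ, mul_pow, pow_mul 2 2 k]; norm_num; ring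
    have h2 : (4 : ℝ) ^ 1 ≤ 4 ^ k := pow_le_pow_right₀ (by norm_num) hk
    have h3 : 0 < ((2 : ℝ) ^ J) ^ (2 * k) := by positivity
    rw [h1]
    nlinarith

/-- The mean square errors of all scales together cost a single Sobolev norm, without a logarithmic
factor. -/
lemma MemHk0.sum_damping_le {k : ℕ} (hk : 1 ≤ k) {g : (Fin d → ℝ) → ℝ} (hg : MemHk0 k g) (n : ℕ) :
    ∑ j ∈ Finset.range n, ((2 : ℝ) ^ j) ^ (2 * k) *
      ∑' m, damping k (2 ^ j) m * ‖fcoef g m‖ ^ 2 ≤ 8 / 3 * sobolevNorm k g ^ 2 := by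
  obtain ⟨hs, hle⟩ := hg.summable_pow_norm
  have h1 : ∀ j ∈ Finset.range n, Summable fun m =>
      ((2 : ℝ) ^ j) ^ (2 * k) * (damping k (2 ^ j) m * ‖fcoef g m‖ ^ 2) := fun j _ =>
    (summable_damping hg).mul_left _
  simp only [← tsum_mul_left]
  rw [← Summable.tsum_finsetSum h1]
  calc _ ≤ ∑' m, 8 / 3 * (‖m‖ ^ (2 * k) * ‖fcoef g m‖ ^ 2) := by
        refine Summable.tsum_le_tsum (fun m => ?_) (summable_sum h1) (hs.mul_left _)
        by_cases hm : m = 0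
        · subst hm
          simp [hg.fcoef_zero]
        · simp only [← mul_assoc]
          rw [← Finset.sum_mul]
          exact mul_le_mul_of_nonneg_right (MIND.sum_damping_le hk hm n) (sq_nonneg _)
    _ ≤ _ := by
        rw [tsum_mul_left]
        exact mul_le_mul_of_nonneg_left hle (by norm_num)

/-- Bounds in the supremum norm and in `L^{2+4k/d}` for functions with small multiresolution norm
on the grid and bounded Sobolev norm. -/
theorem exists_sup_integral_bound (hd : 1 ≤ d) {k : ℕ} (hk : d < 2 * k) {𝓑 : Set (Cube d)}
    (h𝓑 : IsNormal 𝓑) :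
    ∃ K c₀ : ℝ, 0 < K ∧ 0 < c₀ ∧ ∀ N : ℕ, 1 ≤ N → ∀ g : (Fin d → ℝ) → ℝ, MemHk0 k g →
      ∀ A Δ : ℝ, 0 < A → A ≤ Δ → Δ ≤ A * (c₀ * N) ^ k →
        mrNorm 𝓑 (sample N g) ≤ A * √((N : ℝ) ^ d) → sobolevNorm k g ≤ Δ →
        (∀ x ∈ Set.Icc (0 : Fin d → ℝ) 1, |g x| ≤ K * (A * (Δ / A) ^ ((d : ℝ) / (2 * k)))) ∧
        ∫ x, |g x| ^ (2 + 4 * (k : ℝ) / d) ∂(cellMeasure d) ≤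
          K * (A ^ (2 + 4 * (k : ℝ) / d) * (Δ / A) ^ 2) := by
  obtain ⟨C, c₀, hC, hc₀, hq⟩ := exists_isQuasiInterp hd k h𝓑
  obtain ⟨C₁, hC₁, hsup⟩ := exists_abs_sub_le (𝓑 := 𝓑) hk hC.le
  obtain ⟨C₂, hC₂, hms⟩ := exists_meanSquare_error (𝓑 := 𝓑) (k := k) hk (C := C)
  have hk1 : 1 ≤ k := by omega
  -- The first two summands bound the weighted samples and the error at the finest level; the third
  -- is required by `abs_rpow_le_dyadic`.
  set K₁ := C + √C₁ * 2 ^ k + 2 * C * √(2 ^ d) with hK₁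
  have hK₁0 : 0 < K₁ := by positivity
  set p := 2 + 4 * (k : ℝ) / d with hp
  set K₂ := (2 * C) ^ p + 4 * K₁ ^ (4 * (k : ℝ) / d) * (C₂ * (8 / 3 + 2 * c₀ ^ (2 * k))) with hK₂
  have hK₂0 : 0 < K₂ := by positivity
  refine ⟨K₁ + K₂, c₀, by positivity, hc₀, ?_⟩
  intro N hN g hg A Δ hA hAΔ hΔ hmr hsob
  have hN0 : (0 : ℝ) < N := by exact_mod_cast hN
  have hR1 : 1 ≤ Δ / A := (one_le_div hA).2 hAΔ
  have hΔ0 : 0 < Δ := hA.trans_le hAΔ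
  -- The finest level balances A·2^{Jd/2} against Δ·2^{J(d/2-k)}, so 2^{Jk} is about Δ/A.
  obtain ⟨J, hJ1, hJ2⟩ := exists_nat_pow_near hR1
    (one_lt_pow₀ (one_lt_two (α := ℝ)) (by omega : k ≠ 0))
  have hJk : ((2 : ℝ) ^ J) ^ k ≤ Δ / A := by rw [← pow_mul, mul_comm, pow_mul]; exact hJ1
  have hJk' : Δ ≤ A * (2 ^ k * ((2 : ℝ) ^ J) ^ k) := by
    rw [div_lt_iff₀ hA, pow_succ] at hJ2
    rw [← pow_mul 2 J k, mul_comm J k, pow_mul]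
    linarith
  -- The upper bound on Δ keeps the scale coarse enough for the cubes to contain grid points.
  have hJN : (2 : ℝ) ^ J ≤ c₀ * N := by
    refine le_of_pow_le_pow_left₀ (by omega : k ≠ 0) (by positivity) (hJk.trans ?_)
    rw [div_le_iff₀ hA]; linarith
  have hjN : ∀ j ≤ J, (((2 ^ j : ℕ)) : ℝ) ≤ c₀ * N := fun j hj => by
    push_cast
    exact (pow_le_pow_right₀ one_le_two hj).trans hJN
  have hone : ∀ j, 1 ≤ 2 ^ j := fun j => Nat.one_le_two_pow
  have hwsum : ∀ j x (w : (Fin d → Fin N) → ℝ), IsQuasiInterp 𝓑 k (2 ^ j) C x w →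
      |∑ τ, w τ * g (gridPoint τ)| ≤ C * A * √(((2 : ℝ) ^ j) ^ d) := by
    intro j x w hw
    refine (hw.abs_sum_le (sample N g)).trans ?_
    push_cast
    calc _ ≤ C * √(((2 : ℝ) ^ j / N) ^ d) * (A * √((N : ℝ) ^ d)) := by gcongr
      _ = C * A * (√(((2 : ℝ) ^ j / N) ^ d) * √((N : ℝ) ^ d)) := by ring
      _ = _ := by
        rw [← Real.sqrt_mul (by positivity), ← mul_pow, div_mul_cancel₀ _ hN0.ne']
  have hsupb : ∀ x ∈ Set.Icc (0 : Fin d → ℝ) 1, |g x| ≤ K₁ * A * √(((2 : ℝ) ^ J) ^ d) := by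
    intro x hx
    obtain ⟨w, hw⟩ := hq _ N (hone J) (hjN J le_rfl) x hx
    have h1 := hwsum J x w hw
    have h2 := hsup N _ (hone J) x hx w hw g hg
    push_cast at h2
    have h3 : (g x - ∑ τ, w τ * g (gridPoint τ)) ^ 2 ≤
        (√C₁ * 2 ^ k * A * √(((2 : ℝ) ^ J) ^ d)) ^ 2 := by
      have h4 : sobolevNorm k g ^ 2 ≤ (A * (2 ^ k * ((2 : ℝ) ^ J) ^ k)) ^ 2 :=
        pow_le_pow_left₀ (sobolevNorm_nonneg _ _) (hsob.trans hJk') 2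
      refine h2.trans ((mul_le_mul_of_nonneg_left h4 (by positivity)).trans (le_of_eq ?_))
      rw [mul_pow (√C₁ * 2 ^ k * A), mul_pow (√C₁ * 2 ^ k), mul_pow √C₁, Real.sq_sqrt hC₁,
        Real.sq_sqrt (by positivity)]
      field_simp
      ring
    have h5 := abs_le_of_sq_le_sq h3 (by positivity)
    have h6 : |g x| ≤ |g x - ∑ τ, w τ * g (gridPoint τ)| + |∑ τ, w τ * g (gridPoint τ)| := by
      have := abs_add_le (g x - ∑ τ, w τ * g (gridPoint τ)) (∑ τ, w τ * g (gridPoint τ))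
      rwa [sub_add_cancel] at this
    have h8 : 0 ≤ 2 * C * √(2 ^ d) * A * √(((2 : ℝ) ^ J) ^ d) := by positivity
    rw [hK₁]
    nlinarith
  -- These majorants do not depend on the weights, so no measurable choice of weights in `x` is
  -- needed.
  choose E hEi hE0 hEle hEint using fun j => hms (2 ^ j) N (hone j) hN g hg
  constructor
  · intro x hx
    have h1 : √(((2 : ℝ) ^ J) ^ d) ≤ (Δ / A) ^ ((d : ℝ) / (2 * k)) := by
      have hk0 : (0 : ℝ) < k := by positivity
      calc √(((2 : ℝ) ^ J) ^ d) = (((2 : ℝ) ^ J) ^ k) ^ ((d : ℝ) / (2 * k)) := by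
            rw [Real.sqrt_eq_rpow, ← Real.rpow_natCast _ d, ← Real.rpow_natCast _ k,
              ← Real.rpow_mul (by positivity), ← Real.rpow_mul (by positivity)]
            congr 1
            field_simp
        _ ≤ _ := Real.rpow_le_rpow (by positivity) hJk (by positivity)
    calc |g x| ≤ K₁ * A * √(((2 : ℝ) ^ J) ^ d) := hsupb x hx
      _ ≤ K₁ * A * (Δ / A) ^ ((d : ℝ) / (2 * k)) := by gcongr
      _ ≤ (K₁ + K₂) * A * (Δ / A) ^ ((d : ℝ) / (2 * k)) := by gcongr; linarith
      _ = _ := by ring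
  · have hsumi : Integrable (fun x => ∑ j ∈ Finset.range (J + 1), ((2 : ℝ) ^ j) ^ (2 * k) * E j x)
        (cellMeasure d) := integrable_finsetSum _ fun j _ => (hEi j).const_mul _
    have hpt : ∀ x ∈ Set.Icc (0 : Fin d → ℝ) 1, |g x| ^ p ≤ (2 * C * A) ^ p +
        4 * (K₁ * A) ^ (4 * (k : ℝ) / d) *
          ∑ j ∈ Finset.range (J + 1), ((2 : ℝ) ^ j) ^ (2 * k) * E j x := by
      intro x hx
      refine abs_rpow_le_dyadic hd hA hC (fun j => E j x) (fun j => hE0 j x) (fun j hj => ?_)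
        ?_ (hsupb x hx)
      · obtain ⟨w, hw⟩ := hq _ N (hone j) (hjN j hj) x hx
        exact ⟨_, hwsum j x w hw, hEle j x hx w hw⟩
      · have : 0 ≤ C + √C₁ * 2 ^ k := by positivity
        rw [hK₁]; linarith
    have hp0 : 0 ≤ p := by positivity
    have hgi : Integrable (fun x => |g x| ^ p) (cellMeasure d) :=
      integrable_cell (hg.continuous.abs.rpow_const fun x => Or.inr hp0)
    have hint : ∫ x, |g x| ^ p ∂(cellMeasure d) ≤ (2 * C * A) ^ p +
        4 * (K₁ * A) ^ (4 * (k : ℝ) / d) *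
          ∑ j ∈ Finset.range (J + 1), ((2 : ℝ) ^ j) ^ (2 * k) * ∫ x, E j x ∂(cellMeasure d) := by
      have hbi : Integrable (fun x => (2 * C * A) ^ p + 4 * (K₁ * A) ^ (4 * (k : ℝ) / d) *
          ∑ j ∈ Finset.range (J + 1), ((2 : ℝ) ^ j) ^ (2 * k) * E j x) (cellMeasure d) :=
        (integrable_const _).add (hsumi.const_mul _)
      refine (integral_mono_ae hgi hbi ?_).trans ?_
      · rw [Filter.EventuallyLE, cellMeasure]
        exact ae_restrict_of_forall_mem measurableSet_Icc hpt
      · have h1 := integral_add (integrable_const ((2 * C * A) ^ p))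
          (hsumi.const_mul (4 * (K₁ * A) ^ (4 * (k : ℝ) / d)))
        have hi : ∀ j ∈ Finset.range (J + 1), Integrable
          (fun x => ((2 : ℝ) ^ j) ^ (2 * k) * E j x) (cellMeasure d) :=
            fun j _ => (hEi j).const_mul _
        refine le_of_eq (h1.trans ?_)
        rw [integral_const_mul, integral_finsetSum _ hi]
        simp only [integral_const_mul]
        simp
    have hsum : ∑ j ∈ Finset.range (J + 1), ((2 : ℝ) ^ j) ^ (2 * k) * ∫ x, E j x ∂(cellMeasure d) ≤
        C₂ * (8 / 3 + 2 * c₀ ^ (2 * k)) * Δ ^ 2 := by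
      have hD2 : sobolevNorm k g ^ 2 ≤ Δ ^ 2 :=
        pow_le_pow_left₀ (sobolevNorm_nonneg _ _) hsob 2
      calc _ ≤ ∑ j ∈ Finset.range (J + 1), ((2 : ℝ) ^ j) ^ (2 * k) *
            (C₂ * (∑' m, damping k (2 ^ j) m * ‖fcoef g m‖ ^ 2 +
              sobolevNorm k g ^ 2 / (N : ℝ) ^ (2 * k))) :=
            Finset.sum_le_sum fun j _ => mul_le_mul_of_nonneg_left (hEint j) (by positivity)
        _ = C₂ * (∑ j ∈ Finset.range (J + 1), ((2 : ℝ) ^ j) ^ (2 * k) *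
              ∑' m, damping k (2 ^ j) m * ‖fcoef g m‖ ^ 2 +
              (∑ j ∈ Finset.range (J + 1), ((2 : ℝ) ^ j) ^ (2 * k)) *
                (sobolevNorm k g ^ 2 / (N : ℝ) ^ (2 * k))) := by
            rw [Finset.sum_mul, ← Finset.sum_add_distrib, Finset.mul_sum]
            exact Finset.sum_congr rfl fun j _ => by ring
        -- The sampling errors form a geometric sum dominated by the finest level, where 2^J ≤ c₀ N
        -- cancels N^{-2k}.
        _ ≤ C₂ * (8 / 3 * Δ ^ 2 + (2 * (c₀ * N) ^ (2 * k)) * (Δ ^ 2 / (N : ℝ) ^ (2 * k))) := by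
            have h1 := hg.sum_damping_le hk1 (J + 1)
            have h2 : ∑ j ∈ Finset.range (J + 1), ((2 : ℝ) ^ j) ^ (2 * k) ≤
                2 * (c₀ * N) ^ (2 * k) := (sum_two_pow_le hk1 J).trans (by gcongr)
            have h3 : 8 / 3 * sobolevNorm k g ^ 2 ≤ 8 / 3 * Δ ^ 2 := by linarith
            have h4 := h1.trans h3
            gcongr
        _ = _ := by rw [mul_pow]; field_simp
    refine hint.trans ?_
    have hAp : A ^ p = A ^ 2 * A ^ (4 * (k : ℝ) / d) := by
      rw [hp, Real.rpow_add hA, Real.rpow_two]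
    calc _ ≤ (2 * C * A) ^ p + 4 * (K₁ * A) ^ (4 * (k : ℝ) / d) *
          (C₂ * (8 / 3 + 2 * c₀ ^ (2 * k)) * Δ ^ 2) := by gcongr
      _ = (2 * C) ^ p * A ^ p * 1 + 4 * K₁ ^ (4 * (k : ℝ) / d) *
          (C₂ * (8 / 3 + 2 * c₀ ^ (2 * k))) * (A ^ p * (Δ / A) ^ 2) := by
          rw [Real.mul_rpow (by positivity) hA.le, Real.mul_rpow hK₁0.le hA.le, hAp]
          field_simp
      _ ≤ (2 * C) ^ p * A ^ p * (Δ / A) ^ 2 + 4 * K₁ ^ (4 * (k : ℝ) / d) *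
          (C₂ * (8 / 3 + 2 * c₀ ^ (2 * k))) * (A ^ p * (Δ / A) ^ 2) := by
          have : 1 ≤ (Δ / A) ^ 2 := one_le_pow₀ hR1
          gcongr
      _ = K₂ * (A ^ p * (Δ / A) ^ 2) := by rw [hK₂]; ring
      _ ≤ _ := by gcongr; linarith

end Interpolation

end MIND
namespace MIND

/-! ### From the critical exponent and the supremum to all L^q norms -/

section LqNorm

variable {d : ℕ}

lemma lqNorm_nonneg (q : ℝ≥0∞) (g : (Fin d → ℝ) → ℝ) : 0 ≤ lqNorm q g := ENNReal.toReal_nonneg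

lemma lqNorm_le_of_forall (q : ℝ≥0∞) {g : (Fin d → ℝ) → ℝ} {C : ℝ} (hC : 0 ≤ C)
    (h : ∀ x ∈ Set.Icc (0 : Fin d → ℝ) 1, |g x| ≤ C) : lqNorm q g ≤ C := by
  refine ENNReal.toReal_le_of_le_ofReal hC ?_
  have h1 : ∀ᵐ x ∂(cellMeasure d), ‖g x‖ ≤ C := by
    rw [cellMeasure]
    exact ae_restrict_of_forall_mem measurableSet_Icc h
  refine (eLpNorm_le_of_ae_bound h1).trans (le_of_eq ?_)
  rw [measure_univ, ENNReal.one_rpow, one_mul]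

lemma lqNorm_mono {p q : ℝ≥0∞} (hpq : p ≤ q) {g : (Fin d → ℝ) → ℝ} (hg : Continuous g) :
    lqNorm p g ≤ lqNorm q g :=
  ENNReal.toReal_mono (memLp_cell hg q).eLpNorm_ne_top
    (eLpNorm_le_eLpNorm_of_exponent_le hpq hg.aestronglyMeasurable)

lemma lqNorm_eq {q : ℝ≥0∞} (h0 : q ≠ 0) (h : q ≠ ∞) {g : (Fin d → ℝ) → ℝ} (hg : Continuous g) :
    lqNorm q g = (∫ x, |g x| ^ q.toReal ∂(cellMeasure d)) ^ q.toReal⁻¹ := by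
  rw [lqNorm, (memLp_cell hg q).eLpNorm_eq_integral_rpow_norm h0 h, ENNReal.toReal_ofReal]
  · rfl
  · exact Real.rpow_nonneg (integral_nonneg fun x => Real.rpow_nonneg (norm_nonneg _) _) _

lemma lqNorm_sub_le {q : ℝ≥0∞} (hq : 1 ≤ q) {g h : (Fin d → ℝ) → ℝ} (hg : Continuous g)
    (hh : Continuous h) : lqNorm q g - lqNorm q h ≤ lqNorm q (fun x => g x - h x) := by
  have h1 : eLpNorm g q (cellMeasure d) ≤
      eLpNorm (fun x => g x - h x) q (cellMeasure d) + eLpNorm h q (cellMeasure d) := by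
    have := eLpNorm_add_le (hg.sub hh).aestronglyMeasurable hh.aestronglyMeasurable
      (μ := cellMeasure d) hq
    rwa [sub_add_cancel] at this
  have h2 := ENNReal.toReal_mono (ENNReal.add_ne_top.2
    ⟨(memLp_cell (hg.sub hh) q).eLpNorm_ne_top, (memLp_cell hh q).eLpNorm_ne_top⟩) h1
  rw [ENNReal.toReal_add (memLp_cell (hg.sub hh) q).eLpNorm_ne_top
    (memLp_cell hh q).eLpNorm_ne_top] at h2
  exact sub_le_iff_le_add.2 h2

/-- The right-hand side is 2/p for the critical exponent p = 2 + 4k/d, the power of Δ/A produced by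
`exists_sup_integral_bound`. -/
lemma one_sub_two_theta_of_le {k : ℕ} (hd : 1 ≤ d) {q : ℝ≥0∞}
    (hq : q ≤ ENNReal.ofReal ((4 * k + 2 * d) / d)) :
    1 - 2 * theta k d q = 2 * (2 + 4 * (k : ℝ) / d)⁻¹ := by
  have hd0 : (0 : ℝ) < d := by exact_mod_cast hd
  rw [theta, if_pos hq]
  field_simp
  ring

lemma one_sub_two_theta_of_gt {k : ℕ} (hk : 1 ≤ k) {q : ℝ≥0∞}
    (hq : ¬ q ≤ ENNReal.ofReal ((4 * k + 2 * d) / d)) :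
    1 - 2 * theta k d q = (d : ℝ) / (2 * k) - d * q.toReal⁻¹ / k := by
  have hk0 : (0 : ℝ) < k := by exact_mod_cast hk
  rw [theta, if_neg hq, ENNReal.toReal_inv]
  field_simp
  ring

lemma theta_nonneg {k : ℕ} (hk : d < 2 * k) (q : ℝ≥0∞) : 0 ≤ theta k d q := by
  have hk' : (d : ℝ) < 2 * k := by exact_mod_cast hk
  rw [theta]
  split_ifs
  · positivity
  · have : 0 ≤ (d : ℝ) * (q⁻¹).toReal := by positivity
    exact div_nonneg (by linarith) (by positivity)

/-- Makes the exponent 1 - 2ϑ of Δ/A nonnegative, which is also what places the final rate above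
n^{-1/2}. -/
lemma theta_le_half {k : ℕ} (hd : 1 ≤ d) (hk : d < 2 * k) (q : ℝ≥0∞) : theta k d q ≤ 1 / 2 := by
  have hk1 : 1 ≤ k := by omega
  have hd0 : (0 : ℝ) < d := by exact_mod_cast hd
  have hk0 : (0 : ℝ) < k := by exact_mod_cast hk1
  suffices 0 ≤ 1 - 2 * theta k d q by linarith
  by_cases hq : q ≤ ENNReal.ofReal ((4 * k + 2 * d) / d)
  · rw [one_sub_two_theta_of_le hd hq]; positivity
  · rw [one_sub_two_theta_of_gt hk1 hq]
    have h1 : q.toReal⁻¹ ≤ 1 / 2 := by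
      rw [← ENNReal.toReal_inv]
      refine ENNReal.toReal_le_of_le_ofReal (by norm_num) ?_
      rw [one_div, ENNReal.ofReal_inv_of_pos (by norm_num)]
      refine ENNReal.inv_le_inv.2 (le_trans (ENNReal.ofReal_le_ofReal ?_) (not_le.1 hq).le)
      rw [le_div_iff₀ hd0]; linarith
    have h2 : (d : ℝ) / (2 * k) - d * q.toReal⁻¹ / k = d * (1 / 2 - q.toReal⁻¹) / k := by
      field_simp
    rw [h2]
    exact div_nonneg (mul_nonneg hd0.le (by linarith)) hk0.le

/-- The multiscale interpolation inequality: a function with small multiresolution norm on the grid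
and bounded Sobolev norm has small `L^q` norm. -/
theorem exists_lqNorm_le (hd : 1 ≤ d) {k : ℕ} (hk : d < 2 * k) {𝓑 : Set (Cube d)}
    (h𝓑 : IsNormal 𝓑) {q : ℝ≥0∞} (hq : 1 ≤ q) :
    ∃ K c₀ : ℝ, 0 < K ∧ 0 < c₀ ∧ ∀ N : ℕ, 1 ≤ N → ∀ g : (Fin d → ℝ) → ℝ, MemHk0 k g →
      ∀ A Δ : ℝ, 0 < A → A ≤ Δ → Δ ≤ A * (c₀ * N) ^ k →
        mrNorm 𝓑 (sample N g) ≤ A * √((N : ℝ) ^ d) → sobolevNorm k g ≤ Δ →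
        lqNorm q g ≤ K * (A * (Δ / A) ^ (1 - 2 * theta k d q)) := by
  obtain ⟨K, c₀, hK, hc₀, hbd⟩ := exists_sup_integral_bound hd hk h𝓑
  have hd0 : (0 : ℝ) < d := by exact_mod_cast hd
  have hk1 : 1 ≤ k := by omega
  have hk0 : (0 : ℝ) < k := by exact_mod_cast hk1
  set p := 2 + 4 * (k : ℝ) / d with hp
  have hp0 : 0 < p := by positivity
  have hpe : (4 * (k : ℝ) + 2 * d) / d = p := by rw [hp]; field_simp; ring
  have hint0 : ∀ (g : (Fin d → ℝ) → ℝ) (s : ℝ), 0 ≤ ∫ x, |g x| ^ s ∂(cellMeasure d) := fun g s =>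
    integral_nonneg fun x => Real.rpow_nonneg (abs_nonneg _) _
  by_cases hqp : q ≤ ENNReal.ofReal ((4 * k + 2 * d) / d)
  · refine ⟨K ^ p⁻¹, c₀, by positivity, hc₀, fun N hN g hg A Δ hA hAΔ hΔ hmr hsob => ?_⟩
    obtain ⟨-, h2⟩ := hbd N hN g hg A Δ hA hAΔ hΔ hmr hsob
    have hR : 0 < Δ / A := div_pos (hA.trans_le hAΔ) hA
    rw [one_sub_two_theta_of_le hd hqp]
    rw [hpe] at hqp
    refine (lqNorm_mono hqp hg.continuous).trans ?_
    rw [lqNorm_eq (by simpa using hp0) ENNReal.ofReal_ne_top hg.continuous,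
      ENNReal.toReal_ofReal hp0.le]
    refine (Real.rpow_le_rpow (hint0 g p) h2 (by positivity)).trans (le_of_eq ?_)
    rw [Real.mul_rpow hK.le (by positivity), Real.mul_rpow (by positivity) (by positivity),
      Real.rpow_rpow_inv hA.le hp0.ne', ← Real.rpow_natCast (Δ / A) 2, ← Real.rpow_mul hR.le]
    norm_num [hp]
  · by_cases hqt : q = ∞
    · refine ⟨K, c₀, hK, hc₀, fun N hN g hg A Δ hA hAΔ hΔ hmr hsob => ?_⟩
      obtain ⟨h1, -⟩ := hbd N hN g hg A Δ hA hAΔ hΔ hmr hsob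
      have hR : 0 < Δ / A := div_pos (hA.trans_le hAΔ) hA
      rw [one_sub_two_theta_of_gt hk1 hqp, hqt]
      simp only [ENNReal.toReal_top, inv_zero, mul_zero, zero_div, sub_zero]
      exact lqNorm_le_of_forall _ (by positivity) h1
    · set s := q.toReal with hs
      have hps : p < s := by
        rw [hpe] at hqp
        exact (ENNReal.ofReal_lt_iff_lt_toReal hp0.le hqt).1 (not_le.1 hqp)
      have hs0 : 0 < s := hp0.trans hps
      refine ⟨(K ^ (s - p) * K) ^ s⁻¹, c₀, by positivity, hc₀,
        fun N hN g hg A Δ hA hAΔ hΔ hmr hsob => ?_⟩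
      obtain ⟨h1, h2⟩ := hbd N hN g hg A Δ hA hAΔ hΔ hmr hsob
      have hR : 0 < Δ / A := div_pos (hA.trans_le hAΔ) hA
      set R := Δ / A with hRdef
      set e := (d : ℝ) / (2 * k) with he
      rw [lqNorm_eq (by positivity) hqt hg.continuous, one_sub_two_theta_of_gt hk1 hqp, ← hs]
      have hcont : ∀ r : ℝ, 0 ≤ r → Integrable (fun x => |g x| ^ r) (cellMeasure d) := fun r hr =>
        integrable_cell (hg.continuous.abs.rpow_const fun x => Or.inr hr)
      -- For p < s < ∞, s - p powers of |g| are replaced by the supremum bound and the p-th power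
      -- integral remains.
      have h3 : ∫ x, |g x| ^ s ∂(cellMeasure d) ≤
          (K * (A * R ^ e)) ^ (s - p) * ∫ x, |g x| ^ p ∂(cellMeasure d) := by
        rw [← integral_const_mul]
        refine integral_mono_ae (hcont s hs0.le) ((hcont p hp0.le).const_mul _) ?_
        rw [Filter.EventuallyLE, cellMeasure]
        refine ae_restrict_of_forall_mem measurableSet_Icc fun x hx => ?_
        rw [show s = (s - p) + p by ring, Real.rpow_add_of_nonneg (abs_nonneg _) (by linarith) hp0.le]
        simp only [sub_add_cancel]
        refine mul_le_mul_of_nonneg_right ?_ (Real.rpow_nonneg (abs_nonneg _) _)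
        exact Real.rpow_le_rpow (abs_nonneg _) (h1 x hx) (by linarith)
      have h4 := h3.trans (mul_le_mul_of_nonneg_left h2 (by positivity))
      refine (Real.rpow_le_rpow (hint0 g s) h4 (by positivity)).trans (le_of_eq ?_)
      have h5 : (K * (A * R ^ e)) ^ (s - p) * (K * (A ^ p * R ^ 2)) =
          (K ^ (s - p) * K) * (A ^ s * R ^ (e * (s - p) + 2)) := by
        rw [Real.mul_rpow hK.le (by positivity), Real.mul_rpow hA.le (by positivity),
          Real.rpow_add hR, Real.rpow_mul hR.le, Real.rpow_two,
          show A ^ s = A ^ (s - p) * A ^ p by rw [← Real.rpow_add hA, sub_add_cancel]]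
        ring
      rw [h5, Real.mul_rpow (y := A ^ s * R ^ (e * (s - p) + 2)) (by positivity) (by positivity),
        Real.mul_rpow (x := A ^ s) (by positivity) (by positivity), Real.rpow_rpow_inv hA.le hs0.ne', ← Real.rpow_mul hR.le]
      congr 3
      rw [he, hp]
      field_simp
      ring

/-- The Sobolev embedding into the continuous functions. -/
theorem exists_abs_le_sobolevNorm {k : ℕ} (hk : d < 2 * k) :
    ∃ K : ℝ, 0 ≤ K ∧ ∀ g : (Fin d → ℝ) → ℝ, MemHk0 k g → ∀ x ∈ Set.Icc (0 : Fin d → ℝ) 1,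
      |g x| ≤ K * sobolevNorm k g := by
  set L := ∑' m : Fin d → ℤ, (freqWeight k 1 m)⁻¹ with hL
  have hL0 : 0 ≤ L := tsum_nonneg fun m => inv_nonneg.2 (freqWeight_pos _ _ _).le
  refine ⟨√(L * 4 ^ k), Real.sqrt_nonneg _, fun g hg x hx => ?_⟩
  obtain ⟨hs, hle⟩ := hg.summable_pow_norm
  have h1 : Summable fun m => freqWeight k 1 m * ‖fcoef g m‖ ^ 2 :=
    Summable.of_nonneg_of_le (fun m => mul_nonneg (freqWeight_pos _ _ _).le (sq_nonneg _))
      (freqWeight_mul_le le_rfl hg) (hs.mul_left _)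
  have h2 := norm_tsum_sq_le (c := fun m => fcoef g m * char m x)
    (f := fun m => (freqWeight k 1 m)⁻¹) (g := fun m => freqWeight k 1 m * ‖fcoef g m‖ ^ 2)
    (fun m => inv_nonneg.2 (freqWeight_pos _ _ _).le)
    (fun m => mul_nonneg (freqWeight_pos _ _ _).le (sq_nonneg _)) (summable_freqWeight_one hk) h1
    (fun m => by
      rw [norm_mul, norm_char, mul_one, inv_mul_cancel_left₀ (freqWeight_pos _ _ _).ne'])
  rw [(hg.hasSum_char hk hx).tsum_eq, Complex.norm_real, Real.norm_eq_abs] at h2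
  refine abs_le_of_sq_le_sq (a := |g x|) ?_ (mul_nonneg (Real.sqrt_nonneg _) (sobolevNorm_nonneg _ _))
    |>.trans' (le_abs_self _)
  rw [mul_pow, Real.sq_sqrt (by positivity), mul_assoc]
  refine h2.trans (mul_le_mul_of_nonneg_left ?_ hL0)
  refine (h1.tsum_le_tsum (freqWeight_mul_le le_rfl hg) (hs.mul_left _)).trans ?_
  rw [tsum_mul_left]
  exact mul_le_mul_of_nonneg_left hle (by positivity)

end LqNorm

end MIND
namespace MIND

/-! ### Trigonometric interpolation of grid data with mean zero -/

section Interpolant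

variable {d : ℕ}

/-- Trigonometric interpolation on the grid by functions with mean zero. -/
theorem exists_interpolant (hd : 1 ≤ d) (k : ℕ) :
    ∃ K : ℝ, 0 ≤ K ∧ ∀ N : ℕ, 1 ≤ N → ∀ y : (Fin d → Fin N) → ℝ, ∃ g, MemHk0 k g ∧
      sample N g = y ∧ ∀ B : ℝ, 0 ≤ B → (∀ τ, |y τ| ≤ B) →
        sobolevNorm k g ≤ K * (N : ℝ) ^ k * B := by
  classical
  refine ⟨√((2 * Real.pi) ^ (2 * k) * (d : ℝ) ^ k), Real.sqrt_nonneg _, fun N hN y => ?_⟩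
  have : NeZero N := ⟨by omega⟩
  have hN0 : (0 : ℝ) < N := by exact_mod_cast hN
  have hNC : ((N : ℂ) ^ d) ≠ 0 := pow_ne_zero _ (Nat.cast_ne_zero.2 (by omega))
  -- The zero frequency is replaced by N in the first coordinate: the values on the grid are
  -- unchanged by aliasing, and the mean becomes zero.
  set shift : (Fin d → Fin N) → (Fin d → ℤ) :=
    fun ρ => if ρ = 0 then Pi.single ⟨0, hd⟩ 1 else 0 with hshift
  set φ : (Fin d → Fin N) → (Fin d → ℤ) := fun ρ => residueEquiv d N (ρ, shift ρ) with hφ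
  have hφi : Function.Injective φ := fun ρ ρ' h =>
    (Prod.mk.inj ((residueEquiv d N).injective h)).1
  set yh : (Fin d → Fin N) → ℂ := fun ρ => ((N : ℂ) ^ d)⁻¹ *
    ∑ τ, (y τ : ℂ) * char (toFreq ρ) (-gridPoint τ) with hyh
  set s := Finset.univ.image φ with hs
  set b : (Fin d → ℤ) → ℂ := fun m => yh ((residueEquiv d N).symm m).1 with hb
  have hbφ : ∀ ρ, b (φ ρ) = yh ρ := fun ρ => by simp [hb, hφ]
  have h0 : (0 : Fin d → ℤ) ∉ s := by
    rw [hs, Finset.mem_image]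
    rintro ⟨ρ, -, hρ⟩
    have h1 : residueEquiv d N (0, 0) = 0 := by
      ext a; simp [residueEquiv_apply]
    rw [← h1] at hρ
    obtain ⟨h2, h3⟩ := Prod.mk.inj ((residueEquiv d N).injective hρ)
    rw [hshift] at h3
    simp only [h2, if_true] at h3
    have := congrFun h3 ⟨0, hd⟩
    simp at this
  have hinterp : ∀ τ, ∑ ρ, yh ρ * char (toFreq ρ) (gridPoint τ) = (y τ : ℂ) := by
    intro τ
    simp only [hyh, mul_assoc, Finset.sum_mul, ← Finset.mul_sum]
    rw [Finset.sum_comm]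
    have h1 : ∀ τ', ∑ ρ : Fin d → Fin N, (y τ' : ℂ) * (char (toFreq ρ) (-gridPoint τ') *
        char (toFreq ρ) (gridPoint τ)) = (y τ' : ℂ) * if τ = τ' then (N : ℂ) ^ d else 0 := by
      intro τ'
      rw [← sum_char_freq τ τ', Finset.mul_sum]
      refine Finset.sum_congr rfl fun ρ _ => ?_
      rw [sub_eq_add_neg, char_add_right, mul_comm (char _ _)]
    simp only [h1, mul_ite, mul_zero, Finset.sum_ite_eq, Finset.mem_univ, if_true]
    field_simp
  have htrig : ∀ τ, trigPoly s b (gridPoint τ) = (y τ : ℂ) := by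
    intro τ
    rw [trigPoly, hs, Finset.sum_image fun ρ _ ρ' _ h => hφi h, ← hinterp τ]
    refine Finset.sum_congr rfl fun ρ _ => ?_
    rw [hbφ, hφ]
    simp only [char_residue]
  refine ⟨_, memHk0_trigPoly k h0 b, ?_, fun B hB hyB => ?_⟩
  · ext τ
    rw [sample, htrig, Complex.ofReal_re]
  · have hcoef : ∀ m ∈ s, ∑ a, (m a : ℝ) ^ 2 ≤ d * (N : ℝ) ^ 2 := by
      intro m hm
      obtain ⟨ρ, -, rfl⟩ := Finset.mem_image.1 hm
      have h1 : ∀ a, (((φ ρ) a : ℤ) : ℝ) ^ 2 ≤ (N : ℝ) ^ 2 := by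
        intro a
        have h2 : 0 ≤ φ ρ a ∧ φ ρ a ≤ N := by
          simp only [hφ, hshift, residueEquiv_apply]
          have h3 := (ρ a).2
          split_ifs with h4
          · subst h4
            by_cases ha : a = ⟨0, hd⟩
            · subst ha; simp
            · simp [ha]
          · simp only [Pi.zero_apply]
            omega
        have h3 : (0 : ℝ) ≤ φ ρ a := by exact_mod_cast h2.1
        have h4 : ((φ ρ a : ℤ) : ℝ) ≤ N := by exact_mod_cast h2.2
        exact pow_le_pow_left₀ h3 h4 2
      refine (Finset.sum_le_sum fun a _ => h1 a).trans (le_of_eq ?_)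
      simp
    have hpars := sum_normSq_grid yh
    simp only [hinterp] at hpars
    have hyh2 : ∑ ρ, ‖yh ρ‖ ^ 2 ≤ B ^ 2 := by
      have h1 : ∑ τ : Fin d → Fin N, ‖(y τ : ℂ)‖ ^ 2 ≤ (N : ℝ) ^ d * B ^ 2 := by
        have h2 : ∀ τ ∈ (Finset.univ : Finset (Fin d → Fin N)), ‖(y τ : ℂ)‖ ^ 2 ≤ B ^ 2 :=
          fun τ _ => by
            rw [Complex.norm_real]
            exact pow_le_pow_left₀ (norm_nonneg _) (hyB τ) 2
        refine (Finset.sum_le_sum h2).trans (le_of_eq ?_)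
        simp
      rw [hpars] at h1
      exact le_of_mul_le_mul_left h1 (by positivity)
    have h2 := sobolevNorm_trigPoly_sq_le k h0 b
    refine abs_le_of_sq_le_sq (h2.trans ?_) (by positivity) |>.trans' (le_abs_self _)
    calc ∑ m ∈ s, (2 * Real.pi) ^ (2 * k) * (∑ a, (m a : ℝ) ^ 2) ^ k * ‖b m‖ ^ 2
        ≤ ∑ m ∈ s, (2 * Real.pi) ^ (2 * k) * (d * (N : ℝ) ^ 2) ^ k * ‖b m‖ ^ 2 := by
          refine Finset.sum_le_sum fun m hm => ?_
          have h3 := hcoef m hm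
          have h4 : 0 ≤ ∑ a, (m a : ℝ) ^ 2 := Finset.sum_nonneg fun a _ => sq_nonneg _
          gcongr
      _ = (2 * Real.pi) ^ (2 * k) * (d * (N : ℝ) ^ 2) ^ k * ∑ ρ, ‖yh ρ‖ ^ 2 := by
          rw [hs, Finset.sum_image fun ρ _ ρ' _ h => hφi h, Finset.mul_sum]
          simp only [hbφ]
      _ ≤ (2 * Real.pi) ^ (2 * k) * (d * (N : ℝ) ^ 2) ^ k * B ^ 2 := by gcongr
      _ = _ := by
          rw [mul_pow _ B, mul_pow _ ((N : ℝ) ^ k), Real.sq_sqrt (by positivity), mul_pow]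
          ring

end Interpolant

/-! ### Deterministic properties of the estimator -/

section Estimator

variable {d N k : ℕ} {𝓑 : Set (Cube d)} {y y' : (Fin d → Fin N) → ℝ} {γ : ℝ}
  {u u' : (Fin d → ℝ) → ℝ}

lemma mrNorm_zero (𝓑 : Set (Cube d)) : mrNorm 𝓑 (0 : (Fin d → Fin N) → ℝ) = 0 := by
  simpa using mrNorm_smul 𝓑 0 (0 : (Fin d → Fin N) → ℝ)

lemma mrNorm_neg (𝓑 : Set (Cube d)) (y : (Fin d → Fin N) → ℝ) : mrNorm 𝓑 (-y) = mrNorm 𝓑 y := by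
  simpa using mrNorm_smul 𝓑 (-1) y

/-- The variational inequality for the estimator. -/
lemma IsMIND.inner_nonneg (hu : IsMIND k 𝓑 y γ u) {g : (Fin d → ℝ) → ℝ} (hg : MemHk0 k g)
    (hgy : mrNorm 𝓑 (sample N g - y) ≤ γ) : 0 ≤ sobolevInner k u (fun x => g x - u x) := by
  obtain ⟨hu0, huy, hmin⟩ := hu
  have hgu := hg.sub hu0
  set v : (Fin d → ℝ) → ℝ := fun x => g x - u x with hv
  by_contra! hneg
  set a := sobolevInner k u v with ha
  set b := sobolevInner k v v with hb
  have hb0 : 0 ≤ b := sobolevInner_self_nonneg k v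
  have key : ∀ t : ℝ, 0 ≤ t → t ≤ 1 → 0 ≤ 2 * t * a + t ^ 2 * b := by
    intro t h0 h1
    have htv := hgu.const_mul t
    have hfeas : mrNorm 𝓑 (sample N (fun x => u x + t * v x) - y) ≤ γ := by
      have h2 : sample N (fun x => u x + t * v x) - y =
          (1 - t) • (sample N u - y) + t • (sample N g - y) := by
        ext τ
        simp only [sample, hv, Pi.sub_apply, Pi.add_apply, Pi.smul_apply, smul_eq_mul]
        ring
      rw [h2]
      refine (mrNorm_add_le _ _ _).trans ?_
      rw [mrNorm_smul, mrNorm_smul, abs_of_nonneg h0, abs_of_nonneg (sub_nonneg.2 h1)]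
      nlinarith
    have h3 := hmin _ (hu0.add htv) hfeas
    rw [sobolevNorm_sq, sobolevNorm_sq, sobolevInner_add_left hu0 htv (hu0.add htv),
      sobolevInner_add_right hu0 htv hu0, sobolevInner_add_right hu0 htv htv,
      sobolevInner_const_mul_left hgu, sobolevInner_const_mul_left hgu,
      sobolevInner_const_mul_right hgu, sobolevInner_const_mul_right hgu,
      sobolevInner_comm v u] at h3
    rw [ha, hb]
    linarith
  -- The quadratic 2ta + t²b has its minimiser -a/b in [0,1] unless b ≤ -a, and then t = 1 already
  -- contradicts a < 0.
  by_cases hab : b ≤ -a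
  · have := key 1 zero_le_one le_rfl
    linarith
  · have hb' : 0 < b := by linarith
    have h4 := key (-a / b) (div_nonneg (by linarith) hb0) ((div_le_one hb').2 (by linarith))
    have h5 : 2 * (-a / b) * a + (-a / b) ^ 2 * b = -(a ^ 2 / b) := by field_simp; ring
    rw [h5] at h4
    have : 0 < a ^ 2 / b := div_pos (by nlinarith) hb'
    linarith

/-- The estimator depends on the data in a Lipschitz continuous way. -/
lemma IsMIND.sobolevNorm_sub_le (hu : IsMIND k 𝓑 y γ u) (hu' : IsMIND k 𝓑 y' γ u')
    {h : (Fin d → ℝ) → ℝ} (hh : MemHk0 k h) (hs : sample N h = y - y') :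
    sobolevNorm k (fun x => u x - u' x) ≤ sobolevNorm k h := by
  have hu0 := hu.1
  have hu0' := hu'.1
  -- Translation by `h` carries the feasible set for `y'` to that for `y`, so each estimator yields
  -- a competitor for the other. Adding the two variational inequalities gives ‖D^k(u - u')‖² ≤ ⟨u -
  -- u', h⟩.
  have e1 : sample N (fun x => u' x + h x) - y = sample N u' - y' := by
    ext τ
    have := congrFun hs τ
    simp only [sample, Pi.sub_apply] at this ⊢
    linarith
  have e2 : sample N (fun x => u x - h x) - y' = sample N u - y := by
    ext τ
    have := congrFun hs τ
    simp only [sample, Pi.sub_apply] at this ⊢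
    linarith
  have h1 := hu.inner_nonneg (hu0'.add hh) (by rw [e1]; exact hu'.2.1)
  have h2 := hu'.inner_nonneg (hu0.sub hh) (by rw [e2]; exact hu.2.1)
  set v : (Fin d → ℝ) → ℝ := fun x => u x - u' x with hv
  have hv0 : MemHk0 k v := hu0.sub hu0'
  have e3 : (fun x => u' x + h x - u x) = fun x => h x - v x := by ext x; simp only [hv]; ring
  have e4 : (fun x => u x - h x - u' x) = fun x => v x - h x := by ext x; simp only [hv]; ring
  rw [e3, sobolevInner_sub_right hh hv0 hu0] at h1
  rw [e4, sobolevInner_sub_right hv0 hh hu0'] at h2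
  have h3 : sobolevInner k v v ≤ sobolevInner k v h := by
    have h4 := sobolevInner_sub_left hu0 hu0' hv0
    have h5 := sobolevInner_sub_left hu0 hu0' hh
    linarith
  have h6 := h3.trans ((le_abs_self _).trans (abs_sobolevInner_le hv0 hh))
  rw [← sobolevNorm_sq, sq] at h6
  by_contra! hlt
  have h7 := sobolevNorm_nonneg k h
  nlinarith

/-- A bound for the estimator without any assumption on the noise. -/
lemma IsMIND.sobolevNorm_sub_le_interpolant (hu : IsMIND k 𝓑 y γ u) (hγ : 0 ≤ γ)
    {f h : (Fin d → ℝ) → ℝ} (hf : MemHk0 k f) (hh : MemHk0 k h)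
    (hs : sample N h = y - sample N f) :
    sobolevNorm k (fun x => u x - f x) ≤ 2 * sobolevNorm k f + sobolevNorm k h := by
  -- The function `f + h` interpolates the data and is feasible whatever the noise.
  have e1 : sample N (fun x => f x + h x) - y = 0 := by
    ext τ
    have := congrFun hs τ
    simp only [sample, Pi.sub_apply, Pi.zero_apply] at this ⊢
    linarith
  have h1 := hu.2.2 _ (hf.add hh) (by rw [e1, mrNorm_zero]; exact hγ)
  have h2 : sobolevNorm k u ≤ sobolevNorm k (fun x => f x + h x) :=
    le_of_sq_le_sq (by linarith) (sobolevNorm_nonneg _ _)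
  have h3 := sobolevNorm_add_le hf hh
  have h4 := sobolevNorm_add_le hu.1 (hf.const_mul (-1))
  have h5 : sobolevNorm k (fun x => -1 * f x) = sobolevNorm k f := by
    rw [sobolevNorm, sobolevNorm, sobolevInner_const_mul_left hf, sobolevInner_const_mul_right hf]
    norm_num
  have e2 : (fun x => u x - f x) = fun x => u x + -1 * f x := by ext x; ring
  rw [e2]
  linarith

lemma sum_mul_le_of_dualMRNorm_le {w v : (Fin d → Fin N) → ℝ} {t b : ℝ} (ht : 0 ≤ t) (hb : 0 < b)
    (hw : dualMRNorm 𝓑 w ≤ ENNReal.ofReal t) (hv : mrNorm 𝓑 v ≤ b) : ∑ τ, w τ * v τ ≤ t * b := by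
  have h1 : mrNorm 𝓑 (b⁻¹ • v) ≤ 1 := by
    rw [mrNorm_smul, abs_of_pos (inv_pos.2 hb), inv_mul_le_iff₀ hb, mul_one]
    exact hv
  have h2 : ENNReal.ofReal (∑ τ, w τ * (b⁻¹ • v) τ) ≤ ENNReal.ofReal t :=
    (le_iSup₂ (f := fun (v : (Fin d → Fin N) → ℝ) (_ : mrNorm 𝓑 v ≤ 1) =>
      ENNReal.ofReal (∑ τ, w τ * v τ)) _ h1).trans hw
  rw [ENNReal.ofReal_le_ofReal_iff ht] at h2
  have h3 : ∑ τ, w τ * (b⁻¹ • v) τ = (∑ τ, w τ * v τ) / b := by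
    rw [Finset.sum_div]
    refine Finset.sum_congr rfl fun τ _ => ?_
    rw [Pi.smul_apply, smul_eq_mul]; field_simp
  rwa [h3, div_le_iff₀ hb] at h2

/-- The deterministic error bound for small noise. -/
lemma IsMIND.sobolevNorm_sub_le_distFun (hu : IsMIND k 𝓑 y γ u) (hγ : 0 < γ)
    {f : (Fin d → ℝ) → ℝ} (hf : MemHk0 k f) (hfy : mrNorm 𝓑 (sample N f - y) ≤ γ) {t : ℝ}
    (ht : 0 ≤ t) :
    sobolevNorm k (fun x => u x - f x) ≤ distFun k 𝓑 f N t + √(2 * γ * t) := by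
  rw [← sub_le_iff_le_add]
  -- Zero weights with zero adjoint show that the infimum is over a nonempty set.
  refine le_csInf ⟨_, 0, fun _ => 0, ?_, ⟨MemHk0.zero k, fun g hg => ?_⟩, rfl⟩ ?_
  · simp [dualMRNorm]
  · have := sobolevInner_const_mul_right (MemHk0.zero (d := d) k) 0 g
    simpa using this.symm
  rintro s ⟨w, v, hw, ⟨hv, hadj⟩, rfl⟩
  have hu0 := hu.1
  have huf := hu0.sub hf
  have hfu := hu.inner_nonneg hf hfy
  set e : (Fin d → ℝ) → ℝ := fun x => u x - f x with he
  set δ := sobolevNorm k e with hδ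
  set s := sobolevNorm k (fun x => v x - f x) with hs
  have h1 : sobolevInner k u e ≤ 0 := by
    have h2 := sobolevInner_sub_right hf hu0 hu0
    have h3 := sobolevInner_sub_right hu0 hf hu0
    simp only [he]
    linarith
  have h2 : mrNorm 𝓑 (-sample N e) ≤ 2 * γ := by
    have h3 : -sample N e = (sample N f - y) + -(sample N u - y) := by
      ext τ; simp only [sample, he, Pi.neg_apply, Pi.sub_apply, Pi.add_apply]; ring
    rw [h3]
    refine (mrNorm_add_le _ _ _).trans ?_
    rw [mrNorm_neg]
    linarith [hu.2.1]
  have h3 : -sobolevInner k v e ≤ 2 * γ * t := by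
    have h4 := sum_mul_le_of_dualMRNorm_le ht (by positivity) hw h2
    rw [sobolevInner_comm, ← hadj e huf, ← Finset.sum_neg_distrib]
    refine le_trans (le_of_eq (Finset.sum_congr rfl fun τ _ => ?_)) (h4.trans_eq (by ring))
    rw [Pi.neg_apply]; ring
  -- As ⟨u, e⟩ ≤ 0, one has δ² ≤ -⟨f, e⟩ = ⟨v - f, e⟩ - ⟨v, e⟩; Cauchy–Schwarz bounds the first term
  -- and duality of the norms the second.
  have h4 : δ ^ 2 ≤ s * δ + 2 * γ * t := by
    have h5 := sobolevInner_sub_left hu0 hf huf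
    have h6 := sobolevInner_sub_left hv hf huf
    have h7 := (le_abs_self _).trans (abs_sobolevInner_le (hv.sub hf) huf)
    rw [hδ, sobolevNorm_sq]
    simp only [he] at *
    linarith
  have hs0 : 0 ≤ s := sobolevNorm_nonneg _ _
  have hδ0 : 0 ≤ δ := sobolevNorm_nonneg _ _
  have h5 : 0 ≤ 2 * γ * t := by positivity
  have h6 := Real.sq_sqrt h5
  have h7 := Real.sqrt_nonneg (2 * γ * t)
  by_contra! h8
  nlinarith

lemma IsMIND.mrNorm_sample_sub_le (hu : IsMIND k 𝓑 y γ u) {f : (Fin d → ℝ) → ℝ}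
    (hfy : mrNorm 𝓑 (sample N f - y) ≤ γ) :
    mrNorm 𝓑 (sample N fun x => u x - f x) ≤ 2 * γ := by
  have h3 : (sample N fun x => u x - f x) = (sample N u - y) + -(sample N f - y) := by
    ext τ; simp only [sample, Pi.neg_apply, Pi.sub_apply, Pi.add_apply]; ring
  rw [h3]
  refine (mrNorm_add_le _ _ _).trans ?_
  rw [mrNorm_neg]
  linarith [hu.2.1]

end Estimator

end MIND
namespace MIND

/-! ### Expectations under sub-Gaussian noise -/

section Noise

variable {Ω : Type*} [MeasurableSpace Ω] {P : Measure Ω} {d N k : ℕ} {𝓑 : Set (Cube d)}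

/-- A Lipschitz function of finitely many integrable random variables is integrable. -/
lemma integrable_of_lipschitz [IsFiniteMeasure P] {ι : Type*} [Fintype ι] {Y : ι → Ω → ℝ}
    (hY : ∀ i, Integrable (Y i) P) {X : Ω → ℝ} {L : ℝ} (hL : 0 ≤ L)
    (hX : ∀ ω ω' B, 0 ≤ B → (∀ i, |Y i ω - Y i ω'| ≤ B) → |X ω - X ω'| ≤ L * B) :
    Integrable X P := by
  classical
  set Z : Ω → ι → ℝ := fun ω i => Y i ω with hZ
  have hdist : ∀ ω ω', |X ω - X ω'| ≤ L * dist (Z ω) (Z ω') := fun ω ω' =>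
    hX ω ω' _ dist_nonneg fun i => by
      rw [← Real.dist_eq]
      exact dist_le_pi_dist (Z ω) (Z ω') i
  -- Measurability of `X` is not given. The Lipschitz bound makes `X` a Lipschitz function of the
  -- noise vector on its range; extended to the whole space, it is continuous, so `X` is measurable.
  set φ : (ι → ℝ) → ℝ := fun y => if h : ∃ ω, Z ω = y then X h.choose else 0 with hφ
  have hφZ : ∀ ω, φ (Z ω) = X ω := by
    intro ω
    have h : ∃ ω', Z ω' = Z ω := ⟨ω, rfl⟩
    simp only [hφ, dif_pos h]
    have h2 := hdist h.choose ω
    rw [h.choose_spec, dist_self, mul_zero] at h2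
    exact sub_eq_zero.1 (abs_nonpos_iff.1 h2)
  have hlip : LipschitzOnWith ⟨L, hL⟩ φ (Set.range Z) := by
    refine LipschitzOnWith.of_dist_le_mul ?_
    rintro _ ⟨ω, rfl⟩ _ ⟨ω', rfl⟩
    rw [hφZ, hφZ, Real.dist_eq]
    exact hdist ω ω'
  obtain ⟨F, hF, hFφ⟩ := hlip.extend_real
  have hXF : X = fun ω => F (Z ω) := by
    ext ω
    rw [← hFφ ⟨ω, rfl⟩, hφZ]
  have hmeas : AEStronglyMeasurable X P := by
    rw [hXF]
    exact hF.continuous.comp_aestronglyMeasurable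
      (aemeasurable_pi_lambda _ fun i => (hY i).aemeasurable).aestronglyMeasurable
  refine Integrable.mono' (g := fun ω => |F 0| + L * ∑ i, |Y i ω|)
    ((integrable_const _).add ((integrable_finsetSum _ fun i _ => (hY i).abs).const_mul L)) hmeas
    (ae_of_all _ fun ω => ?_)
  have h1 := hF.dist_le_mul (Z ω) 0
  rw [Real.dist_eq, dist_zero_right] at h1
  have h2 : ‖Z ω‖ ≤ ∑ i, |Y i ω| :=
    (pi_norm_le_iff_of_nonneg (Finset.sum_nonneg fun i _ => abs_nonneg _)).2 fun i =>
      Finset.single_le_sum (f := fun i => |Y i ω|) (fun i _ => abs_nonneg _) (Finset.mem_univ i)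
  have h3 : L * ‖Z ω‖ ≤ L * ∑ i, |Y i ω| := mul_le_mul_of_nonneg_left h2 hL
  have h4 : |F (Z ω) - F 0| ≤ L * ‖Z ω‖ := h1
  rw [Real.norm_eq_abs, hXF]
  have h5 := abs_sub_abs_le_abs_sub (F (Z ω)) (F 0)
  simp only
  linarith

/-- The grid points in a cube form a discrete box. -/
lemma Cube.exists_gridPoints_eq_Icc (B : Cube d) (h : (B.gridPoints N).Nonempty) :
    ∃ p : (Fin d → Fin N) × (Fin d → Fin N), B.gridPoints N = Finset.Icc p.1 p.2 := by
  -- Membership in a cube is a condition on each coordinate separately, so the extreme points may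
  -- differ from coordinate to coordinate.
  choose lo hlo hlo' using fun a => Finset.exists_min_image (B.gridPoints N) (fun τ => τ a) h
  choose hi hhi hhi' using fun a => Finset.exists_max_image (B.gridPoints N) (fun τ => τ a) h
  refine ⟨(fun a => lo a a, fun a => hi a a), ?_⟩
  ext τ
  rw [Finset.mem_Icc]
  constructor
  · exact fun hτ => ⟨fun a => hlo' a τ hτ, fun a => hhi' a τ hτ⟩
  · rintro ⟨h1, h2⟩
    rw [Cube.mem_gridPoints]
    intro a
    have h3 := (Cube.mem_gridPoints.1 (hlo a) a).1
    have h4 := (Cube.mem_gridPoints.1 (hhi a) a).2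
    have h5 : ((lo a a : ℕ) : ℝ) ≤ (τ a : ℕ) := by exact_mod_cast h1 a
    have h6 : ((τ a : ℕ) : ℝ) ≤ (hi a a : ℕ) := by exact_mod_cast h2 a
    simp only [gridPoint] at h3 h4 ⊢
    exact ⟨h3.trans (by gcongr), lt_of_le_of_lt (by gcongr) h4⟩

lemma exp_mul_abs_le (a x : ℝ) :
    Real.exp (a * |x|) ≤ Real.exp (a * x) + Real.exp (-a * x) := by
  have h1 := Real.exp_pos (a * x)
  have h2 := Real.exp_pos (-a * x)
  rcases abs_cases x with ⟨h, -⟩ | ⟨h, -⟩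
  · rw [h]; linarith
  · rw [h, show a * -x = -a * x by ring]; linarith

lemma integrable_exp_add_exp {X : Ω → ℝ} {c : ℝ≥0} (h : HasSubgaussianMGF X c P) (s : ℝ) :
    Integrable (fun ω => Real.exp (s * X ω) + Real.exp (-s * X ω)) P :=
  (h.integrable_exp_mul s).add (h.integrable_exp_mul (-s))

lemma integral_exp_add_exp_le {X : Ω → ℝ} {c : ℝ≥0} (h : HasSubgaussianMGF X c P) (s : ℝ) :
    ∫ ω, (Real.exp (s * X ω) + Real.exp (-s * X ω)) ∂P ≤ 2 * Real.exp (c * s ^ 2 / 2) := by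
  rw [integral_add (h.integrable_exp_mul s) (h.integrable_exp_mul (-s))]
  have h1 := h.mgf_le s
  have h2 := h.mgf_le (-s)
  rw [neg_sq] at h2
  simp only [mgf] at h1 h2
  linarith

/-- An exponential majorant of the indicator of the event that the sum of the noise over the set
`R` is large. -/
noncomputable def exceedance (σ γ : ℝ) (R : Finset (Fin d → Fin N)) (y : (Fin d → Fin N) → ℝ) : ℝ :=
  Real.exp (-(γ ^ 2 / σ ^ 2)) * (Real.exp (γ / (σ ^ 2 * √(R.card : ℝ)) * ∑ τ ∈ R, y τ) +
    Real.exp (-(γ / (σ ^ 2 * √(R.card : ℝ))) * ∑ τ ∈ R, y τ))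

lemma exceedance_nonneg (σ γ : ℝ) (R : Finset (Fin d → Fin N)) (y : (Fin d → Fin N) → ℝ) :
    0 ≤ exceedance σ γ R y := by
  unfold exceedance; positivity

/-- Chernoff's argument as a pointwise inequality: above the threshold, the tilted exponential
compensates the prefactor exp(-γ²/σ²). -/
lemma one_le_exceedance {σ γ : ℝ} (hσ : 0 < σ) (hγ : 0 ≤ γ) {R : Finset (Fin d → Fin N)}
    (hR : R.Nonempty) {y : (Fin d → Fin N) → ℝ} (h : γ < |∑ τ ∈ R, y τ| / √(R.card : ℝ)) :
    1 ≤ exceedance σ γ R y := by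
  have hc : 0 < √(R.card : ℝ) := Real.sqrt_pos.2 (by exact_mod_cast hR.card_pos)
  rw [lt_div_iff₀ hc] at h
  have h1 := exp_mul_abs_le (γ / (σ ^ 2 * √(R.card : ℝ))) (∑ τ ∈ R, y τ)
  have h2 : γ ^ 2 / σ ^ 2 ≤ γ / (σ ^ 2 * √(R.card : ℝ)) * |∑ τ ∈ R, y τ| := by
    calc γ ^ 2 / σ ^ 2 = γ / (σ ^ 2 * √(R.card : ℝ)) * (γ * √(R.card : ℝ)) := by field_simp
      _ ≤ _ := mul_le_mul_of_nonneg_left h.le (by positivity)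
  calc (1 : ℝ) = Real.exp (-(γ ^ 2 / σ ^ 2)) * Real.exp (γ ^ 2 / σ ^ 2) := by
        rw [← Real.exp_add, neg_add_cancel, Real.exp_zero]
    _ ≤ Real.exp (-(γ ^ 2 / σ ^ 2)) *
        Real.exp (γ / (σ ^ 2 * √(R.card : ℝ)) * |∑ τ ∈ R, y τ|) := by gcongr
    _ ≤ _ := mul_le_mul_of_nonneg_left h1 (Real.exp_pos _).le

/-- A union bound over discrete boxes rather than cubes: there are only finitely many, indexed by
pairs of grid points, whatever the system. -/
lemma one_le_sum_exceedance {σ γ : ℝ} (hσ : 0 < σ) (hγ : 0 ≤ γ) {y : (Fin d → Fin N) → ℝ}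
    (h : γ < mrNorm 𝓑 y) :
    1 ≤ ∑ p : (Fin d → Fin N) × (Fin d → Fin N), exceedance σ γ (Finset.Icc p.1 p.2) y := by
  have h1 : ∃ B : 𝓑, γ < |∑ τ ∈ (B : Cube d).gridPoints N, y τ| /
      √((((B : Cube d).gridPoints N).card : ℕ) : ℝ) := by
    by_contra! h1
    exact absurd (Real.iSup_le h1 hγ) (not_le.2 h)
  obtain ⟨B, hB⟩ := h1
  have hne : ((B : Cube d).gridPoints N).Nonempty := by
    rw [Finset.nonempty_iff_ne_empty]
    intro he
    rw [he] at hB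
    simp at hB
    linarith
  obtain ⟨p, hp⟩ := (B : Cube d).exists_gridPoints_eq_Icc hne
  rw [hp] at hB hne
  exact (one_le_exceedance hσ hγ hne hB).trans (Finset.single_le_sum
    (f := fun p : (Fin d → Fin N) × (Fin d → Fin N) => exceedance σ γ (Finset.Icc p.1 p.2) y)
    (fun p _ => exceedance_nonneg _ _ _ _) (Finset.mem_univ p))

lemma integrable_exceedance {ξ : (Fin d → Fin N) → Ω → ℝ} {σ : ℝ≥0} (hindep : iIndepFun ξ P)
    (hsub : ∀ τ, HasSubgaussianMGF (ξ τ) (σ ^ 2) P) (γ : ℝ) (R : Finset (Fin d → Fin N)) :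
    Integrable (fun ω => exceedance σ γ R fun τ => ξ τ ω) P :=
  (integrable_exp_add_exp (HasSubgaussianMGF.sum_of_iIndepFun hindep (s := R)
    fun τ _ => hsub τ) _).const_mul _

/-- The tilt γ/(σ²√|R|) is the optimal one: the moment generating function contributes
exp(γ²/(2σ²)), half of the exponent in the prefactor. -/
lemma integral_exceedance_le {ξ : (Fin d → Fin N) → Ω → ℝ} {σ : ℝ≥0} (hσ : 0 < σ)
    (hindep : iIndepFun ξ P)
    (hsub : ∀ τ, HasSubgaussianMGF (ξ τ) (σ ^ 2) P) (γ : ℝ) (R : Finset (Fin d → Fin N)) :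
    ∫ ω, exceedance σ γ R (fun τ => ξ τ ω) ∂P ≤ 2 * Real.exp (-(γ ^ 2 / (2 * (σ : ℝ) ^ 2))) := by
  have hσ' : (0 : ℝ) < σ := hσ
  have h1 := integral_exp_add_exp_le (HasSubgaussianMGF.sum_of_iIndepFun hindep (s := R)
    fun τ _ => hsub τ) (γ / ((σ : ℝ) ^ 2 * √(R.card : ℝ)))
  unfold exceedance
  rw [integral_const_mul]
  refine (mul_le_mul_of_nonneg_left h1 (Real.exp_pos _).le).trans ?_
  rw [mul_left_comm, ← Real.exp_add]
  refine mul_le_mul_of_nonneg_left (Real.exp_le_exp.2 ?_) (by norm_num)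
  simp only [Finset.sum_const, nsmul_eq_mul, NNReal.coe_mul, NNReal.coe_natCast, NNReal.coe_pow]
  -- For an empty box the tilt is 0, being a division by zero, and only the prefactor remains.
  rcases Nat.eq_zero_or_pos R.card with h0 | h0
  · rw [h0]
    simp only [Nat.cast_zero, Real.sqrt_zero, mul_zero, zero_mul, zero_div, add_zero]
    rw [neg_le_neg_iff]
    exact div_le_div_of_nonneg_left (sq_nonneg _) (by positivity) (by nlinarith [sq_nonneg (σ : ℝ)])
  · have hc : (0 : ℝ) < R.card := by exact_mod_cast h0
    rw [div_pow, mul_pow, Real.sq_sqrt hc.le]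
    apply le_of_eq
    field_simp
    ring

/-- The expectation of a quantity which is controlled by the size of the noise, and better so
where the multiresolution norm of the noise is small. -/
theorem integral_le_of_noise_bounds [IsProbabilityMeasure P] {ξ : (Fin d → Fin N) → Ω → ℝ}
    {σ : ℝ≥0} (hσ : 0 < σ) (hindep : iIndepFun ξ P)
    (hsub : ∀ τ, HasSubgaussianMGF (ξ τ) (σ ^ 2) P) {γ T s G K : ℝ} (hγ : 0 ≤ γ) (hT : 0 ≤ T)
    (hs : 0 ≤ s) (hG : 0 ≤ G) (hK : 0 ≤ K) {X : Ω → ℝ} (hXi : Integrable X P)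
    (h1 : ∀ ω, mrNorm 𝓑 (fun τ => ξ τ ω) ≤ γ → X ω ≤ G)
    (h2 : ∀ ω B, 0 ≤ B → (∀ τ, |ξ τ ω| ≤ B) → X ω ≤ K * (1 + (N : ℝ) ^ k * B)) :
    ∫ ω, X ω ∂P ≤ G +
      K * (1 + (N : ℝ) ^ k * T) *
        (((N : ℝ) ^ d) ^ 2 * (2 * Real.exp (-(γ ^ 2 / (2 * (σ : ℝ) ^ 2))))) +
      K * (N : ℝ) ^ k * ((N : ℝ) ^ d *
        (Real.exp (-(s * T)) * (2 * Real.exp ((σ : ℝ) ^ 2 * (1 + s) ^ 2 / 2)))) := by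
  -- `U` dominates the indicator of large multiresolution norm, and `V` the excess of the largest
  -- |ξ| over `T`. Integrable majorants make it unnecessary to treat these events as measurable
  -- sets.
  set U : Ω → ℝ := fun ω => ∑ p : (Fin d → Fin N) × (Fin d → Fin N),
    exceedance σ γ (Finset.Icc p.1 p.2) fun τ => ξ τ ω with hU
  set V : Ω → ℝ := fun ω => ∑ τ, Real.exp (-(s * T)) *
    (Real.exp ((1 + s) * ξ τ ω) + Real.exp (-(1 + s) * ξ τ ω)) with hV
  have hU0 : ∀ ω, 0 ≤ U ω := fun ω => Finset.sum_nonneg fun p _ => exceedance_nonneg _ _ _ _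
  have hV0 : ∀ ω, 0 ≤ V ω := fun ω => Finset.sum_nonneg fun p _ => by positivity
  have hUi : Integrable U P :=
    integrable_finsetSum _ fun p _ => integrable_exceedance hindep hsub γ (Finset.Icc p.1 p.2)
  have hVi' : ∀ τ ∈ (Finset.univ : Finset (Fin d → Fin N)), Integrable (fun ω =>
      Real.exp (-(s * T)) * (Real.exp ((1 + s) * ξ τ ω) + Real.exp (-(1 + s) * ξ τ ω))) P :=
    fun τ _ => (integrable_exp_add_exp (hsub τ) (1 + s)).const_mul _
  have hVi : Integrable V P := integrable_finsetSum _ hVi'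
  have hUint : ∫ ω, U ω ∂P ≤
      ((N : ℝ) ^ d) ^ 2 * (2 * Real.exp (-(γ ^ 2 / (2 * (σ : ℝ) ^ 2)))) := by
    rw [hU, integral_finsetSum _ fun p _ => integrable_exceedance hindep hsub γ
      (Finset.Icc p.1 p.2)]
    refine (Finset.sum_le_sum fun p _ => integral_exceedance_le hσ hindep hsub γ
      (Finset.Icc p.1 p.2)).trans (le_of_eq ?_)
    simp [sq]
  have hVint : ∫ ω, V ω ∂P ≤ (N : ℝ) ^ d *
      (Real.exp (-(s * T)) * (2 * Real.exp ((σ : ℝ) ^ 2 * (1 + s) ^ 2 / 2))) := by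
    rw [hV, integral_finsetSum _ hVi']
    simp only [integral_const_mul]
    refine (Finset.sum_le_sum fun τ _ => mul_le_mul_of_nonneg_left
      (integral_exp_add_exp_le (hsub τ) (1 + s)) (Real.exp_pos _).le).trans (le_of_eq ?_)
    simp
  -- On the bad event every |ξ| is at most T + V. The part with T is multiplied by U ≥ 1, while the
  -- part with V is already small in mean.
  have hpt : ∀ ω, X ω ≤ G + K * (1 + (N : ℝ) ^ k * T) * U ω + K * (N : ℝ) ^ k * V ω := by
    intro ω
    have ha : 0 ≤ K * (1 + (N : ℝ) ^ k * T) := by positivity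
    have hb : 0 ≤ K * (N : ℝ) ^ k := by positivity
    have hbV := mul_nonneg hb (hV0 ω)
    rcases le_or_gt (mrNorm 𝓑 fun τ => ξ τ ω) γ with h | h
    · have := h1 ω h
      have := mul_nonneg ha (hU0 ω)
      linarith
    · have h3 : 1 ≤ U ω := one_le_sum_exceedance (σ := (σ : ℝ)) hσ hγ h
      have h4 := h2 ω (T + V ω) (add_nonneg hT (hV0 ω)) fun τ => by
        rcases le_or_gt |ξ τ ω| T with h5 | h5
        · linarith [hV0 ω]
        -- Above `T` the factor exp(s(|ξ| - T)) exceeds 1, which buys the small constant exp(-sT).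
        · have h6 : |ξ τ ω| ≤ Real.exp (-(s * T)) *
              (Real.exp ((1 + s) * ξ τ ω) + Real.exp (-(1 + s) * ξ τ ω)) := by
            calc |ξ τ ω| ≤ Real.exp |ξ τ ω| := by linarith [Real.add_one_le_exp |ξ τ ω|]
              _ ≤ Real.exp (-(s * T)) * Real.exp ((1 + s) * |ξ τ ω|) := by
                  rw [← Real.exp_add, Real.exp_le_exp]
                  nlinarith
              _ ≤ _ := mul_le_mul_of_nonneg_left (exp_mul_abs_le _ _) (Real.exp_pos _).le
          have h7 : _ ≤ V ω := Finset.single_le_sum (f := fun τ => Real.exp (-(s * T)) *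
            (Real.exp ((1 + s) * ξ τ ω) + Real.exp (-(1 + s) * ξ τ ω)))
            (fun τ _ => by positivity) (Finset.mem_univ τ)
          linarith
      have h5 : K * (1 + (N : ℝ) ^ k * T) * 1 ≤ K * (1 + (N : ℝ) ^ k * T) * U ω :=
        mul_le_mul_of_nonneg_left h3 ha
      nlinarith
  have hi1 : Integrable (fun ω => G + K * (1 + (N : ℝ) ^ k * T) * U ω) P :=
    (integrable_const G).add (hUi.const_mul _)
  have hi2 : Integrable (fun ω => K * (N : ℝ) ^ k * V ω) P := hVi.const_mul _
  refine (integral_mono hXi (hi1.add hi2) hpt).trans ?_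
  have e1 := integral_add hi1 hi2
  have e2 := integral_add (integrable_const (μ := P) G)
    (hUi.const_mul (K * (1 + (N : ℝ) ^ k * T)))
  simp only [integral_const_mul, integral_const, probReal_univ, smul_eq_mul, one_mul] at e1 e2
  refine (e1.trans (by rw [e2])).le.trans ?_
  gcongr

end Noise

/-! ### Crude bounds for the loss in terms of the largest noise value -/

section EstimatorBounds

variable {d : ℕ}

/-- Bounds for the loss of the estimator, in terms of the size of the noise only. -/
theorem exists_estimator_bounds (hd : 1 ≤ d) {k : ℕ} (hk : d < 2 * k) {q : ℝ≥0∞} (hq : 1 ≤ q)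
    (𝓑 : Set (Cube d)) {f : (Fin d → ℝ) → ℝ} (hf : MemHk0 k f) :
    ∃ K : ℝ, 0 ≤ K ∧ ∀ N : ℕ, 1 ≤ N → ∀ γ : ℝ, 0 ≤ γ →
      (∀ y y' : (Fin d → Fin N) → ℝ, ∀ u u', IsMIND k 𝓑 y γ u → IsMIND k 𝓑 y' γ u' →
        ∀ B, 0 ≤ B → (∀ τ, |y τ - y' τ| ≤ B) →
          |lqNorm q (fun x => u x - f x) - lqNorm q (fun x => u' x - f x)| ≤
            K * (N : ℝ) ^ k * B) ∧
      (∀ (y : (Fin d → Fin N) → ℝ) (u : (Fin d → ℝ) → ℝ), IsMIND k 𝓑 y γ u →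
        ∀ B, 0 ≤ B → (∀ τ, |y τ - sample N f τ| ≤ B) →
          lqNorm q (fun x => u x - f x) ≤ K * (1 + (N : ℝ) ^ k * B)) := by
  obtain ⟨K₁, hK₁, hsob⟩ := exists_abs_le_sobolevNorm hk
  obtain ⟨K₂, hK₂, hint⟩ := exists_interpolant hd k
  have hsob' : ∀ g, MemHk0 k g → lqNorm q g ≤ K₁ * sobolevNorm k g := fun g hg =>
    lqNorm_le_of_forall q (mul_nonneg hK₁ (sobolevNorm_nonneg _ _)) (hsob g hg)
  have hD := sobolevNorm_nonneg k f
  refine ⟨K₁ * (2 * sobolevNorm k f + K₂), by positivity, fun N hN γ hγ => ⟨?_, ?_⟩⟩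
  · intro y y' u u' hu hu' B hB hy
    obtain ⟨h, hh, hs, hbd⟩ := hint N hN (y - y')
    have h1 := hu.sobolevNorm_sub_le hu' hh hs
    have h2 := hbd B hB hy
    have h3 := hsob' _ (hu.1.sub hu'.1)
    have h3' := hsob' _ (hu'.1.sub hu.1)
    rw [sobolevNorm_sub_comm hu'.1 hu.1] at h3'
    have h4 : K₁ * sobolevNorm k (fun x => u x - u' x) ≤
        K₁ * (2 * sobolevNorm k f + K₂) * (N : ℝ) ^ k * B := by
      have h5 : 0 ≤ K₁ * (2 * sobolevNorm k f) * (N : ℝ) ^ k * B := by positivity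
      have h6 := mul_le_mul_of_nonneg_left (h1.trans h2) hK₁
      linarith
    have h5 := lqNorm_sub_le hq (hu.1.sub hf).continuous (hu'.1.sub hf).continuous
    have h6 := lqNorm_sub_le hq (hu'.1.sub hf).continuous (hu.1.sub hf).continuous
    simp only [sub_sub_sub_cancel_right] at h5 h6
    rw [abs_le]
    constructor <;> linarith
  · intro y u hu B hB hy
    obtain ⟨h, hh, hs, hbd⟩ := hint N hN (y - sample N f)
    have h1 := hu.sobolevNorm_sub_le_interpolant hγ hf hh hs
    have h2 := hbd B hB hy
    have h3 := hsob' _ (hu.1.sub hf)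
    have h4 := mul_le_mul_of_nonneg_left (h1.trans (add_le_add le_rfl h2)) hK₁
    have h5 : 0 ≤ K₁ * K₂ := by positivity
    have h6 : 0 ≤ K₁ * (2 * sobolevNorm k f) * ((N : ℝ) ^ k * B) := by positivity
    linarith

end EstimatorBounds

end MIND
namespace MIND

/-! ### Growth comparisons, with x standing for n and a for k/d -/

section Asymptotics

lemma eventually_one_le_log : ∀ᶠ x : ℝ in atTop, 1 ≤ Real.log x :=
  Real.tendsto_log_atTop.eventually_ge_atTop 1

lemma eventually_log_rpow_le (r : ℝ) {s ε : ℝ} (hs : 0 < s) (hε : 0 < ε) :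
    ∀ᶠ x : ℝ in atTop, Real.log x ^ r ≤ ε * x ^ s := by
  filter_upwards [(isLittleO_log_rpow_rpow_atTop r hs).bound hε, eventually_one_le_log,
    eventually_gt_atTop 0] with x h1 h2 h3
  rwa [Real.norm_of_nonneg (by positivity), Real.norm_of_nonneg (by positivity)] at h1

/-- Secures the hypothesis A ≤ Δ of the interpolation inequality; here μ < 1/2 is needed. -/
lemma eventually_threshold_le {C r μ Δ : ℝ} (hC : 0 < C) (hμ : μ < 1 / 2) (hΔ : 0 < Δ) :
    ∀ᶠ x : ℝ in atTop, 2 * (C * Real.log x ^ r) / √x ≤ Δ * x ^ (-μ) := by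
  filter_upwards [eventually_log_rpow_le r (s := 1 / 2 - μ) (ε := Δ / (2 * C)) (by linarith)
    (by positivity), eventually_gt_atTop 0] with x h1 h2
  rw [Real.sqrt_eq_rpow, div_le_iff₀ (by positivity), mul_assoc, ← Real.rpow_add h2]
  calc 2 * (C * Real.log x ^ r) = 2 * C * Real.log x ^ r := by ring
    _ ≤ 2 * C * (Δ / (2 * C) * x ^ (1 / 2 - μ)) := by gcongr
    _ = Δ * x ^ (-μ + 1 / 2) := by rw [neg_add_eq_sub]; field_simp

/-- Secures the upper bound on Δ in the interpolation inequality; here k > d/2 enters as a > 1/2. -/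
lemma eventually_le_threshold {C r μ Δ a c : ℝ} (hC : 0 < C) (hr : 0 ≤ r) (hμ : 0 ≤ μ) (hΔ : 0 < Δ)
    (ha : 1 / 2 < a) (hc : 0 < c) :
    ∀ᶠ x : ℝ in atTop, Δ * x ^ (-μ) ≤ 2 * (C * Real.log x ^ r) / √x * (c * x ^ a) := by
  filter_upwards [(tendsto_rpow_atTop (sub_pos.2 ha)).eventually_ge_atTop (Δ / (2 * C * c)),
    eventually_one_le_log, eventually_ge_atTop 1] with x h1 h2 h3
  have hx : 0 < x := by linarith
  have h4 : x ^ (-μ) ≤ 1 := Real.rpow_le_one_of_one_le_of_nonpos h3 (by linarith)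
  have h5 : 1 ≤ Real.log x ^ r := Real.one_le_rpow h2 hr
  calc Δ * x ^ (-μ) ≤ Δ * 1 := by gcongr
    _ = 2 * C * c * (Δ / (2 * C * c)) := by field_simp
    _ ≤ 2 * C * c * x ^ (a - 1 / 2) := by gcongr
    _ = 2 * (C * 1) / √x * (c * x ^ a) := by
      rw [Real.sqrt_eq_rpow, Real.rpow_sub hx]; ring
    _ ≤ _ := by gcongr

/-- For r = 1/2 the condition on C says exactly that C²/(2σ²) > a + 5/2; for r > 1/2 the power (log
x)^{2r} outgrows every multiple of log x. -/
lemma exists_exponent {σ C r a : ℝ} (hσ : 0 < σ) (hC : 0 < C) (hr : 1 / 2 ≤ r)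
    (hCσ : r = 1 / 2 → σ * √(5 + 2 * a) < C) (ha : 0 < a) :
    ∃ β, a + 5 / 2 < β ∧ ∀ᶠ x : ℝ in atTop,
      β * Real.log x ≤ (C * Real.log x ^ r) ^ 2 / (2 * σ ^ 2) := by
  rcases hr.eq_or_lt with h | h
  · refine ⟨C ^ 2 / (2 * σ ^ 2), ?_, ?_⟩
    · have h1 := pow_lt_pow_left₀ (hCσ h.symm) (by positivity) two_ne_zero
      rw [mul_pow, Real.sq_sqrt (by positivity)] at h1
      rw [lt_div_iff₀ (by positivity)]
      linarith
    · filter_upwards [eventually_one_le_log] with x hx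
      rw [← h, ← Real.sqrt_eq_rpow, mul_pow, Real.sq_sqrt (by linarith)]
      exact le_of_eq (by ring)
  · refine ⟨a + 3, by linarith, ?_⟩
    have h1 : Tendsto (fun x => Real.log x ^ (2 * r - 1)) atTop atTop :=
      (tendsto_rpow_atTop (by linarith)).comp Real.tendsto_log_atTop
    filter_upwards [eventually_one_le_log,
      h1.eventually_ge_atTop ((a + 3) * (2 * σ ^ 2) / C ^ 2)] with x hx h2
    have hL : 0 < Real.log x := by linarith
    rw [le_div_iff₀ (by positivity)]
    rw [div_le_iff₀ (by positivity)] at h2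
    have h3 : (Real.log x ^ r) ^ 2 = Real.log x ^ (2 * r - 1) * Real.log x := by
      rw [← Real.rpow_natCast, ← Real.rpow_mul hL.le, ← Real.rpow_add_one hL.ne']
      congr 1
      push_cast; ring
    rw [mul_pow, h3]
    nlinarith

/-- A loss of order x^a log x, times x² boxes, times the tail x^{-β}, stays below x^{-1/2} precisely
because β > a + 5/2. -/
lemma eventually_exceedance_le {σ C r a : ℝ} (hσ : 0 < σ) (hC : 0 < C) (hr : 1 / 2 ≤ r)
    (hCσ : r = 1 / 2 → σ * √(5 + 2 * a) < C) (ha : 0 < a) :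
    ∀ᶠ x : ℝ in atTop, (1 + x ^ a * Real.log x) *
      (x ^ 2 * (2 * Real.exp (-((C * Real.log x ^ r) ^ 2 / (2 * σ ^ 2))))) ≤ x ^ (-(1 / 2) : ℝ) := by
  obtain ⟨β, hβ, hev⟩ := exists_exponent hσ hC hr hCσ ha
  filter_upwards [hev, eventually_one_le_log, eventually_ge_atTop 1,
    eventually_log_rpow_le 1 (s := β - a - 5 / 2) (ε := 1 / 4) (by linarith) (by norm_num)]
    with x h1 h2 h3 h4
  have hx : 0 < x := by linarith
  rw [Real.rpow_one] at h4
  have h5 : Real.exp (-((C * Real.log x ^ r) ^ 2 / (2 * σ ^ 2))) ≤ x ^ (-β) := by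
    rw [Real.rpow_def_of_pos hx, Real.exp_le_exp]
    linarith
  have h6 : 1 ≤ x ^ a * Real.log x :=
    one_le_mul_of_one_le_of_one_le (Real.one_le_rpow h3 ha.le) h2
  calc _ ≤ (x ^ a * Real.log x + x ^ a * Real.log x) * (x ^ 2 * (2 * x ^ (-β))) := by gcongr
    _ = 4 * (x ^ a * x ^ 2 * x ^ (-β)) * Real.log x := by ring
    _ ≤ 4 * (x ^ a * x ^ 2 * x ^ (-β)) * (1 / 4 * x ^ (β - a - 5 / 2)) := by gcongr
    _ = x ^ a * x ^ (2 : ℝ) * x ^ (-β) * x ^ (β - a - 5 / 2) := by rw [Real.rpow_two]; ring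
    _ = _ := by
      rw [← Real.rpow_add hx, ← Real.rpow_add hx, ← Real.rpow_add hx]
      congr 1; ring

lemma tail_le {x a : ℝ} (hx : 1 ≤ x) :
    x ^ a * (x * Real.exp (-((a + 2) * Real.log x))) ≤ x ^ (-(1 / 2) : ℝ) := by
  have hx0 : 0 < x := by linarith
  have h1 : Real.exp (-((a + 2) * Real.log x)) = x ^ (-(a + 2)) := by
    rw [Real.rpow_def_of_pos hx0]; congr 1; ring
  rw [h1]
  calc x ^ a * (x * x ^ (-(a + 2))) = x ^ (-1 : ℝ) := by
        nth_rewrite 2 [← Real.rpow_one x]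
        rw [← Real.rpow_add hx0, ← Real.rpow_add hx0]
        congr 1; ring
    _ ≤ _ := Real.rpow_le_rpow_of_exponent_le hx (by norm_num)

/-- The bad event contributes O(x^{-1/2}), and -1/2 = -(1/2)(1 - 2θ) - θ is at most the target
exponent as μ < 1/2. -/
lemma rpow_neg_half_le {x μ θ r : ℝ} (hx : 1 ≤ x) (hL : 1 ≤ Real.log x) (hμ : μ < 1 / 2)
    (hθ0 : 0 ≤ θ) (hθ : θ ≤ 1 / 2) (hr : 0 ≤ r) :
    x ^ (-(1 / 2) : ℝ) ≤ x ^ (-μ * (1 - 2 * θ) - θ) * Real.log x ^ (2 * r * θ) := by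
  have h1 : 1 ≤ Real.log x ^ (2 * r * θ) := Real.one_le_rpow hL (by positivity)
  have h2 : x ^ (-(1 / 2) : ℝ) ≤ x ^ (-μ * (1 - 2 * θ) - θ) :=
    Real.rpow_le_rpow_of_exponent_le hx (by nlinarith)
  have h3 : 0 < x := by linarith
  exact h2.trans (le_mul_of_one_le_right (by positivity) h1)

/-- Collecting powers, A occurs with exponent 2θ; its factors x^{-1/2} and (log x)^r give x^{-θ} and
(log x)^{2rθ}. -/
lemma rate_eq {x μ θ r C Δ : ℝ} (hx : 0 < x) (hL : 0 < Real.log x) (hC : 0 < C) (hΔ : 0 < Δ) :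
    2 * (C * Real.log x ^ r) / √x * (Δ * x ^ (-μ) / (2 * (C * Real.log x ^ r) / √x)) ^
      (1 - 2 * θ) = (2 * C) ^ (2 * θ) * Δ ^ (1 - 2 * θ) *
        (x ^ (-μ * (1 - 2 * θ) - θ) * Real.log x ^ (2 * r * θ)) := by
  set A := 2 * (C * Real.log x ^ r) / √x with hA
  have hA0 : 0 < A := by positivity
  have h1 : A = 2 * C * Real.log x ^ r * x ^ (-(1 / 2) : ℝ) := by
    rw [hA, Real.sqrt_eq_rpow, Real.rpow_neg hx.le]; field_simp
  have h2 : A * (Δ * x ^ (-μ) / A) ^ (1 - 2 * θ) = A ^ (2 * θ) * (Δ * x ^ (-μ)) ^ (1 - 2 * θ) := by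
    rw [Real.div_rpow (by positivity) hA0.le, show A ^ (2 * θ) = A / A ^ (1 - 2 * θ) by
      rw [eq_div_iff (by positivity), ← Real.rpow_add hA0]
      norm_num]
    ring
  rw [h2, h1, Real.mul_rpow (by positivity) (by positivity), Real.mul_rpow (by positivity)
    (by positivity), Real.mul_rpow (by positivity) (by positivity),
    Real.mul_rpow (x := Δ) hΔ.le (by positivity), ← Real.rpow_mul hL.le, ← Real.rpow_mul hx.le, ← Real.rpow_mul hx.le, show r * (2 * θ) = 2 * r * θ by ring,
    show -μ * (1 - 2 * θ) - θ = -(1 / 2) * (2 * θ) + -μ * (1 - 2 * θ) by ring, Real.rpow_add hx]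
  ring

end Asymptotics

/-! ### The distance function and the error for small noise -/

section GoodEvent

variable {d N k : ℕ} {𝓑 : Set (Cube d)} {f : (Fin d → ℝ) → ℝ}

lemma distFun_nonneg (t : ℝ) : 0 ≤ distFun k 𝓑 f N t := by
  refine Real.sInf_nonneg ?_
  rintro s ⟨w, u, -, -, rfl⟩
  exact sobolevNorm_nonneg _ _

/-- With γ = C L^r the term √(2γt) equals √(2C) L^{r/2} t^{1/2}, so both summands of the
deterministic bound are absorbed by one constant, for every t. -/
lemma IsMIND.sobolevNorm_sub_le_iInf {y : (Fin d → Fin N) → ℝ} {u : (Fin d → ℝ) → ℝ} {C L r : ℝ}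
    (hC : 0 < C) (hL : 0 < L) (hu : IsMIND k 𝓑 y (C * L ^ r) u) (hf : MemHk0 k f)
    (hfy : mrNorm 𝓑 (sample N f - y) ≤ C * L ^ r) :
    sobolevNorm k (fun x => u x - f x) ≤ (1 + √(2 * C)) *
      ⨅ t : ℝ≥0, (distFun k 𝓑 f N t + L ^ (r / 2) * (t : ℝ) ^ (1 / 2 : ℝ)) := by
  rw [← div_le_iff₀' (by positivity)]
  refine le_ciInf fun t => ?_
  rw [div_le_iff₀' (by positivity)]
  have h1 := hu.sobolevNorm_sub_le_distFun (by positivity) hf hfy t.coe_nonneg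
  have h2 : √(2 * (C * L ^ r) * t) = √(2 * C) * (L ^ (r / 2) * (t : ℝ) ^ (1 / 2 : ℝ)) := by
    rw [← mul_assoc 2 C, mul_assoc (2 * C), Real.sqrt_mul (x := 2 * C) (by positivity),
      Real.sqrt_mul (x := L ^ r) (by positivity),
      ← Real.sqrt_eq_rpow, Real.sqrt_eq_rpow (L ^ r), ← Real.rpow_mul hL.le]
    congr 3
    ring
  have h3 := distFun_nonneg (k := k) (𝓑 := 𝓑) (f := f) (N := N) t
  have h4 : 0 ≤ L ^ (r / 2) * (t : ℝ) ^ (1 / 2 : ℝ) := by positivity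
  have h5 := Real.sqrt_nonneg (2 * C)
  rw [h2] at h1
  refine h1.trans ?_
  nlinarith [mul_nonneg h5 h3]

end GoodEvent

end MIND
-- Assembly of the risk bound
theorem mainTheorem3
    {Ω : Type*} [MeasurableSpace Ω] (P : Measure Ω) [IsProbabilityMeasure P]
    (d k : ℕ) (hd : 1 ≤ d) (hk : (d : ℝ) / 2 < k)
    (q : ℝ≥0∞) (hq : 1 ≤ q)
    (𝓑 : Set (Cube d)) (h𝓑 : IsNormal 𝓑)
    -- the truth
    (f : (Fin d → ℝ) → ℝ) (hf : MemHk0 k f)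
    -- for each grid with `N ^ d` points, i.i.d. sub-Gaussian noise with scale parameter `σ`
    (σ : ℝ≥0) (hσ : 0 < σ)
    (ξ : (N : ℕ) → (Fin d → Fin N) → Ω → ℝ)
    (hindep : ∀ N, 1 ≤ N → iIndepFun (ξ N) P)
    (hident : ∀ N, 1 ≤ N → ∀ τ τ', IdentDistrib (ξ N τ) (ξ N τ') P P)
    (hsub : ∀ N, 1 ≤ N → ∀ τ, HasSubgaussianMGF (ξ N τ) (σ ^ 2) P)
    -- the threshold `γ_n = C (log n) ^ r`
    (r C : ℝ) (hr : 1 / 2 ≤ r) (hC : 0 < C)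
    (hCσ : r = 1 / 2 → (σ : ℝ) * √(5 + 2 * (k : ℝ) / d) < C)
    (γ : ℕ → ℝ) (hγ : ∀ N, γ N = C * Real.log ((N : ℝ) ^ d) ^ r)
    -- the estimator
    (fhat : ℕ → Ω → (Fin d → ℝ) → ℝ)
    (hfhat : ∀ N, 1 ≤ N → ∀ ω,
      IsMIND k 𝓑 (fun τ => sample N f τ + ξ N τ ω) (γ N) (fhat N ω))
    -- the decay of the distance functions
    (μ : ℝ) (hμ0 : 0 ≤ μ) (hμ : μ < 1 / 2)
    (hdist : (fun N : ℕ => ⨅ t : ℝ≥0,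
        (distFun k 𝓑 f N t + Real.log ((N : ℝ) ^ d) ^ (r / 2) * (t : ℝ) ^ (1 / 2 : ℝ)))
      =O[atTop] fun N : ℕ => ((N : ℝ) ^ d) ^ (-μ)) :
    (∀ N, 1 ≤ N → Integrable (fun ω => lqNorm q (fun x => fhat N ω x - f x)) P) ∧
      (fun N : ℕ => ∫ ω, lqNorm q (fun x => fhat N ω x - f x) ∂P)
        =O[atTop] fun N : ℕ =>
          ((N : ℝ) ^ d) ^ (-μ * (1 - 2 * theta k d q) - theta k d q) *
            Real.log ((N : ℝ) ^ d) ^ (2 * r * theta k d q) := by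
  have hkd : d < 2 * k := by
    have : (d : ℝ) < 2 * k := by linarith
    exact_mod_cast this
  have hd0 : (0 : ℝ) < d := by exact_mod_cast hd
  have hk0 : (0 : ℝ) < k := by linarith [half_pos hd0]
  have hσ' : (0 : ℝ) < σ := hσ
  have hr0 : 0 ≤ r := by linarith
  obtain ⟨K₁, c₀, hK₁, hc₀, hinterp⟩ := exists_lqNorm_le hd hkd h𝓑 hq
  obtain ⟨K₂, hK₂, hest⟩ := exists_estimator_bounds hd hkd hq 𝓑 hf
  have hlog : ∀ N : ℕ, 1 ≤ N → 0 ≤ Real.log ((N : ℝ) ^ d) := fun N hN =>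
    Real.log_nonneg (one_le_pow₀ (by exact_mod_cast hN))
  have hγ0 : ∀ N, 1 ≤ N → 0 ≤ γ N := fun N hN => by
    rw [hγ]
    exact mul_nonneg hC.le (Real.rpow_nonneg (hlog N hN) _)
  have hint : ∀ N, 1 ≤ N → Integrable (fun ω => lqNorm q (fun x => fhat N ω x - f x)) P := by
    intro N hN
    refine integrable_of_lipschitz (fun τ => (hsub N hN τ).integrable)
      (L := K₂ * (N : ℝ) ^ k) (by positivity) fun ω ω' B hB hωω' => ?_
    refine (hest N hN _ (hγ0 N hN)).1 _ _ _ _ (hfhat N hN ω) (hfhat N hN ω') B hB fun τ => ?_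
    rw [add_sub_add_left_eq_sub]
    exact hωω' τ
  refine ⟨hint, ?_⟩
  obtain ⟨c, hc, hdist'⟩ := hdist.exists_pos
  rw [IsBigOWith] at hdist'
  set Δ := (1 + √(2 * C)) * c with hΔ
  have hΔ0 : 0 < Δ := by positivity
  set a := (k : ℝ) / d with ha
  have ha2 : 1 / 2 < a := by rw [ha, lt_div_iff₀ hd0]; linarith
  have ha0 : 0 < a := by linarith
  have hCσ' : r = 1 / 2 → (σ : ℝ) * √(5 + 2 * a) < C := fun h => by
    rw [ha, ← mul_div_assoc]; exact hCσ h
  set θ := theta k d q with hθ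
  have hθ0 : 0 ≤ θ := theta_nonneg hkd q
  have hθ1 : θ ≤ 1 / 2 := theta_le_half hd hkd q
  -- The moment factor of `integral_le_of_noise_bounds` for s = a + 2; it is independent of N.
  set E := 2 * Real.exp ((σ : ℝ) ^ 2 * (1 + (a + 2)) ^ 2 / 2) with hE
  have htop : Tendsto (fun N : ℕ => (N : ℝ) ^ d) atTop atTop :=
    (tendsto_pow_atTop (by omega)).comp tendsto_natCast_atTop_atTop
  refine IsBigO.of_bound (K₁ * ((2 * C) ^ (2 * θ) * Δ ^ (1 - 2 * θ)) + K₂ + K₂ * E) ?_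
  filter_upwards [hdist', eventually_ge_atTop 1,
    htop.eventually (eventually_threshold_le (r := r) hC hμ hΔ0),
    htop.eventually (eventually_le_threshold hC hr0 hμ0 hΔ0 ha2 (pow_pos hc₀ k)),
    htop.eventually (eventually_exceedance_le hσ' hC hr hCσ' ha0),
    htop.eventually eventually_one_le_log] with N hdN hN hAΔ hΔA hexc hL
  have hN1 : (1 : ℝ) ≤ N := by exact_mod_cast hN
  have hpow : (N : ℝ) ^ k = ((N : ℝ) ^ d) ^ a := by
    rw [← Real.rpow_natCast _ d, ← Real.rpow_mul (by positivity), ha, mul_div_cancel₀ _ hd0.ne',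
      Real.rpow_natCast]
  have hx1 : 1 ≤ (N : ℝ) ^ d := one_le_pow₀ hN1
  have hγN := hγ N
  have hMIND := hfhat N hN
  have hest2 := (hest N hN _ (hγ0 N hN)).2
  rw [hγN] at hMIND
  set x := (N : ℝ) ^ d with hx
  have hx0 : 0 < x := by linarith
  have hL0 : 0 < Real.log x := by linarith
  set A := 2 * (C * Real.log x ^ r) / √x with hA
  have hA0 : 0 < A := by positivity
  set target := x ^ (-μ * (1 - 2 * θ) - θ) * Real.log x ^ (2 * r * θ) with htarget
  have htarget0 : 0 < target := by positivity
  have hhalf : x ^ (-(1 / 2) : ℝ) ≤ target := rpow_neg_half_le hx1 hL hμ hθ0 hθ1 hr0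
  -- On this event `f` is feasible, so the Sobolev bound and the multiresolution bound on the
  -- samples feed the interpolation inequality.
  have hgood : ∀ ω, mrNorm 𝓑 (fun τ => ξ N τ ω) ≤ C * Real.log x ^ r →
      lqNorm q (fun x => fhat N ω x - f x) ≤
        K₁ * ((2 * C) ^ (2 * θ) * Δ ^ (1 - 2 * θ) * target) := by
    intro ω hω
    have hfy : mrNorm 𝓑 (sample N f - fun τ => sample N f τ + ξ N τ ω) ≤
        C * Real.log x ^ r := by
      have h1 : (sample N f - fun τ => sample N f τ + ξ N τ ω) = -fun τ => ξ N τ ω := by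
        ext τ; simp
      rw [h1, mrNorm_neg]
      exact hω
    have h1 := (hMIND ω).sobolevNorm_sub_le_iInf hC hL0 hf hfy
    have h2 : sobolevNorm k (fun z => fhat N ω z - f z) ≤ Δ * x ^ (-μ) := by
      refine h1.trans ?_
      rw [hΔ, mul_assoc]
      refine mul_le_mul_of_nonneg_left ?_ (by positivity)
      rw [Real.norm_of_nonneg (Real.rpow_nonneg hx0.le _)] at hdN
      exact (le_abs_self _).trans hdN
    have h3 := (hMIND ω).mrNorm_sample_sub_le hfy
    rw [← rate_eq hx0 hL0 hC hΔ0]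
    refine hinterp N hN _ ((hMIND ω).1.sub hf) A (Δ * x ^ (-μ)) hA0 hAΔ ?_ ?_ h2
    · rw [mul_pow, hpow]
      exact hΔA
    · rw [hA, div_mul_cancel₀ _ (by positivity)]
      exact h3
  have hbad : ∀ ω B, 0 ≤ B → (∀ τ, |ξ N τ ω| ≤ B) →
      lqNorm q (fun x => fhat N ω x - f x) ≤ K₂ * (1 + (N : ℝ) ^ k * B) := fun ω B hB hξ =>
    hest2 _ _ (hfhat N hN ω) B hB fun τ => by
      rw [add_sub_cancel_left]
      exact hξ τ
  -- With T = log n and s = a + 2, the values beyond T contribute n^a · n · n^{-(a+2)} = n^{-1}, up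
  -- to constants.
  have hfinal := integral_le_of_noise_bounds (T := Real.log x) (s := a + 2) hσ (hindep N hN)
    (hsub N hN) (mul_nonneg hC.le (Real.rpow_nonneg hL0.le r)) hL0.le (by linarith)
    (by positivity) hK₂ (hint N hN) hgood hbad
  rw [Real.norm_of_nonneg (integral_nonneg fun ω => lqNorm_nonneg _ _),
    Real.norm_of_nonneg htarget0.le]
  refine hfinal.trans ?_
  rw [← hx, hpow]
  have h1 : K₂ * (1 + x ^ a * Real.log x) * (x ^ 2 *
      (2 * Real.exp (-((C * Real.log x ^ r) ^ 2 / (2 * (σ : ℝ) ^ 2))))) ≤ K₂ * target := by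
    rw [mul_assoc]
    exact mul_le_mul_of_nonneg_left (hexc.trans hhalf) hK₂
  have h2 : K₂ * x ^ a * (x * (Real.exp (-((a + 2) * Real.log x)) * E)) ≤ K₂ * E * target := by
    calc _ = K₂ * E * (x ^ a * (x * Real.exp (-((a + 2) * Real.log x)))) := by ring
      _ ≤ _ := mul_le_mul_of_nonneg_left ((tail_le hx1).trans hhalf) (by positivity)
  calc _ ≤ K₁ * ((2 * C) ^ (2 * θ) * Δ ^ (1 - 2 * θ) * target) + K₂ * target +
        K₂ * E * target := add_le_add (add_le_add le_rfl h1) h2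
    _ = _ := by ring
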